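/- **Theorem (Kubo formula for time-reversal invariant random Schrödinger operators on $\mathbb Z^d$).** *Setting.* Let $k:\mathbb Z^d\to\mathbb R$ satisfy $k(-a)=k(a)$ and $\sum_a(1+|a|)\,|k(a)|<\infty$, let $\lambda\in\mathbb R$, and let $V=\{V_x\}_{x\in\mathbb Z^d}$ be a real random potential whose law is invariant under the lattice translations (for instance i.i.d.). Let $H=K+\lambda V$ be the self-adjoint operator on $\ell^2(\mathbb Z^d)$ with $K_{x,y}=k(x-y)$ and domain $\{\psi:\lambda V\psi\in\ell^2\}$. Let $P_B=1_B(H)$ be its spectral projections, $v_i=\mathrm i[H,x_i]$ the (bounded) velocity operators, $G(x,y;z)=\langle x|(H-z)^{-1}|y\rangle$, and $\mathrm{Tr}\,A=\mathbb E\,\langle 0|A|0\rangle$ the trace per unit volume. Let $m_{ij}$ be the complex measure on $\mathbb R^2$ determined by $$m_{ij}(A\times B)=\mathrm{Tr}\,(P_A\,v_i\,P_B\,v_j)\qquad (A,B\subset\mathbb R\ \text{Borel}).$$ For $T>0$ and $E_F\in\mathbb R$ let $f(E)=f_T(E)=(1+e^{(E-E_F)/T})^{-1}$, let $\delta_\eta(u)=\frac{\eta}{\pi}\,(u^2+\eta^2)^{-1}$,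 and put $$\sigma_{ij}(T,\eta)=-\pi\iint \delta_\eta(t-s)\,\frac{f(t)-f(s)}{t-s}\,m_{ij}(dt,ds),\qquad \sigma_{ij}(T)=\lim_{\eta\downarrow0}\sigma_{ij}(T,\eta),$$ where the quotient is read as $f'(t)$ when $t=s$; $\sigma_{ij}(T)$ is the Kubo conductivity at temperature $T$. Let $$\tilde\sigma_{ij}(E)=\lim_{\eta\downarrow0}\frac{\eta^2}{\pi}\sum_{x\in\mathbb Z^d}x_ix_j\,\mathbb E\,|G(0,x;E+\mathrm i\eta)|^2 ,$$ whenever this limit exists in $\mathbb R$. *Assumption.* There is a finite constant $C$ such that $$\eta^2\sum_{x\in\mathbb Z^d}x^2\,\mathbb E\,|G(0,x;E+\mathrm i\eta)|^2\le C\qquad\text{for all }\eta>0\text{ and all }E\in\mathbb R .$$ *Conclusions.* For all $i,j$ and all $E_F\in\mathbb R$: 1. If the limit $\tilde\sigma_{ij}(E)$ exists for every $E\in\mathbb R$, then for every $T>0$ the function $f'\tilde\sigma_{ij}$ is integrable, the limit $\sigma_{ij}(T)$ exists, and $$\sigma_{ij}(T)=-\int_{\mathbb R} f'(E)\,\tilde\sigma_{ij}(E)\,dE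 .$$ 2. If, instead, $\tilde\sigma_{ij}(E)$ is only assumed to exist for $E$ in some neighbourhood of $E_F$ and to be continuous there, then $$\lim_{T\downarrow0}\ \limsup_{\eta\downarrow0}\ \bigl|\sigma_{ij}(T,\eta)-\tilde\sigma_{ij}(E_F)\bigr|=0 ;$$ that is, $\lim_{T\downarrow0}\sigma_{ij}(T)=\tilde\sigma_{ij}(E_F)$, where for each $T$ the limit $\eta\downarrow0$ may be taken along an arbitrary subsequence for which it exists. -/

import Mathlib

open MeasureTheory Filter Topology
open scoped ENNReal NNReal

noncomputable section

namespace Kubo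

/-! ### Unbounded self-adjoint operators: resolvent and spectral resolution -/

section Operators

variable {E : Type*} [NormedAddCommGroup E] [InnerProductSpace ℂ E]

/-- `R` is the bounded two-sided inverse `(H - z)⁻¹` of the (unbounded) operator `H - z`. -/
def IsResolvent (H : E →ₗ.[ℂ] E) (z : ℂ) (R : E →L[ℂ] E) : Prop :=
  (∀ ψ : E, ∃ h : R ψ ∈ H.domain, H ⟨R ψ, h⟩ - z • R ψ = ψ) ∧
    ∀ φ : H.domain, R (H φ - z • (φ : E)) = φ

open Classical in
/-- The resolvent `(H - z)⁻¹` (and `0` when `H - z` has no bounded inverse). -/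
def resolventOp (H : E →ₗ.[ℂ] E) (z : ℂ) : E →L[ℂ] E :=
  if h : ∃ R, IsResolvent H z R then h.choose else 0

/-- `P` is the projection-valued spectral measure of `H`, i.e. `H = ∫ t dP(t)`, where
`dom H = {ψ | ∫ t² d⟨ψ, P(t) ψ⟩ < ∞}`. Only the values of `P` on Borel sets matter. -/
structure IsSpectralResolution (H : E →ₗ.[ℂ] E) (P : Set ℝ → E →L[ℂ] E) : Prop where
  isSymmetric : ∀ B, MeasurableSet B → (P B : E →ₗ[ℂ] E).IsSymmetric
  idempotent : ∀ B, MeasurableSet B → P B * P B = P B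
  map_univ : P Set.univ = 1
  hasSum_iUnion : ∀ B : ℕ → Set ℝ, (∀ n, MeasurableSet (B n)) →
    Pairwise (Function.onFun Disjoint B) → ∀ ψ, HasSum (fun n => P (B n) ψ) (P (⋃ n, B n) ψ)
  eq_integral : ∀ ψ : E, ∃ ν : Measure ℝ,
    (∀ B, MeasurableSet B → ν B = ‖P B ψ‖ₑ ^ 2) ∧
    (ψ ∈ H.domain ↔ ∫⁻ t, ‖t‖ₑ ^ 2 ∂ν < ∞) ∧
    ∀ h : ψ ∈ H.domain, inner ℂ ψ (H ⟨ψ, h⟩) = ((∫ t, t ∂ν : ℝ) : ℂ)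

open Classical in
/-- The spectral projection `P_B = 1_B(H)`. -/
def spectralProjection (H : E →ₗ.[ℂ] E) (B : Set ℝ) : E →L[ℂ] E :=
  if h : ∃ P, IsSpectralResolution H P then h.choose B else 0

end Operators

/-! ### The lattice Hilbert space and the random Hamiltonian -/

/-- The lattice `ℤ^d`. -/
abbrev Lattice (d : ℕ) : Type := Fin d → ℤ

/-- The one-particle Hilbert space `ℓ²(ℤ^d)`. -/
abbrev HilbertSpace (d : ℕ) : Type := lp (fun _ : Lattice d => ℂ) 2

/-- The probability space of random environments `{V_x}`, with the product `σ`-algebra. -/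
abbrev Environment (d : ℕ) : Type := Lattice d → ℝ

/-- The shift `(T_a V)_x = V_{x-a}`. -/
def translate {d : ℕ} (a : Lattice d) (V : Environment d) : Environment d := fun x => V (x - a)

/-- The state `|x⟩`. -/
def site {d : ℕ} (x : Lattice d) : HilbertSpace d := lp.single 2 x (1 : ℂ)

lemma memℓp_comp_sub {d : ℕ} (a : Lattice d) (ψ : HilbertSpace d) :
    Memℓp (fun x => ψ (x - a)) 2 := by
  refine memℓp_gen ?_
  exact ((Equiv.subRight a).summable_iff (f := fun x => ‖ψ x‖ ^ (2 : ℝ≥0∞).toReal)).2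
    ((lp.memℓp ψ).summable (by norm_num))

/-- The lattice shift `(S_a ψ)(x) = ψ(x - a)` on `ℓ²(ℤ^d)`. -/
def shift {d : ℕ} (a : Lattice d) : HilbertSpace d →L[ℂ] HilbertSpace d :=
  LinearMap.mkContinuous
    { toFun := fun ψ => ⟨fun x => ψ (x - a), memℓp_comp_sub a ψ⟩
      map_add' := fun _ _ => rfl
      map_smul' := fun _ _ => rfl } 1 (by
      intro ψ
      rw [one_mul, lp.norm_eq_tsum_rpow (by norm_num), lp.norm_eq_tsum_rpow (by norm_num)]
      refine le_of_eq (congrArg (· ^ (1 / (2 : ℝ≥0∞).toReal)) ?_)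
      exact (Equiv.subRight a).tsum_eq (fun x => ‖ψ x‖ ^ (2 : ℝ≥0∞).toReal))

/-- The translation-invariant operator on `ℓ²(ℤ^d)` with kernel `⟨x|A|y⟩ = w (x - y)`,
for a summable function `w`. -/
def convolution {d : ℕ} (w : Lattice d → ℂ) : HilbertSpace d →L[ℂ] HilbertSpace d :=
  ∑' a, w a • shift a

/-- The natural domain `{ψ ∈ ℓ² | U ψ ∈ ℓ²}` of multiplication by a real function `U`. -/
def multiplicationDomain {d : ℕ} (U : Lattice d → ℝ) : Submodule ℂ (HilbertSpace d) where
  carrier := {ψ | Memℓp (fun x => (U x : ℂ) * ψ x) 2}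
  zero_mem' := by
    have h : (fun x => (U x : ℂ) * (0 : HilbertSpace d) x) = 0 := by
      ext x; simp
    rw [Set.mem_ofPred_eq, h]
    exact zero_memℓp
  add_mem' := by
    intro ψ φ hψ hφ
    have h : (fun x => (U x : ℂ) * (ψ + φ : HilbertSpace d) x) =
        (fun x => (U x : ℂ) * ψ x) + fun x => (U x : ℂ) * φ x := by
      ext x; simp [mul_add]
    rw [Set.mem_ofPred_eq, h]
    exact hψ.add hφ
  smul_mem' := by
    intro c ψ hψ
    have h : (fun x => (U x : ℂ) * (c • ψ : HilbertSpace d) x) =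
        c • fun x => (U x : ℂ) * ψ x := by
      ext x; simp [mul_left_comm]
    rw [Set.mem_ofPred_eq, h]
    exact hψ.const_smul c

/-- The operator of multiplication by a real function `U`, on its natural domain. -/
def multiplication {d : ℕ} (U : Lattice d → ℝ) : HilbertSpace d →ₗ.[ℂ] HilbertSpace d where
  domain := multiplicationDomain U
  toFun :=
    { toFun := fun ψ => ⟨fun x => (U x : ℂ) * (ψ : HilbertSpace d) x, ψ.2⟩
      map_add' := fun ψ φ => by
        ext x
        exact mul_add (U x : ℂ) ((ψ : HilbertSpace d) x) ((φ : HilbertSpace d) x)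
      map_smul' := fun c ψ => by
        ext x
        exact mul_left_comm (U x : ℂ) c ((ψ : HilbertSpace d) x) }

/-- The Hamiltonian `H = K + lam V` in the environment `V`, with hopping `K_{x,y} = k (x - y)`,
as a self-adjoint operator on its natural domain `{ψ | lam V ψ ∈ ℓ²}`. -/
def hamiltonian {d : ℕ} (k : Lattice d → ℝ) (lam : ℝ) (V : Environment d) :
    HilbertSpace d →ₗ.[ℂ] HilbertSpace d :=
  (convolution fun a => (k a : ℂ)).toLinearMap +ᵥ multiplication fun x => lam * V x

/-- The velocity `v_i = i [H, x_i]`. The potential commutes with `x_i`, and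
`⟨x| v_i |y⟩ = i (y_i - x_i) k (x - y)`. -/
def velocity {d : ℕ} (k : Lattice d → ℝ) (i : Fin d) : HilbertSpace d →L[ℂ] HilbertSpace d :=
  convolution fun a => -Complex.I * (a i : ℂ) * (k a : ℂ)

/-- The Green function `G(x,y;z) = ⟨x| (H - z)⁻¹ |y⟩` in the environment `V`. -/
def green {d : ℕ} (k : Lattice d → ℝ) (lam : ℝ) (V : Environment d) (x y : Lattice d) (z : ℂ) : ℂ :=
  inner ℂ (site x) (resolventOp (hamiltonian k lam V) z (site y))

/-! ### Conductivity -/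

/-- The trace per unit volume `Tr A = 𝔼 ⟨0| A_V |0⟩` of a stationary family of operators. -/
def tracePerVolume {d : ℕ} (ℙ : Measure (Environment d))
    (A : Environment d → HilbertSpace d →L[ℂ] HilbertSpace d) : ℂ :=
  ∫ V, inner ℂ (site 0) (A V (site 0)) ∂ℙ

/-- `m` is the conductivity measure `m_{ij}(dt,ds) = Tr (dP_{≤ t} v_i dP_{≤ s} v_j)`. -/
def IsConductivityMeasure {d : ℕ} (k : Lattice d → ℝ) (lam : ℝ) (ℙ : Measure (Environment d))
    (i j : Fin d) (m : ComplexMeasure (ℝ × ℝ)) : Prop :=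
  ∀ A B : Set ℝ, MeasurableSet A → MeasurableSet B →
    m (A ×ˢ B) = tracePerVolume ℙ fun V =>
      spectralProjection (hamiltonian k lam V) A * velocity k i *
        spectralProjection (hamiltonian k lam V) B * velocity k j

open Classical in
/-- The conductivity measure `m_{ij}` (a finite complex measure is determined by its values on
rectangles). -/
def conductivityMeasure {d : ℕ} (k : Lattice d → ℝ) (lam : ℝ) (ℙ : Measure (Environment d))
    (i j : Fin d) : ComplexMeasure (ℝ × ℝ) :=
  if h : ∃ m, IsConductivityMeasure k lam ℙ i j m then h.choose else 0

/-- The approximate delta function `δ_η(u) = (η/π) / (u² + η²)`. -/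
def approxDelta (η u : ℝ) : ℝ := η / Real.pi * (u ^ 2 + η ^ 2)⁻¹

/-- The Fermi distribution `f(E) = θ_T(E - E_F)`, `θ_T(u) = (1 + e^{u/T})⁻¹`. -/
def fermi (T EF E : ℝ) : ℝ := (1 + Real.exp ((E - EF) / T))⁻¹

/-- The Kubo conductivity at temperature `T` and Fermi energy `EF`, before the limit `η ↓ 0`:
`-π Tr ∫∫ δ_η(t-s) (f(t)-f(s))/(t-s) dP_{≤ t} v_i dP_{≤ s} v_j`, where the difference quotient
is read as `f'(t)` on the diagonal `t = s`. -/
def kuboConductivity {d : ℕ} (k : Lattice d → ℝ) (lam : ℝ) (ℙ : Measure (Environment d))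
    (i j : Fin d) (EF T η : ℝ) : ℂ :=
  -(Real.pi : ℂ) * ∫ᵛ p, approxDelta η (p.1 - p.2) * dslope (fermi T EF) p.2 p.1
    ∂•(conductivityMeasure k lam ℙ i j)

/-- The quantity `(η²/π) ∑_x x_i x_j 𝔼|G(0,x;E+iη)|²`, whose limit as `η ↓ 0` is `σ̃_{ij}(E)`. -/
def greenConductivity {d : ℕ} (k : Lattice d → ℝ) (lam : ℝ) (ℙ : Measure (Environment d))
    (i j : Fin d) (E η : ℝ) : ℝ :=
  η ^ 2 / Real.pi * ∑' x : Lattice d, (x i : ℝ) * (x j : ℝ) *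
    ∫ V, ‖green k lam V 0 x ((E : ℂ) + η * Complex.I)‖ ^ 2 ∂ℙ

/-- The quantity `η² ∑_x x² 𝔼|G(0,x;E+iη)|²` in `[0,∞]`, with `x² = ∑_l x_l²`. -/
def greenSecondMoment {d : ℕ} (k : Lattice d → ℝ) (lam : ℝ) (ℙ : Measure (Environment d))
    (E η : ℝ) : ℝ≥0∞ :=
  ENNReal.ofReal (η ^ 2) * ∑' x : Lattice d, ENNReal.ofReal (∑ l, (x l : ℝ) ^ 2) *
    ∫⁻ V, ‖green k lam V 0 x ((E : ℂ) + η * Complex.I)‖ₑ ^ 2 ∂ℙ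

end Kubo

end

noncomputable section

namespace Kubo

/-! ### Quadratic forms and their pointwise limits -/

section WeakLimits

variable {E : Type*} [NormedAddCommGroup E] [InnerProductSpace ℂ E]

/-! For n in ℂ^d let v = ∑ n_l v_l, R = (H − z)⁻¹ and z = E + iη. Position acts on the resolvent
through the commutator with H, and n·x vanishes at the origin, so R v R δ₀ = i (n·x) R δ₀
(`resolvent_velocity_resolvent`). Let μ_n be the positive measure with μ_n(A × B) = 𝔼‖P_B v* P_A
δ₀‖². The spectral theorem applied in each variable, together with stationarity, turns the averaged
squared norm of this vector into (η/π)² ∑ₓ |n·x|² 𝔼|G(0,x;z)|² = ∬ δ_η(t−E) δ_η(s−E) μ_n(dt,ds)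
(`lintegral_approxDelta_correlation`, `hasSum_integral_correlation`). Polarization over n = e_i + s
e_j with s⁴ = 1 expresses m_ij through four such measures, and the Green function sum through the
same four with the same coefficients (`exists_conductivityMeasure_eq`, `greenConductivity_eq`).

The two conductivities are then compared at the level of kernels. By the Poisson semigroup law
δ_{2η}(t−s) = ∫ δ_η(t−E) δ_η(s−E) dE, the Kubo kernel at 2η is the E-integral of f'(c) δ_η(t−E)
δ_η(s−E), where c is a mean value point between s and t; the smeared Green function sum has f'(E) in
place of f'(c). The bound |f'(c) − f'(E)| ≤ (κ + C(c−E)²)/(1+E²) splits the error in two. The κ part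
is at most κπM, where M is the uniform bound supplied by the assumption on second moments. The
quadratic part is O(η), since u² δ_η(u) ≤ η/π. Hence σ_ij(T,2η) + ∫ f'(E) G_η(E) dE → 0, with G_η
the prelimit Green function conductivity (`tendsto_kernel_sub`, `tendsto_kuboConductivity_add`). The
first conclusion is now dominated convergence, as G_η is uniformly bounded. The second holds because
−f' has integral one and concentrates at the Fermi energy as T ↓ 0.

The rest is foundation: the spectral theorem for H from the functional calculus of (H − i)⁻¹, its
uniqueness (the projections in the statement are only chosen, not constructed), measurability in the
environment, cyclicity of the trace per unit volume, and the extension of positive bimeasures to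
measures on the plane. -/

lemma inner_polarization (T : E →L[ℂ] E) (φ ψ : E) :
    inner ℂ φ (T ψ) = (inner ℂ (φ + ψ) (T (φ + ψ)) - inner ℂ (φ - ψ) (T (φ - ψ))
      - Complex.I * inner ℂ (φ + Complex.I • ψ) (T (φ + Complex.I • ψ))
      + Complex.I * inner ℂ (φ - Complex.I • ψ) (T (φ - Complex.I • ψ))) / 4 := by
  simp only [map_add, map_sub, map_smul, inner_add_left, inner_add_right, inner_sub_left,
    inner_sub_right, inner_smul_left, inner_smul_right, Complex.conj_I]
  linear_combination (inner ℂ φ (T ψ) / 2 - inner ℂ ψ (T φ) / 2) * Complex.I_sq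

lemma ext_of_inner_self {S T : E →L[ℂ] E} (h : ∀ ψ, inner ℂ ψ (S ψ) = inner ℂ ψ (T ψ)) :
    S = T := by
  ext ψ
  refine ext_inner_left ℂ fun φ => ?_
  rw [inner_polarization S, inner_polarization T, h, h, h, h]

lemma tendsto_inner_of_tendsto_inner_self {ι : Type*} {l : Filter ι} {T : ι → E →L[ℂ] E}
    {S : E →L[ℂ] E} (h : ∀ ψ, Tendsto (fun n => inner ℂ ψ (T n ψ)) l (𝓝 (inner ℂ ψ (S ψ))))
    (φ ψ : E) : Tendsto (fun n => inner ℂ φ (T n ψ)) l (𝓝 (inner ℂ φ (S ψ))) := by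
  rw [inner_polarization S]
  simp_rw [inner_polarization (T _) φ ψ]
  exact (((((h _).sub (h _)).sub ((h _).const_mul _)).add ((h _).const_mul _)).div_const 4)

/-- A pointwise limit of quadratic forms of bounded operators, if it is a bounded form, is the
quadratic form of a bounded operator. -/
lemma exists_operator_of_tendsto [CompleteSpace E] {T : ℕ → E →L[ℂ] E} {q : E → ℂ} {C : ℝ}
    (hC : ∀ ψ, ‖q ψ‖ ≤ C * ‖ψ‖ ^ 2)
    (h : ∀ ψ, Tendsto (fun n => inner ℂ ψ (T n ψ)) atTop (𝓝 (q ψ))) :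
    ∃ S : E →L[ℂ] E, ∀ ψ, inner ℂ ψ (S ψ) = q ψ := by
  -- The candidate sesquilinear form is q polarized. Its linearity is not assumed of q: it is
  -- inherited from the forms of T n in the limit.
  set b : E → E → ℂ := fun φ ψ => (q (φ + ψ) - q (φ - ψ) - Complex.I * q (φ + Complex.I • ψ)
      + Complex.I * q (φ - Complex.I • ψ)) / 4 with hb
  have hlim : ∀ φ ψ, Tendsto (fun n => inner ℂ φ (T n ψ)) atTop (𝓝 (b φ ψ)) := by
    intro φ ψ
    simp_rw [inner_polarization (T _) φ ψ]
    exact (((((h _).sub (h _)).sub ((h _).const_mul _)).add ((h _).const_mul _)).div_const 4)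
  have hbq : ∀ ψ, b ψ ψ = q ψ := fun ψ => tendsto_nhds_unique (hlim ψ ψ) (h ψ)
  have hadd₁ : ∀ φ φ' ψ, b (φ + φ') ψ = b φ ψ + b φ' ψ := fun φ φ' ψ =>
    tendsto_nhds_unique (hlim _ _) (by
      simpa only [inner_add_left] using (hlim φ ψ).add (hlim φ' ψ))
  have hsmul₁ : ∀ (c : ℂ) φ ψ, b (c • φ) ψ = (starRingEnd ℂ) c • b φ ψ := fun c φ ψ =>
    tendsto_nhds_unique (hlim _ _) (by
      simpa only [inner_smul_left, smul_eq_mul] using (hlim φ ψ).const_mul _)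
  have hadd₂ : ∀ φ ψ ψ', b φ (ψ + ψ') = b φ ψ + b φ ψ' := fun φ ψ ψ' =>
    tendsto_nhds_unique (hlim _ _) (by
      simpa only [map_add, inner_add_right] using (hlim φ ψ).add (hlim φ ψ'))
  have hsmul₂ : ∀ (c : ℂ) φ ψ, b φ (c • ψ) = c • b φ ψ := fun c φ ψ =>
    tendsto_nhds_unique (hlim _ _) (by
      simpa only [map_smul, inner_smul_right, smul_eq_mul] using (hlim φ ψ).const_mul c)
  have hbound₁ : ∀ φ ψ, ‖b φ ψ‖ ≤ C * (‖φ‖ ^ 2 + ‖ψ‖ ^ 2) := by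
    intro φ ψ
    have h1 := parallelogram_law_with_norm ℂ φ ψ
    have h2 := parallelogram_law_with_norm ℂ φ (Complex.I • ψ)
    rw [norm_smul, Complex.norm_I, one_mul] at h2
    have h3 : ‖b φ ψ‖ ≤ (‖q (φ + ψ)‖ + ‖q (φ - ψ)‖ + ‖q (φ + Complex.I • ψ)‖
        + ‖q (φ - Complex.I • ψ)‖) / 4 := by
      rw [hb]
      simp only [norm_div, RCLike.norm_ofNat]
      gcongr
      refine (norm_add_le _ _).trans (add_le_add ((norm_sub_le _ _).trans (add_le_add
        (norm_sub_le _ _) ?_)) ?_) <;> simp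
    -- The parallelogram law for (φ, ψ) and for (φ, iψ) evaluates the sum of the four squared norms
    -- as 4(‖φ‖² + ‖ψ‖²).
    have := hC (φ - Complex.I • ψ)
    linear_combination h3 + (C / 4) * h1 + (C / 4) * h2 + (this + hC (φ + ψ) + hC (φ - ψ)
      + hC (φ + Complex.I • ψ)) / 4
  have hbound : ∀ φ ψ, ‖b φ ψ‖ ≤ 2 * C * ‖φ‖ * ‖ψ‖ := by
    intro φ ψ
    rcases eq_or_ne φ 0 with rfl | hφ
    · have : b 0 ψ = 0 := by simpa using hsmul₁ 0 0 ψ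
      simp [this]
    rcases eq_or_ne ψ 0 with rfl | hψ
    · have : b φ 0 = 0 := by simpa using hsmul₂ 0 φ 0
      simp [this]
    have hφ' : 0 < ‖φ‖ := norm_pos_iff.2 hφ
    have hψ' : 0 < ‖ψ‖ := norm_pos_iff.2 hψ
    -- Rescaling both vectors to unit length turns the bound by a sum of squares into a bound by a
    -- product, with constant 2C.
    have h1 := hbound₁ (((‖φ‖⁻¹ : ℝ) : ℂ) • φ) (((‖ψ‖⁻¹ : ℝ) : ℂ) • ψ)
    rw [hsmul₁, hsmul₂] at h1
    simp only [smul_eq_mul, norm_mul, norm_smul, Complex.norm_real, norm_inv, norm_norm,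
      Complex.conj_ofReal] at h1
    rw [inv_mul_cancel₀ hφ'.ne', inv_mul_cancel₀ hψ'.ne', ← mul_assoc, ← mul_inv,
      inv_mul_le_iff₀ (by positivity)] at h1
    linarith
  let B : E →L⋆[ℂ] E →L[ℂ] ℂ :=
    LinearMap.mkContinuous₂ (LinearMap.mk₂'ₛₗ (starRingEnd ℂ) (RingHom.id ℂ) b hadd₁ hsmul₁ hadd₂
      hsmul₂) (2 * C) hbound
  refine ⟨ContinuousLinearMap.adjoint (InnerProductSpace.continuousLinearMapOfBilin B),
    fun ψ => ?_⟩
  rw [ContinuousLinearMap.adjoint_inner_right, InnerProductSpace.continuousLinearMapOfBilin_apply]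
  exact hbq ψ

end WeakLimits

/-! ### Projection-valued measures -/

section PVM

variable {X : Type*} [MeasurableSpace X] {E : Type*} [NormedAddCommGroup E] [InnerProductSpace ℂ E]

/-- Projection-valued measures. Only the values on measurable sets matter. -/
structure IsPVM (P : Set X → E →L[ℂ] E) : Prop where
  isSymmetric : ∀ B, MeasurableSet B → (P B : E →ₗ[ℂ] E).IsSymmetric
  idempotent : ∀ B, MeasurableSet B → P B * P B = P B
  map_univ : P Set.univ = 1
  hasSum_iUnion : ∀ B : ℕ → Set X, (∀ n, MeasurableSet (B n)) →
    Pairwise (Function.onFun Disjoint B) → ∀ ψ, HasSum (fun n => P (B n) ψ) (P (⋃ n, B n) ψ)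

namespace IsPVM

variable {P : Set X → E →L[ℂ] E} (hP : IsPVM P)
include hP

lemma inner_apply {B : Set X} (hB : MeasurableSet B) (φ ψ : E) :
    inner ℂ φ (P B ψ) = inner ℂ (P B φ) ψ := (hP.isSymmetric B hB φ ψ).symm

lemma apply_apply {B : Set X} (hB : MeasurableSet B) (ψ : E) : P B (P B ψ) = P B ψ :=
  DFunLike.congr_fun (hP.idempotent B hB) ψ

lemma inner_apply_self {B : Set X} (hB : MeasurableSet B) (ψ : E) :
    inner ℂ ψ (P B ψ) = ((‖P B ψ‖ ^ 2 : ℝ) : ℂ) := by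
  rw [← hP.apply_apply hB, hP.inner_apply hB, hP.apply_apply hB, inner_self_eq_norm_sq_to_K]
  norm_cast

lemma map_empty : P ∅ = 0 := by
  ext ψ
  have h := hP.hasSum_iUnion (fun _ => ∅) (fun _ => MeasurableSet.empty)
    (fun _ _ _ => disjoint_bot_left) ψ
  simpa using tendsto_nhds_unique (tendsto_const_nhds (x := P ∅ ψ)) h.summable.tendsto_atTop_zero

lemma map_union {A B : Set X} (hA : MeasurableSet A) (hB : MeasurableSet B) (h : Disjoint A B) :
    P (A ∪ B) = P A + P B := by
  ext ψ
  have h1 := hP.hasSum_iUnion (fun n => if n = 0 then A else if n = 1 then B else ∅)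
    (fun n => by split_ifs <;> simp [hA, hB]) (by
      intro m n hmn
      rw [Function.onFun]
      split_ifs <;> simp_all [h.symm]) ψ
  have h2 : HasSum (fun n => P (if n = 0 then A else if n = 1 then B else ∅) ψ)
      (∑ n ∈ Finset.range 2, P (if n = 0 then A else if n = 1 then B else ∅) ψ) := by
    refine hasSum_sum_of_ne_finset_zero fun n hn => ?_
    have : 1 < n := by simpa using hn
    rw [if_neg (by omega), if_neg (by omega), hP.map_empty]
    rfl
  have h3 : (⋃ n : ℕ, if n = 0 then A else if n = 1 then B else ∅) = A ∪ B := by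
    ext x
    simp only [Set.mem_iUnion, Set.mem_union]
    constructor
    · rintro ⟨n, hn⟩
      split_ifs at hn <;> simp_all
    · rintro (hx | hx)
      · exact ⟨0, by simpa using hx⟩
      · exact ⟨1, by simpa using hx⟩
  rw [h3] at h1
  simpa [Finset.sum_range_succ] using h1.unique h2

/-- Idempotency of P A + P B makes the anticommutator of P A and P B vanish. Applied to P B ψ and
paired with P A P B ψ, this says ‖P A P B ψ‖² + ‖P B P A P B ψ‖² = 0. -/
lemma mul_eq_zero_of_disjoint {A B : Set X} (hA : MeasurableSet A) (hB : MeasurableSet B)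
    (h : Disjoint A B) : P A * P B = 0 := by
  have h1 : P A * P B + P B * P A = 0 := by
    have h2 := hP.idempotent _ (hA.union hB)
    rw [hP.map_union hA hB h] at h2
    have h3 := hP.idempotent A hA
    have h4 := hP.idempotent B hB
    have h5 : (P A + P B) * (P A + P B)
        = P A * P A + P B * P B + (P A * P B + P B * P A) := by noncomm_ring
    rw [h5, h3, h4] at h2
    simpa using h2
  ext ψ
  have h2 : P A (P B (P B ψ)) + P B (P A (P B ψ)) = 0 := DFunLike.congr_fun h1 (P B ψ)
  have h4 : inner ℂ (P A (P B ψ)) (P A (P B (P B ψ)) + P B (P A (P B ψ))) = 0 := by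
    rw [h2, inner_zero_right]
  rw [hP.apply_apply hB, inner_add_right, hP.inner_apply_self hB, inner_self_eq_norm_sq_to_K] at h4
  have h5 : ‖P A (P B ψ)‖ ^ 2 + ‖P B (P A (P B ψ))‖ ^ 2 = 0 := by
    apply Complex.ofReal_injective
    push_cast at h4 ⊢
    exact h4
  have h6 : ‖P A (P B ψ)‖ = 0 := by
    rw [← sq_eq_zero_iff]
    exact le_antisymm (h5 ▸ le_add_of_nonneg_right (sq_nonneg _)) (sq_nonneg _)
  rw [norm_eq_zero] at h6
  exact h6

lemma mul_eq_inter {A B : Set X} (hA : MeasurableSet A) (hB : MeasurableSet B) :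
    P A * P B = P (A ∩ B) := by
  have h1 : P A = P (A ∩ B) + P (A \ B) := by
    rw [← hP.map_union (hA.inter hB) (hA.diff hB) Set.disjoint_sdiff_inter.symm,
      Set.inter_union_sdiff]
  have h2 : P B = P (A ∩ B) + P (B \ A) := by
    rw [Set.inter_comm, ← hP.map_union (hB.inter hA) (hB.diff hA) Set.disjoint_sdiff_inter.symm,
      Set.inter_union_sdiff]
  have d1 : Disjoint (A ∩ B) (B \ A) := by
    rw [Set.inter_comm]; exact Set.disjoint_sdiff_inter.symm
  have d2 : Disjoint (A \ B) B := Set.disjoint_sdiff_left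
  calc P A * P B = P (A ∩ B) * P B + P (A \ B) * P B := by rw [← add_mul, ← h1]
    _ = P (A ∩ B) * P B := by
        rw [hP.mul_eq_zero_of_disjoint (hA.diff hB) hB d2, add_zero]
    _ = P (A ∩ B) := by
        rw [h2, mul_add, hP.idempotent _ (hA.inter hB),
          hP.mul_eq_zero_of_disjoint (hA.inter hB) (hB.diff hA) d1, add_zero]

lemma apply_inter {A B : Set X} (hA : MeasurableSet A) (hB : MeasurableSet B) (ψ : E) :
    P A (P B ψ) = P (A ∩ B) ψ := DFunLike.congr_fun (hP.mul_eq_inter hA hB) ψ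

lemma map_compl {A : Set X} (hA : MeasurableSet A) : P Aᶜ = 1 - P A := by
  rw [eq_sub_iff_add_eq', ← hP.map_union hA hA.compl disjoint_compl_right, Set.union_compl_self,
    hP.map_univ]

omit hP in
/-- The scalar spectral measure `B ↦ ‖P B ψ‖²`. -/
def measure (hP : IsPVM P) (ψ : E) : Measure X :=
  Measure.ofMeasurable (fun B _ => ‖P B ψ‖ₑ ^ 2) (by simp [hP.map_empty]) (by
    intro B hB hd
    have h := (hP.hasSum_iUnion B hB hd ψ).mapL (innerSL ℂ ψ)
    simp only [innerSL_apply_apply] at h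
    rw [hP.inner_apply_self (MeasurableSet.iUnion hB)] at h
    simp_rw [hP.inner_apply_self (hB _)] at h
    have h2 := Complex.hasSum_ofReal.1 h
    have e : ∀ x : E, ‖x‖ₑ ^ 2 = ENNReal.ofReal (‖x‖ ^ 2) := fun x => by
      rw [← ofReal_norm, ENNReal.ofReal_pow (norm_nonneg _)]
    simp_rw [e]
    rw [← h2.tsum_eq, ENNReal.ofReal_tsum_of_nonneg (fun n => by positivity) h2.summable])

lemma measure_apply {B : Set X} (hB : MeasurableSet B) (ψ : E) :
    hP.measure ψ B = ‖P B ψ‖ₑ ^ 2 := Measure.ofMeasurable_apply B hB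

lemma measure_univ (ψ : E) : hP.measure ψ Set.univ = ‖ψ‖ₑ ^ 2 := by
  rw [hP.measure_apply MeasurableSet.univ, hP.map_univ]; rfl

instance (ψ : E) : IsFiniteMeasure (hP.measure ψ) :=
  ⟨by rw [hP.measure_univ]; exact ENNReal.pow_lt_top enorm_lt_top⟩

lemma measureReal_apply {B : Set X} (hB : MeasurableSet B) (ψ : E) :
    (hP.measure ψ).real B = ‖P B ψ‖ ^ 2 := by
  rw [Measure.real, hP.measure_apply hB, ENNReal.toReal_pow, toReal_enorm]

lemma measure_map_apply {A : Set X} (hA : MeasurableSet A) (ψ : E) :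
    hP.measure (P A ψ) = (hP.measure ψ).restrict A := by
  ext B hB
  rw [Measure.restrict_apply hB, hP.measure_apply hB, hP.measure_apply (hB.inter hA),
    hP.apply_inter hB hA]

lemma norm_apply_le {B : Set X} (hB : MeasurableSet B) (ψ : E) : ‖P B ψ‖ ≤ ‖ψ‖ := by
  have h : hP.measure ψ B ≤ hP.measure ψ Set.univ := measure_mono (Set.subset_univ _)
  rw [hP.measure_apply hB, hP.measure_univ] at h
  have := (ENNReal.pow_le_pow_left_iff two_ne_zero).1 h
  simpa [← ofReal_norm] using this

/-- The pushforward of a projection-valued measure. -/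
lemma map {Y : Type*} [MeasurableSpace Y] {τ : X → Y} (hτ : Measurable τ) :
    IsPVM fun B => P (τ ⁻¹' B) where
  isSymmetric B hB := hP.isSymmetric _ (hτ hB)
  idempotent B hB := hP.idempotent _ (hτ hB)
  map_univ := hP.map_univ
  hasSum_iUnion B hB hd ψ := by
    rw [Set.preimage_iUnion]
    exact hP.hasSum_iUnion _ (fun n => hτ (hB n)) (fun m n hmn => (hd hmn).preimage τ) ψ

lemma measure_map {Y : Type*} [MeasurableSpace Y] {τ : X → Y} (hτ : Measurable τ) (ψ : E) :
    (hP.map hτ).measure ψ = (hP.measure ψ).map τ := by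
  ext B hB
  rw [Measure.map_apply hτ hB, (hP.map hτ).measure_apply hB, hP.measure_apply (hτ hB)]

end IsPVM

end PVM

/-! ### From a representation of C(X) to a projection-valued measure -/

section Representation

variable {X : Type*} [TopologicalSpace X]
  {E : Type*} [NormedAddCommGroup E] [InnerProductSpace ℂ E] [CompleteSpace E]

lemma inner_rep_star (Φ : C(X, ℂ) →⋆ₐ[ℂ] (E →L[ℂ] E)) (f : C(X, ℂ)) (φ ψ : E) :
    inner ℂ φ (Φ f ψ) = inner ℂ (Φ (star f) φ) ψ := by
  rw [map_star, ContinuousLinearMap.star_eq_adjoint, ContinuousLinearMap.adjoint_inner_left]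

/-- The complexification of a real continuous function. -/
def toComplex (f : C(X, ℝ)) : C(X, ℂ) := ⟨fun x => (f x : ℂ), by fun_prop⟩

@[simp] lemma toComplex_apply (f : C(X, ℝ)) (x : X) : toComplex f x = (f x : ℂ) := rfl

lemma star_toComplex (f : C(X, ℝ)) : star (toComplex f) = toComplex f := by
  ext x; simp

lemma inner_rep_toComplex_im (Φ : C(X, ℂ) →⋆ₐ[ℂ] (E →L[ℂ] E)) (f : C(X, ℝ)) (ψ : E) :
    (((inner ℂ ψ (Φ (toComplex f) ψ)).re : ℝ) : ℂ) = inner ℂ ψ (Φ (toComplex f) ψ) := by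
  rw [← Complex.conj_eq_iff_re, inner_conj_symm]
  conv_rhs => rw [inner_rep_star, star_toComplex]

variable [CompactSpace X] [T2Space X] [MeasurableSpace X] [BorelSpace X]

/-- Riesz–Markov applied to f ↦ ⟨ψ, Φ f ψ⟩. The functional is positive because f = √f · √f gives the
value ‖Φ(√f) ψ‖². -/
lemma exists_measure_of_rep (Φ : C(X, ℂ) →⋆ₐ[ℂ] (E →L[ℂ] E)) (ψ : E) :
    ∃ ν : Measure X, IsFiniteMeasure ν ∧
      ∀ f : C(X, ℝ), ((∫ x, f x ∂ν : ℝ) : ℂ) = inner ℂ ψ (Φ (toComplex f) ψ) := by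
  let Λ₀ : CompactlySupportedContinuousMap X ℝ →ₗ[ℝ] ℝ :=
    { toFun := fun f => (inner ℂ ψ (Φ (toComplex f.toContinuousMap) ψ)).re
      map_add' := fun f g => by
        have : toComplex (f + g).toContinuousMap
            = toComplex f.toContinuousMap + toComplex g.toContinuousMap := by
          ext x; simp
        rw [this, map_add, add_apply, inner_add_right, Complex.add_re]
      map_smul' := fun c f => by
        have : toComplex (c • f).toContinuousMap
            = (c : ℂ) • toComplex f.toContinuousMap := by
          ext x; simp
        rw [this, map_smul, smul_apply, inner_smul_right]
        simp }
  let Λ : CompactlySupportedContinuousMap X ℝ →ₚ[ℝ] ℝ := PositiveLinearMap.mk₀ Λ₀ (by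
    intro f hf
    let g : C(X, ℝ) := ⟨fun x => Real.sqrt (f x), by fun_prop⟩
    have h : toComplex f.toContinuousMap = star (toComplex g) * toComplex g := by
      rw [star_toComplex]
      ext x
      have : Real.sqrt (f x) * Real.sqrt (f x) = f x := Real.mul_self_sqrt (hf x)
      simp only [ContinuousMap.mul_apply, toComplex_apply, g, ContinuousMap.coe_mk]
      exact_mod_cast this.symm
    change 0 ≤ (inner ℂ ψ (Φ (toComplex f.toContinuousMap) ψ)).re
    rw [h, map_mul, mul_apply_eq_comp, inner_rep_star, star_star]
    exact inner_self_nonneg (𝕜 := ℂ))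
  refine ⟨RealRMK.rieszMeasure Λ, ⟨?_⟩, fun f => ?_⟩
  · exact isCompact_univ.measure_lt_top
  · have := RealRMK.integral_rieszMeasure Λ
      (CompactlySupportedContinuousMap.continuousMapEquiv f)
    rw [← inner_rep_toComplex_im]
    exact congrArg _ this

/-- The scalar spectral measures of a representation of `C(X)`. -/
def repMeasure (Φ : C(X, ℂ) →⋆ₐ[ℂ] (E →L[ℂ] E)) (ψ : E) : Measure X :=
  (exists_measure_of_rep Φ ψ).choose

variable (Φ : C(X, ℂ) →⋆ₐ[ℂ] (E →L[ℂ] E))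

instance (ψ : E) : IsFiniteMeasure (repMeasure Φ ψ) := (exists_measure_of_rep Φ ψ).choose_spec.1

lemma integral_repMeasure (f : C(X, ℝ)) (ψ : E) :
    ((∫ x, f x ∂(repMeasure Φ ψ) : ℝ) : ℂ) = inner ℂ ψ (Φ (toComplex f) ψ) :=
  (exists_measure_of_rep Φ ψ).choose_spec.2 f

omit [T2Space X] in
lemma integrable_continuousMap {F : Type*} [NormedAddCommGroup F] [SecondCountableTopologyEither X
    F]
    (μ : Measure X) [IsFiniteMeasure μ] (f : C(X, F)) : Integrable f μ :=
  f.continuous.integrable_of_hasCompactSupport (HasCompactSupport.of_compactSpace _)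

lemma integral_repMeasure_complex (f : C(X, ℂ)) (ψ : E) :
    ∫ x, f x ∂(repMeasure Φ ψ) = inner ℂ ψ (Φ f ψ) := by
  let g : C(X, ℝ) := ⟨fun x => (f x).re, by fun_prop⟩
  let h : C(X, ℝ) := ⟨fun x => (f x).im, by fun_prop⟩
  have e : f = toComplex g + Complex.I • toComplex h := by
    ext x
    simp [g, h, mul_comm Complex.I, Complex.re_add_im]
  have h1 := integral_repMeasure Φ g ψ
  have h2 := integral_repMeasure Φ h ψ
  conv_rhs => rw [e]
  rw [map_add, map_smul, add_apply, smul_apply,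
    inner_add_right, inner_smul_right, ← h1, ← h2,
    ← integral_re_add_im (integrable_continuousMap _ f)]
  simp [g, h, mul_comm]

lemma integral_norm_sq_repMeasure (f : C(X, ℂ)) (ψ : E) :
    ∫ x, ‖f x‖ ^ 2 ∂(repMeasure Φ ψ) = ‖Φ f ψ‖ ^ 2 := by
  let g : C(X, ℝ) := ⟨fun x => ‖f x‖ ^ 2, by fun_prop⟩
  have h : toComplex g = star f * f := by
    ext x
    simp [g, ← Complex.conj_mul']
  have := integral_repMeasure Φ g ψ
  rw [h, map_mul, mul_apply_eq_comp, inner_rep_star, star_star,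
    inner_self_eq_norm_sq_to_K] at this
  apply Complex.ofReal_injective
  refine this.trans ?_
  norm_cast

variable [HasOuterApproxClosed X]

lemma repMeasure_eq_of_forall {μ : Measure X} [IsFiniteMeasure μ] {ψ : E}
    (h : ∀ f : C(X, ℝ), ((∫ x, f x ∂μ : ℝ) : ℂ) = inner ℂ ψ (Φ (toComplex f) ψ)) :
    repMeasure Φ ψ = μ := by
  refine ext_of_forall_integral_eq_of_IsFiniteMeasure fun f => ?_
  apply Complex.ofReal_injective
  exact (integral_repMeasure Φ f.toContinuousMap ψ).trans (h f.toContinuousMap).symm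

/-- Moving Φ f across the inner product gives ⟨Φ f ψ, Φ h Φ f ψ⟩ = ⟨ψ, Φ(f̄ h f) ψ⟩, and f̄ h f =
|f|² h. -/
lemma repMeasure_rep (f : C(X, ℂ)) (ψ : E) :
    repMeasure Φ (Φ f ψ) = (repMeasure Φ ψ).withDensity fun x => ‖f x‖ₑ ^ 2 := by
  have e : ∀ x, ‖f x‖ₑ ^ 2 = ((‖f x‖₊ ^ 2 : ℝ≥0) : ℝ≥0∞) := fun x => by
    rw [enorm_eq_nnnorm]; norm_cast
  have hfin : IsFiniteMeasure ((repMeasure Φ ψ).withDensity fun x => ‖f x‖ₑ ^ 2) := by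
    refine isFiniteMeasure_withDensity ?_
    let g : C(X, ℝ) := ⟨fun x => ‖f x‖ ^ 2, by fun_prop⟩
    have := (integrable_continuousMap (repMeasure Φ ψ) g).2
    refine ne_of_lt (lt_of_eq_of_lt (lintegral_congr fun x => ?_) this)
    simp [g]
  refine repMeasure_eq_of_forall Φ fun h => ?_
  simp_rw [e]
  rw [integral_withDensity_eq_integral_smul (by fun_prop)]
  let g : C(X, ℝ) := ⟨fun x => ‖f x‖ ^ 2 * h x, by fun_prop⟩
  have hg : toComplex g = star f * (toComplex h * f) := by
    ext x
    simp only [toComplex_apply, g, ContinuousMap.coe_mk, ContinuousMap.mul_apply,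
      ContinuousMap.star_apply, RCLike.star_def]
    push_cast
    rw [← Complex.conj_mul']
    ring
  have := integral_repMeasure Φ g ψ
  rw [hg, map_mul, map_mul, mul_apply_eq_comp, inner_rep_star, star_star,
    mul_apply_eq_comp] at this
  exact this

/-- Needed for uniqueness of the spectral measure, with W the reflection 1 − 2 P A. -/
lemma repMeasure_unitary {W : E →L[ℂ] E} (hW : ∀ φ ψ, inner ℂ (W φ) (W ψ) = inner ℂ φ ψ)
    (hc : ∀ f, Commute (Φ f) W) (ψ : E) : repMeasure Φ (W ψ) = repMeasure Φ ψ := by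
  refine repMeasure_eq_of_forall Φ fun f => ?_
  have : Φ (toComplex f) (W ψ) = W (Φ (toComplex f) ψ) := DFunLike.congr_fun (hc (toComplex f)) ψ
  rw [this, hW, integral_repMeasure]

omit [CompactSpace X] [T2Space X] in
lemma tendsto_integral_apprSeq (μ : Measure X) [IsFiniteMeasure μ] {F : Set X} (hF : IsClosed F) :
    Tendsto (fun n => ∫ x, (hF.apprSeq n x : ℝ) ∂μ) atTop (𝓝 (μ.real F)) := by
  have h := (ENNReal.tendsto_toReal (measure_ne_top μ F)).comp
    (HasOuterApproxClosed.tendsto_lintegral_apprSeq hF μ)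
  refine h.congr fun n => ?_
  rw [integral_eq_lintegral_of_nonneg_ae (Eventually.of_forall fun x => NNReal.coe_nonneg _)
    (by fun_prop)]
  simp

omit [CompactSpace X] [T2Space X] [HasOuterApproxClosed X] in
lemma measurableSpace_eq_generateFrom_isClosed :
    ‹MeasurableSpace X› = MeasurableSpace.generateFrom {s : Set X | IsClosed s} :=
  BorelSpace.measurable_eq.trans borel_eq_generateFrom_isClosed

omit [HasOuterApproxClosed X] in
lemma repMeasure_real_univ (ψ : E) : (repMeasure Φ ψ).real Set.univ = ‖ψ‖ ^ 2 := by
  simpa using integral_norm_sq_repMeasure Φ 1 ψ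

/-- Continuous functions approximating the indicator of a closed set. -/
def closedApprox {F : Set X} (hF : IsClosed F) (n : ℕ) : C(X, ℝ) :=
  ⟨fun x => (hF.apprSeq n x : ℝ), by fun_prop⟩

lemma tendsto_inner_closedApprox {F : Set X} (hF : IsClosed F) (ψ : E) :
    Tendsto (fun n => inner ℂ ψ (Φ (toComplex (closedApprox hF n)) ψ)) atTop
      (𝓝 (((repMeasure Φ ψ).real F : ℝ) : ℂ)) := by
  simp_rw [← integral_repMeasure]
  exact (Complex.continuous_ofReal.tendsto _).comp (tendsto_integral_apprSeq _ hF)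

omit [TopologicalSpace X] [CompactSpace X] [T2Space X] [BorelSpace X]
  [HasOuterApproxClosed X] in
lemma hasSum_measureReal {μ : Measure X} [IsFiniteMeasure μ] {f : ℕ → Set X}
    (hm : ∀ n, MeasurableSet (f n)) (hd : Pairwise (Function.onFun Disjoint f)) :
    HasSum (fun n => μ.real (f n)) (μ.real (⋃ n, f n)) := by
  have h := measure_iUnion (μ := μ) hd hm
  have h' : ∑' n, μ (f n) ≠ ∞ := h ▸ measure_ne_top μ _
  simp only [Measure.real]
  rw [h, ENNReal.tsum_toReal_eq fun n => measure_ne_top μ _]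
  exact (ENNReal.summable_toReal h').hasSum

/-- A π-λ argument over closed sets. The form of a closed set is a limit of forms of continuous
functions, complements subtract from the identity, and disjoint unions are limits of finite sums;
`exists_operator_of_tendsto` turns each limit form into an operator. -/
lemma exists_operator_measure (B : Set X) (hB : MeasurableSet B) :
    ∃ T : E →L[ℂ] E, ∀ ψ, inner ℂ ψ (T ψ) = (((repMeasure Φ ψ).real B : ℝ) : ℂ) := by
  have hbd : ∀ (B : Set X) ψ, ‖(((repMeasure Φ ψ).real B : ℝ) : ℂ)‖ ≤ 1 * ‖ψ‖ ^ 2 := by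
    intro B ψ
    rw [Complex.norm_real, Real.norm_of_nonneg measureReal_nonneg, one_mul,
      ← repMeasure_real_univ Φ]
    exact measureReal_mono (Set.subset_univ _)
  refine MeasurableSpace.induction_on_inter
    (C := fun B _ => ∃ T : E →L[ℂ] E, ∀ ψ, inner ℂ ψ (T ψ) = (((repMeasure Φ ψ).real B : ℝ) : ℂ))
    measurableSpace_eq_generateFrom_isClosed isPiSystem_isClosed ?_ ?_ ?_ ?_ B hB
  · exact ⟨0, fun ψ => by simp⟩
  · intro F hF
    exact exists_operator_of_tendsto (hbd F) (tendsto_inner_closedApprox Φ hF)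
  · rintro A hA ⟨T, hT⟩
    refine ⟨1 - T, fun ψ => ?_⟩
    rw [measureReal_compl hA, repMeasure_real_univ, sub_apply, inner_sub_right, hT,
      one_apply_eq_self, inner_self_eq_norm_sq_to_K]
    push_cast
    rfl
  · intro f hd hm ih
    choose T hT using ih
    refine exists_operator_of_tendsto (T := fun n => ∑ k ∈ Finset.range n, T k) (hbd _) fun ψ => ?_
    simp only [sum_apply, inner_sum, hT]
    exact (Complex.hasSum_ofReal.2 (hasSum_measureReal hm hd)).tendsto_sum_nat

open Classical in
/-- The projection-valued measure extending a representation of `C(X)`. -/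
def repProjection (B : Set X) : E →L[ℂ] E :=
  if hB : MeasurableSet B then (exists_operator_measure Φ B hB).choose else 0

lemma inner_repProjection {B : Set X} (hB : MeasurableSet B) (ψ : E) :
    inner ℂ ψ (repProjection Φ B ψ) = (((repMeasure Φ ψ).real B : ℝ) : ℂ) := by
  rw [repProjection, dif_pos hB]
  exact (exists_operator_measure Φ B hB).choose_spec ψ

lemma repProjection_isSymmetric {B : Set X} (hB : MeasurableSet B) :
    (repProjection Φ B : E →ₗ[ℂ] E).IsSymmetric := by
  rw [LinearMap.isSymmetric_iff_inner_map_self_real]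
  intro ψ
  have := inner_repProjection Φ hB ψ
  rw [ContinuousLinearMap.coe_coe, inner_conj_symm, this, ← inner_conj_symm, this,
    Complex.conj_ofReal]

/-- The spectral measure of `ψ` restricted to `A` is represented by `f ↦ re ⟨P_A ψ, Φ f ψ⟩`. -/
lemma re_inner_repProjection_rep {A : Set X} (hA : MeasurableSet A) (f : C(X, ℝ)) (ψ : E) :
    (inner ℂ (repProjection Φ A ψ) (Φ (toComplex f) ψ)).re = ∫ x in A, f x ∂(repMeasure Φ ψ) := by
  set T := repProjection Φ A with hT
  have key : ∀ g : C(X, ℝ), (inner ℂ (Φ (toComplex g) ψ) (T (Φ (toComplex g) ψ))).re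
      = ∫ x in A, g x ^ 2 ∂(repMeasure Φ ψ) := by
    intro g
    rw [hT, inner_repProjection Φ hA, Complex.ofReal_re, repMeasure_rep, Measure.real,
      withDensity_apply _ hA, integral_eq_lintegral_of_nonneg_ae
      (Eventually.of_forall fun x => sq_nonneg _) (by fun_prop)]
    congr 1
    refine lintegral_congr fun x => ?_
    rw [← ofReal_norm, ← ENNReal.ofReal_pow (norm_nonneg _)]
    simp
  -- The identity for squares gives the linear one through 4f = (1+f)² − (1−f)².
  have h1 := key (1 + f)
  have h2 := key (1 - f)
  have e1 : toComplex (1 + f) = 1 + toComplex f := by ext x; simp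
  have e2 : toComplex (1 - f) = 1 - toComplex f := by ext x; simp
  have hi : ∀ g : C(X, ℝ), IntegrableOn g A (repMeasure Φ ψ) := fun g =>
    (integrable_continuousMap _ g).integrableOn
  have h3 : ∫ x in A, (1 + f) x ^ 2 ∂(repMeasure Φ ψ) - ∫ x in A, (1 - f) x ^ 2 ∂(repMeasure Φ ψ)
      = 4 * ∫ x in A, f x ∂(repMeasure Φ ψ) := by
    rw [← integral_const_mul]
    refine (integral_sub (hi ((1 + f) ^ 2)) (hi ((1 - f) ^ 2))).symm.trans
      (integral_congr_ae (Eventually.of_forall fun x => ?_))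
    simp only [ContinuousMap.pow_apply, ContinuousMap.add_apply, ContinuousMap.sub_apply,
      ContinuousMap.one_apply]
    ring
  have hs : inner ℂ (Φ (toComplex f) ψ) (T ψ)
      = (starRingEnd ℂ) (inner ℂ (T ψ) (Φ (toComplex f) ψ)) := (inner_conj_symm _ _).symm
  have hs2 : inner ℂ ψ (T (Φ (toComplex f) ψ)) = inner ℂ (T ψ) (Φ (toComplex f) ψ) :=
    (repProjection_isSymmetric Φ hA _ _).symm
  rw [e1, map_add, map_one, add_apply, one_apply_eq_self, map_add,
    inner_add_left, inner_add_right, inner_add_right, hs, hs2] at h1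
  rw [e2, map_sub, map_one, sub_apply, one_apply_eq_self, map_sub,
    inner_sub_left, inner_sub_right, inner_sub_right, hs, hs2] at h2
  simp only [Complex.add_re, Complex.sub_re, Complex.conj_re] at h1 h2
  linarith

/-- Multiplicativity of the extension, by a π-λ argument in B with A fixed. The case A = B is what
makes the operators idempotent. -/
lemma re_inner_repProjection_repProjection {A B : Set X} (hA : MeasurableSet A)
    (hB : MeasurableSet B) (ψ : E) :
    (inner ℂ (repProjection Φ A ψ) (repProjection Φ B ψ)).re
      = (repMeasure Φ ψ).real (A ∩ B) := by
  have hweak : ∀ {T : ℕ → E →L[ℂ] E} {B : Set X} (hB : MeasurableSet B),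
      (∀ ψ, Tendsto (fun n => inner ℂ ψ (T n ψ)) atTop (𝓝 (((repMeasure Φ ψ).real B : ℝ) : ℂ))) →
      Tendsto (fun n => (inner ℂ (repProjection Φ A ψ) (T n ψ)).re) atTop
        (𝓝 (inner ℂ (repProjection Φ A ψ) (repProjection Φ B ψ)).re) := fun hB h =>
    (Complex.continuous_re.tendsto _).comp (tendsto_inner_of_tendsto_inner_self
      (fun ψ => by rw [inner_repProjection Φ hB]; exact h ψ) _ _)
  refine MeasurableSpace.induction_on_inter
    (C := fun B _ => (inner ℂ (repProjection Φ A ψ) (repProjection Φ B ψ)).re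
      = (repMeasure Φ ψ).real (A ∩ B))
    measurableSpace_eq_generateFrom_isClosed isPiSystem_isClosed ?_ ?_ ?_ ?_ B hB
  · have : repProjection Φ (∅ : Set X) = 0 := ext_of_inner_self fun ψ => by
      rw [inner_repProjection Φ MeasurableSet.empty]; simp
    simp [this]
  · intro F hF
    have hF : IsClosed F := hF
    refine tendsto_nhds_unique (hweak hF.measurableSet (tendsto_inner_closedApprox Φ hF)) ?_
    simp_rw [re_inner_repProjection_rep Φ hA]
    have := tendsto_integral_apprSeq ((repMeasure Φ ψ).restrict A) hF
    rwa [measureReal_restrict_apply hF.measurableSet, Set.inter_comm] at this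
  · intro C hC ih
    have : repProjection Φ Cᶜ = 1 - repProjection Φ C := ext_of_inner_self fun ψ => by
      rw [inner_repProjection Φ hC.compl, sub_apply, inner_sub_right, inner_repProjection Φ hC,
        one_apply_eq_self, inner_self_eq_norm_sq_to_K,
        measureReal_compl hC, repMeasure_real_univ]
      push_cast
      rfl
    have h2 : inner ℂ (repProjection Φ A ψ) ψ = (((repMeasure Φ ψ).real A : ℝ) : ℂ) :=
      (repProjection_isSymmetric Φ hA ψ ψ).trans (inner_repProjection Φ hA ψ)
    rw [this, sub_apply, inner_sub_right, Complex.sub_re, ih,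
      one_apply_eq_self, h2, Complex.ofReal_re, ← Set.sdiff_eq,
      ← measureReal_inter_add_sdiff (s := A) hC]
    ring
  · intro f hd hm ih
    refine tendsto_nhds_unique (hweak (T := fun n => ∑ k ∈ Finset.range n, repProjection Φ (f k))
      (MeasurableSet.iUnion hm) fun ψ => ?_) ?_
    · simp only [sum_apply, inner_sum, inner_repProjection Φ (hm _)]
      exact (Complex.hasSum_ofReal.2 (hasSum_measureReal hm hd)).tendsto_sum_nat
    · simp only [sum_apply, inner_sum, Complex.re_sum, ih]
      rw [Set.inter_iUnion]
      exact (hasSum_measureReal (fun n => hA.inter (hm n)) fun m n hmn =>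
        (hd hmn).mono Set.inter_subset_right Set.inter_subset_right).tendsto_sum_nat

lemma norm_repProjection_sq {B : Set X} (hB : MeasurableSet B) (ψ : E) :
    ‖repProjection Φ B ψ‖ ^ 2 = (repMeasure Φ ψ).real B := by
  have := re_inner_repProjection_repProjection Φ hB hB ψ
  rw [Set.inter_self] at this
  rw [← this]
  exact (inner_self_eq_norm_sq (𝕜 := ℂ) _).symm

lemma repProjection_finset_iUnion {f : ℕ → Set X} (hm : ∀ n, MeasurableSet (f n))
    (hd : Pairwise (Function.onFun Disjoint f)) (s : Finset ℕ) :
    repProjection Φ (⋃ n, f n) = ∑ n ∈ s, repProjection Φ (f n)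
      + repProjection Φ (⋃ n : {n // n ∉ s}, f n) := by
  refine ext_of_inner_self fun ψ => ?_
  have h1 : (⋃ n, f n) = (⋃ n ∈ s, f n) ∪ ⋃ n : {n // n ∉ s}, f n := by
    ext x
    simp only [Set.mem_iUnion, Set.mem_union, Subtype.exists, exists_prop]
    constructor
    · rintro ⟨n, hn⟩
      by_cases h : n ∈ s
      · exact Or.inl ⟨n, h, hn⟩
      · exact Or.inr ⟨n, h, hn⟩
    · rintro (⟨n, -, hn⟩ | ⟨n, -, hn⟩) <;> exact ⟨n, hn⟩
  have h2 : MeasurableSet (⋃ n : {n // n ∉ s}, f n) := MeasurableSet.iUnion fun n => hm n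
  have h3 : Disjoint (⋃ n ∈ s, f n) (⋃ n : {n // n ∉ s}, f n) := by
    simp only [Set.disjoint_iUnion_left, Set.disjoint_iUnion_right]
    intro m n hn
    exact hd fun h => m.2 (h ▸ hn)
  rw [add_apply, sum_apply, inner_add_right, inner_sum, inner_repProjection Φ h2,
    inner_repProjection Φ (MeasurableSet.iUnion hm), h1,
      measureReal_union h3 h2 (measure_ne_top _ _) (measure_ne_top _ _),
    measureReal_biUnion_finset (fun i _ j _ hij => hd hij) fun n _ => hm n]
  simp only [inner_repProjection Φ (hm _)]
  push_cast
  rfl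

lemma isPVM_repProjection : IsPVM (repProjection Φ) where
  isSymmetric B hB := repProjection_isSymmetric Φ hB
  idempotent B hB := ext_of_inner_self fun ψ => by
    rw [mul_apply_eq_comp, inner_repProjection Φ hB,
      ← norm_repProjection_sq Φ hB]
    refine (repProjection_isSymmetric Φ hB _ _).symm.trans ?_
    rw [ContinuousLinearMap.coe_coe, inner_self_eq_norm_sq_to_K]
    norm_cast
  map_univ := ext_of_inner_self fun ψ => by
    rw [inner_repProjection Φ MeasurableSet.univ, repMeasure_real_univ,
      one_apply_eq_self, inner_self_eq_norm_sq_to_K]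
    norm_cast
  hasSum_iUnion f hm hd ψ := by
    rw [HasSum, SummationFilter.unconditional_filter, tendsto_iff_norm_sub_tendsto_zero]
    -- After removing finitely many sets the error is the operator of the remaining union, and its
    -- squared norm is a tail of the scalar measure series. This gives strong, not merely weak,
    -- convergence.
    have h0 : Tendsto (fun s : Finset ℕ => ∑' n : {n // n ∉ s}, (repMeasure Φ ψ).real (f n))
      atTop (𝓝 0) := tendsto_tsum_compl_atTop_zero fun n => (repMeasure Φ ψ).real (f n)
    have h1 := h0.sqrt
    rw [Real.sqrt_zero] at h1
    refine h1.congr fun s => ?_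
    rw [repProjection_finset_iUnion Φ hm hd s, add_apply, sum_apply, norm_sub_rev,
      add_sub_cancel_left, ← Real.sqrt_sq (norm_nonneg _),
      norm_repProjection_sq Φ (MeasurableSet.iUnion fun n : {n // n ∉ s} => hm n)]
    congr 1
    have hd' : Pairwise (Function.onFun Disjoint fun n : {n // n ∉ s} => f n) :=
      fun m n hmn => hd fun h => hmn (Subtype.ext h)
    rw [Measure.real, measure_iUnion hd' fun n => hm n,
      ENNReal.tsum_toReal_eq fun n => measure_ne_top _ _]
    rfl

lemma measure_isPVM_repProjection (ψ : E) :
    (isPVM_repProjection Φ).measure ψ = repMeasure Φ ψ := by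
  ext B hB
  rw [← measureReal_eq_measureReal_iff, (isPVM_repProjection Φ).measureReal_apply hB,
    norm_repProjection_sq Φ hB]

end Representation

/-! ### Further integral identities for the scalar measures -/

section RepExtra

variable {X : Type*} [TopologicalSpace X] [CompactSpace X] [T2Space X] [MeasurableSpace X]
  [BorelSpace X] {E : Type*} [NormedAddCommGroup E] [InnerProductSpace ℂ E] [CompleteSpace E]
  (Φ : C(X, ℂ) →⋆ₐ[ℂ] (E →L[ℂ] E))

lemma inner_rep_rep (f g : C(X, ℂ)) (ψ : E) :
    inner ℂ (Φ f ψ) (Φ g ψ) = ∫ x, (starRingEnd ℂ) (f x) * g x ∂(repMeasure Φ ψ) := by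
  have := integral_repMeasure_complex Φ (star f * g) ψ
  rw [map_mul, mul_apply_eq_comp, inner_rep_star, star_star] at this
  exact this.symm

lemma integral_repMeasure_rep [HasOuterApproxClosed X] {F : Type*} [NormedAddCommGroup F]
    [NormedSpace ℝ F] (f : C(X, ℂ)) (ψ : E) (g : X → F) :
    ∫ x, g x ∂(repMeasure Φ (Φ f ψ)) = ∫ x, ‖f x‖ ^ 2 • g x ∂(repMeasure Φ ψ) := by
  have e : (fun x => ‖f x‖ₑ ^ 2) = fun x => ((‖f x‖₊ ^ 2 : ℝ≥0) : ℝ≥0∞) := by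
    ext x
    rw [enorm_eq_nnnorm]; norm_cast
  rw [repMeasure_rep, e, integral_withDensity_eq_integral_smul (by fun_prop)]
  rfl

end RepExtra

/-! ### Resolvents of self-adjoint operators -/

section Resolvent

variable {E : Type*} [NormedAddCommGroup E] [InnerProductSpace ℂ E]

namespace IsResolvent

variable {H : E →ₗ.[ℂ] E} {z w : ℂ} {R S : E →L[ℂ] E}

lemma apply_eq (h : IsResolvent H z R) (φ : H.domain) : R (H φ - z • (φ : E)) = φ := h.2 φ

lemma exists_domain (h : IsResolvent H z R) (ψ : E) :
    ∃ χ : H.domain, R ψ = χ ∧ H χ - z • (χ : E) = ψ := by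
  obtain ⟨hd, he⟩ := h.1 ψ
  exact ⟨⟨R ψ, hd⟩, rfl, he⟩

/-- The resolvent identity. -/
lemma sub_eq (hR : IsResolvent H z R) (hS : IsResolvent H w S) : R - S = (z - w) • (R * S) := by
  ext ψ
  obtain ⟨χ, h1, h2⟩ := hS.exists_domain ψ
  have h3 : ψ = (H χ - z • (χ : E)) + (z - w) • (χ : E) := by
    rw [← h2, sub_smul]; abel
  rw [sub_apply, smul_apply, mul_apply_eq_comp, h1]
  conv_lhs => rw [h3]
  rw [map_add, hR.apply_eq, map_smul]
  abel

lemma unique (hR : IsResolvent H z R) (hS : IsResolvent H z S) : R = S := by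
  have := hR.sub_eq hS
  rwa [sub_self, zero_smul, sub_eq_zero] at this

lemma resolventOp_eq (hR : IsResolvent H z R) : resolventOp H z = R := by
  have h : ∃ R, IsResolvent H z R := ⟨R, hR⟩
  rw [resolventOp, dif_pos h]
  exact h.choose_spec.unique hR

end IsResolvent

/-- A symmetric operator all of whose nonreal points are in the resolvent set. -/
structure IsSelfAdjointOp (H : E →ₗ.[ℂ] E) : Prop where
  symm : ∀ φ ψ : H.domain, inner ℂ (H φ) (ψ : E) = inner ℂ (φ : E) (H ψ)
  exists_resolvent : ∀ z : ℂ, z.im ≠ 0 → ∃ R, IsResolvent H z R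

namespace IsSelfAdjointOp

variable {H : E →ₗ.[ℂ] E} (hH : IsSelfAdjointOp H)
include hH

lemma isResolvent {z : ℂ} (hz : z.im ≠ 0) : IsResolvent H z (resolventOp H z) := by
  obtain ⟨R, hR⟩ := hH.exists_resolvent z hz
  rwa [hR.resolventOp_eq]

lemma inner_resolvent {z : ℂ} (hz : z.im ≠ 0) (φ ψ : E) :
    inner ℂ (resolventOp H z φ) ψ = inner ℂ φ (resolventOp H ((starRingEnd ℂ) z) ψ) := by
  obtain ⟨χ, h1, h2⟩ := (hH.isResolvent hz).exists_domain φ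
  obtain ⟨ξ, h3, h4⟩ :=
    (hH.isResolvent (z := (starRingEnd ℂ) z) (by simpa using hz)).exists_domain ψ
  rw [h1, h3, ← h2, ← h4, inner_sub_left, inner_sub_right, hH.symm, inner_smul_left,
    inner_smul_right]

lemma adjoint_resolvent [CompleteSpace E] {z : ℂ} (hz : z.im ≠ 0) :
    ContinuousLinearMap.adjoint (resolventOp H z) = resolventOp H ((starRingEnd ℂ) z) := by
  symm
  rw [ContinuousLinearMap.eq_adjoint_iff]
  intro φ ψ
  rw [hH.inner_resolvent (by simpa using hz), Complex.conj_conj]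

lemma im_inner_self (χ : H.domain) : (inner ℂ (χ : E) (H χ)).im = 0 := by
  have h := inner_conj_symm (𝕜 := ℂ) (χ : E) (H χ)
  rw [hH.symm] at h
  exact Complex.conj_eq_iff_im.1 h

/-- Only z contributes an imaginary part, as ⟨χ, H χ⟩ is real. This yields the norm bound 1/|Im z|,
and later the link between ‖Rψ‖² and the Poisson integral of the spectral measure. -/
lemma im_inner_resolvent {z : ℂ} (hz : z.im ≠ 0) (ψ : E) :
    (inner ℂ ψ (resolventOp H z ψ)).im = z.im * ‖resolventOp H z ψ‖ ^ 2 := by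
  obtain ⟨χ, h1, h2⟩ := (hH.isResolvent hz).exists_domain ψ
  rw [h1, ← h2, inner_sub_left, inner_smul_left, hH.symm, inner_self_eq_norm_sq_to_K,
    Complex.sub_im, hH.im_inner_self]
  have : (((starRingEnd ℂ) z * ((‖(χ : E)‖ : ℂ)) ^ 2)).im = -(z.im * ‖(χ : E)‖ ^ 2) := by
    rw [← Complex.ofReal_pow, Complex.im_mul_ofReal, Complex.conj_im, neg_mul]
  exact (congrArg (0 - ·) this).trans (by ring)

lemma norm_resolvent_le {z : ℂ} (hz : z.im ≠ 0) (ψ : E) :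
    ‖resolventOp H z ψ‖ ≤ |z.im|⁻¹ * ‖ψ‖ := by
  have h := hH.im_inner_resolvent hz ψ
  have h1 : |(inner ℂ ψ (resolventOp H z ψ)).im| ≤ ‖ψ‖ * ‖resolventOp H z ψ‖ :=
    (Complex.abs_im_le_norm _).trans (norm_inner_le_norm _ _)
  rw [h, abs_mul, abs_of_nonneg (sq_nonneg ‖resolventOp H z ψ‖)] at h1
  rcases (norm_nonneg (resolventOp H z ψ)).eq_or_lt with h0 | h0
  · rw [← h0]; positivity
  · rw [le_inv_mul_iff₀ (abs_pos.2 hz)]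
    nlinarith

lemma commute_resolvent {z w : ℂ} (hz : z.im ≠ 0) (hw : w.im ≠ 0) :
    Commute (resolventOp H z) (resolventOp H w) := by
  rcases eq_or_ne z w with rfl | h
  · exact Commute.refl _
  have h1 := (hH.isResolvent hz).sub_eq (hH.isResolvent hw)
  have h2 := (hH.isResolvent hw).sub_eq (hH.isResolvent hz)
  rw [← neg_sub, h1, ← neg_sub z w, neg_smul, neg_inj] at h2
  exact smul_right_injective _ (sub_ne_zero.2 h) h2

variable [CompleteSpace E]

lemma star_resolvent_I : star (resolventOp H Complex.I) = resolventOp H (-Complex.I) := by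
  rw [ContinuousLinearMap.star_eq_adjoint, hH.adjoint_resolvent (by simp), Complex.conj_I]

lemma isStarNormal : IsStarNormal (resolventOp H Complex.I) :=
  ⟨by rw [hH.star_resolvent_I]; exact hH.commute_resolvent (by simp) (by simp)⟩

omit hH in
/-- The continuous functional calculus of `(H - i)⁻¹`. -/
def calculus (hH : IsSelfAdjointOp H) :
    C(spectrum ℂ (resolventOp H Complex.I), ℂ) →⋆ₐ[ℂ] (E →L[ℂ] E) :=
  cfcHom hH.isStarNormal

omit hH in
/-- The inclusion of the spectrum of `(H - i)⁻¹` in the plane. -/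
def coord (H : E →ₗ.[ℂ] E) : C(spectrum ℂ (resolventOp H Complex.I), ℂ) :=
  (ContinuousMap.id ℂ).restrict _

omit hH [CompleteSpace E] in
@[simp] lemma coord_apply (w : spectrum ℂ (resolventOp H Complex.I)) : coord H w = w := rfl

lemma calculus_coord : hH.calculus (coord H) = resolventOp H Complex.I :=
  cfcHom_id hH.isStarNormal

/-- The resolvent identity R − R* = 2i R*R, read through the functional calculus, places the
spectrum on the circle of points 1/(t − i), with t real, together with 0. -/
lemma spectrum_im (w : spectrum ℂ (resolventOp H Complex.I)) : (w : ℂ).im = ‖(w : ℂ)‖ ^ 2 := by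
  have h1 : coord H - star (coord H) = (2 * Complex.I) • (star (coord H) * coord H) := by
    apply (cfcHom_isClosedEmbedding hH.isStarNormal).injective
    change hH.calculus _ = hH.calculus _
    rw [map_sub, map_star, map_smul, map_mul, map_star, hH.calculus_coord, hH.star_resolvent_I,
      ((hH.isResolvent (by simp)).sub_eq (hH.isResolvent (by simp))),
      (hH.commute_resolvent (by simp) (by simp)).eq]
    congr 1
    ring
  have h2 := congrArg Complex.im (DFunLike.congr_fun h1 w)
  simp only [ContinuousMap.sub_apply, coord_apply, ContinuousMap.star_apply, RCLike.star_def,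
    Complex.sub_im, Complex.conj_im, ContinuousMap.smul_apply, ContinuousMap.mul_apply,
    Complex.conj_mul', smul_eq_mul] at h2
  rw [← Complex.ofReal_pow, Complex.im_mul_ofReal] at h2
  simp at h2
  linarith

omit hH in
/-- The energy `t` with `w = (t - i)⁻¹`. -/
def energy (H : E →ₗ.[ℂ] E) (w : spectrum ℂ (resolventOp H Complex.I)) : ℝ := ((w : ℂ)⁻¹).re

omit hH [CompleteSpace E] in
lemma measurable_energy : Measurable (energy H) :=
  Complex.measurable_re.comp (measurable_subtype_coe.inv)

lemma mul_energy_sub_I {w : spectrum ℂ (resolventOp H Complex.I)} (hw : (w : ℂ) ≠ 0) :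
    (w : ℂ) * ((energy H w : ℂ) - Complex.I) = 1 := by
  have h := hH.spectrum_im w
  have h3 : (w : ℂ)⁻¹ = (energy H w : ℂ) - Complex.I := by
    apply Complex.ext
    · simp [energy]
    · have h4 : Complex.normSq (w : ℂ) ≠ 0 := by simpa using hw
      simp [Complex.inv_im, h, Complex.normSq_eq_norm_sq, hw]
  rw [← h3, mul_inv_cancel₀ hw]

omit [CompleteSpace E] in
lemma resolvent_injective {z : ℂ} (hz : z.im ≠ 0) (ψ : E) (h : resolventOp H z ψ = 0) :
    ψ = 0 := by
  obtain ⟨χ, h1, h2⟩ := (hH.isResolvent hz).exists_domain ψ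
  have : χ = 0 := Subtype.ext (h1.symm.trans h)
  rw [← h2, this]
  simp

omit hH in
/-- The spectral projections constructed from the functional calculus of `(H - i)⁻¹`. -/
def projection (hH : IsSelfAdjointOp H) (B : Set ℝ) : E →L[ℂ] E :=
  repProjection hH.calculus (energy H ⁻¹' B)

lemma isPVM_projection : IsPVM hH.projection :=
  (isPVM_repProjection hH.calculus).map measurable_energy

lemma measure_projection (ψ : E) :
    hH.isPVM_projection.measure ψ = (repMeasure hH.calculus ψ).map (energy H) := by
  have := (isPVM_repProjection hH.calculus).measure_map (measurable_energy (H := H)) ψ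
  rwa [measure_isPVM_repProjection] at this

/-- The point 0 corresponds to infinite energy and `energy` takes a default value there. It carries
no mass: its projection applied to ψ lies in the kernel of the resolvent, which is injective. -/
lemma ae_ne_zero (ψ : E) :
    ∀ᵐ w : spectrum ℂ (resolventOp H Complex.I) ∂(repMeasure hH.calculus ψ), (w : ℂ) ≠ 0 := by
  set Z : Set (spectrum ℂ (resolventOp H Complex.I)) := Subtype.val ⁻¹' {(0 : ℂ)} with hZ
  have hZm : MeasurableSet Z := measurable_subtype_coe (measurableSet_singleton (0 : ℂ))
  have hQ := isPVM_repProjection hH.calculus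
  set χ := repProjection hH.calculus Z ψ with hχ
  have h1 : repMeasure hH.calculus χ = (repMeasure hH.calculus ψ).restrict Z := by
    rw [← measure_isPVM_repProjection, hQ.measure_map_apply hZm, measure_isPVM_repProjection]
  have h2 : ‖resolventOp H Complex.I χ‖ ^ 2 = 0 := by
    rw [← hH.calculus_coord, ← integral_norm_sq_repMeasure, h1]
    refine setIntegral_eq_zero_of_forall_eq_zero fun w hw => ?_
    have : (w : ℂ) = 0 := hw
    simp [this]
  have h3 : χ = 0 := hH.resolvent_injective (z := Complex.I) (by simp) χ (by simpa using h2)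
  have h4 := hQ.measure_apply hZm ψ
  rw [← hχ, h3, measure_isPVM_repProjection] at h4
  have h5 : {w : spectrum ℂ (resolventOp H Complex.I) | ¬ (w : ℂ) ≠ 0} = Z := by
    ext w; simp [hZ]
  rw [ae_iff, h5, h4]
  simp

lemma energy_sq_add_one {w : spectrum ℂ (resolventOp H Complex.I)} (hw : (w : ℂ) ≠ 0) :
    ‖(w : ℂ)‖ ^ 2 * (energy H w ^ 2 + 1) = 1 := by
  have h := congrArg (fun x => ‖x‖ ^ 2) (hH.mul_energy_sub_I hw)
  simp only [norm_mul, norm_one, one_pow, mul_pow] at h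
  rw [← Complex.normSq_eq_norm_sq ((energy H w : ℂ) - Complex.I)] at h
  have h2 : Complex.normSq ((energy H w : ℂ) - Complex.I) = energy H w ^ 2 + 1 := by
    simp [Complex.normSq_apply, sq]
  rwa [h2] at h

/-- This is w t = 1 + i w multiplied by the conjugate of w. Both sides vanish at w = 0, so no
exceptional set is needed. -/
lemma norm_sq_mul_energy (w : spectrum ℂ (resolventOp H Complex.I)) :
    ((‖(w : ℂ)‖ ^ 2 * energy H w : ℝ) : ℂ)
      = (starRingEnd ℂ) (w : ℂ) * (1 + Complex.I * w) := by
  rcases eq_or_ne (w : ℂ) 0 with hw | hw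
  · simp [hw]
  · have h := hH.mul_energy_sub_I hw
    push_cast
    rw [← Complex.conj_mul']
    linear_combination (starRingEnd ℂ) (w : ℂ) * h

end IsSelfAdjointOp

end Resolvent

/-! ### The spectral theorem for unbounded operators -/

section SpectralTheorem

variable {E : Type*} [NormedAddCommGroup E] [InnerProductSpace ℂ E] [CompleteSpace E]
  {H : E →ₗ.[ℂ] E}

namespace IsSelfAdjointOp

variable (hH : IsSelfAdjointOp H)
include hH

lemma integral_projection {F : Type*} [NormedAddCommGroup F] [NormedSpace ℝ F]
    {g : ℝ → F} (hg : StronglyMeasurable g) (ψ : E) :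
    ∫ t, g t ∂(hH.isPVM_projection.measure ψ) = ∫ w,
      g (energy H w) ∂(repMeasure hH.calculus ψ) := by
  rw [hH.measure_projection, integral_map measurable_energy.aemeasurable hg.aestronglyMeasurable]

/-- Every vector is reached from the point i: with χ = (H − z)⁻¹ψ and φ = (H − i)χ one has χ = Φ(w)
φ and ψ = Φ(1 − (z − i)w) φ, so both sides become integrals against the measure of φ. -/
lemma integral_inv_sub_projection {z : ℂ} (hz : z.im ≠ 0) (ψ : E) :
    ∫ t : ℝ, ((t : ℂ) - z)⁻¹ ∂(hH.isPVM_projection.measure ψ)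
      = inner ℂ ψ (resolventOp H z ψ) := by
  obtain ⟨χ, h1, h2⟩ := (hH.isResolvent hz).exists_domain ψ
  set φ : E := H χ - Complex.I • (χ : E) with hφ
  have h3 : (χ : E) = hH.calculus (coord H) φ := by
    rw [hH.calculus_coord, hφ, (hH.isResolvent (by simp)).apply_eq]
  set f := 1 - (z - Complex.I) • coord H with hf
  have h4 : ψ = hH.calculus f φ := by
    rw [hf, map_sub hH.calculus, map_one, map_smul hH.calculus, sub_apply, smul_apply,
      one_apply_eq_self, ← h3, ← h2, hφ,
      sub_smul]
    abel
  rw [hH.integral_projection (by fun_prop), h1]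
  conv_lhs => rw [h4]
  conv_rhs => rw [h3, h4]
  rw [integral_repMeasure_rep, inner_rep_rep]
  refine integral_congr_ae ((hH.ae_ne_zero φ).mono fun w hw => ?_)
  have h5 := hH.mul_energy_sub_I hw
  have h6 : f w = (w : ℂ) * ((energy H w : ℂ) - z) := by
    simp only [hf, ContinuousMap.sub_apply, ContinuousMap.one_apply, ContinuousMap.smul_apply,
      coord_apply, smul_eq_mul]
    linear_combination -h5
  have h7 : (energy H w : ℂ) - z ≠ 0 := by
    intro h
    have := congrArg Complex.im h
    simp at this
    exact hz this
  dsimp only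
  rw [Complex.real_smul, Complex.ofReal_pow, ← Complex.conj_mul', h6, coord_apply]
  field_simp

/-- A vector of the domain is Rφ, whose measure has density |w|² relative to that of φ, and t²|w|² ≤
1. Conversely, a finite second moment makes 1/w square integrable; applying continuous approximants
of 1/w to ψ gives a Cauchy sequence whose limit φ satisfies Rφ = ψ. -/
lemma mem_domain_iff (ψ : E) :
    ψ ∈ H.domain ↔ ∫⁻ t, ‖t‖ₑ ^ 2 ∂(hH.isPVM_projection.measure ψ) < ∞ := by
  have h0 : ∫⁻ t, ‖t‖ₑ ^ 2 ∂(hH.isPVM_projection.measure ψ)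
      = ∫⁻ w, ‖energy H w‖ₑ ^ 2 ∂(repMeasure hH.calculus ψ) := by
    rw [hH.measure_projection, lintegral_map (by fun_prop) measurable_energy]
  rw [h0]
  constructor
  · intro h
    set φ : E := H ⟨ψ, h⟩ - Complex.I • ψ with hφ
    have h3 : ψ = hH.calculus (coord H) φ := by
      rw [hH.calculus_coord, hφ]
      exact ((hH.isResolvent (by simp)).apply_eq ⟨ψ, h⟩).symm
    rw [h3, repMeasure_rep, lintegral_withDensity_eq_lintegral_mul _ (by fun_prop)
      (by have := measurable_energy (H := H); fun_prop)]
    refine lt_of_le_of_lt (lintegral_mono (g := fun _ => 1) fun w => ?_) (by simp)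
    simp only [Pi.mul_apply, coord_apply]
    rcases eq_or_ne (w : ℂ) 0 with hw | hw
    · simp [hw]
    · rw [← mul_pow, ← enorm_norm (w : ℂ), ← enorm_mul, ← ofReal_norm, ← ENNReal.ofReal_pow
        (norm_nonneg _), ← ENNReal.ofReal_one]
      refine ENNReal.ofReal_le_ofReal ?_
      rw [Real.norm_eq_abs, sq_abs, mul_pow]
      nlinarith [hH.energy_sq_add_one hw, sq_nonneg ‖(w : ℂ)‖]
  · intro h
    set ρ := repMeasure hH.calculus ψ with hρ
    have hint : Integrable (fun w => energy H w ^ 2 + 1) ρ := by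
      refine Integrable.add ⟨(measurable_energy.pow_const 2).aestronglyMeasurable, ?_⟩
        (integrable_const _)
      simpa [HasFiniteIntegral] using h
    -- A regularized inverse of w, continuous even if 0 is in the spectrum. The product w · g n lies
    -- in [0, 1], so 1 + t² dominates |g n − 1/w|².
    let g : ℕ → C(spectrum ℂ (resolventOp H Complex.I), ℂ) := fun n =>
      ⟨fun w => (starRingEnd ℂ) (w : ℂ) * ((‖(w : ℂ)‖ ^ 2 + (1 / ((n : ℝ) + 1)) : ℝ) : ℂ)⁻¹, by
        have h1 : ∀ w : spectrum ℂ (resolventOp H Complex.I),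
            ((‖(w : ℂ)‖ ^ 2 + (1 / ((n : ℝ) + 1)) : ℝ) : ℂ) ≠ 0 := fun w => by
          rw [Complex.ofReal_ne_zero]; positivity
        have h2 : Continuous fun w : spectrum ℂ (resolventOp H Complex.I) =>
            ((‖(w : ℂ)‖ ^ 2 + (1 / ((n : ℝ) + 1)) : ℝ) : ℂ) := by fun_prop
        exact (by fun_prop : Continuous fun w : spectrum ℂ (resolventOp H Complex.I) =>
          (starRingEnd ℂ) (w : ℂ)).mul (h2.inv₀ h1)⟩
    have hg : ∀ n (w : spectrum ℂ (resolventOp H Complex.I)), (w : ℂ) * g n w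
        = ((‖(w : ℂ)‖ ^ 2 / (‖(w : ℂ)‖ ^ 2 + (1 / ((n : ℝ) + 1))) : ℝ) : ℂ) := fun n w => by
      simp only [g, ContinuousMap.coe_mk]
      rw [← mul_assoc, Complex.mul_conj']
      push_cast
      rfl
    have hlim : ∀ w : spectrum ℂ (resolventOp H Complex.I), (w : ℂ) ≠ 0 →
        Tendsto (fun n => (w : ℂ) * g n w) atTop (𝓝 1) := by
      intro w hw
      have hw' : ‖(w : ℂ)‖ ^ 2 ≠ 0 := by simpa using hw
      simp_rw [hg]
      rw [← Complex.ofReal_one]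
      refine (Complex.continuous_ofReal.tendsto _).comp ?_
      have : Tendsto (fun n : ℕ => ‖(w : ℂ)‖ ^ 2 / (‖(w : ℂ)‖ ^ 2 + (1 / ((n : ℝ) + 1)))) atTop
          (𝓝 (‖(w : ℂ)‖ ^ 2 / (‖(w : ℂ)‖ ^ 2 + 0))) :=
        tendsto_const_nhds.div (tendsto_const_nhds.add tendsto_one_div_add_atTop_nhds_zero_nat)
          (by simpa using hw')
      simpa [hw'] using this
    have hbd : ∀ n (w : spectrum ℂ (resolventOp H Complex.I)), ‖(w : ℂ) * g n w - 1‖ ≤ 1 := by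
      intro n w
      rw [hg, ← Complex.ofReal_one, ← Complex.ofReal_sub, Complex.norm_real, Real.norm_eq_abs,
        abs_le]
      have h1 : 0 ≤ ‖(w : ℂ)‖ ^ 2 / (‖(w : ℂ)‖ ^ 2 + (1 / ((n : ℝ) + 1))) := by positivity
      have h2 : ‖(w : ℂ)‖ ^ 2 / (‖(w : ℂ)‖ ^ 2 + (1 / ((n : ℝ) + 1))) ≤ 1 := by
        rw [div_le_one (by positivity)]
        have : 0 < 1 / ((n : ℝ) + 1) := by positivity
        linarith
      constructor <;> linarith
    have hinv : ∀ w : spectrum ℂ (resolventOp H Complex.I), (w : ℂ) ≠ 0 → ∀ n,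
        ‖g n w - (w : ℂ)⁻¹‖ ^ 2 = ‖(w : ℂ) * g n w - 1‖ ^ 2 * (energy H w ^ 2 + 1) := by
      intro w hw n
      have h1 : (w : ℂ) * g n w - 1 = (w : ℂ) * (g n w - (w : ℂ)⁻¹) := by
        field_simp
      rw [h1, norm_mul, mul_pow]
      linear_combination -‖g n w - (w : ℂ)⁻¹‖ ^ 2 * hH.energy_sq_add_one hw
    have hmeas : ∀ n, AEStronglyMeasurable (fun w => ‖g n w - (w : ℂ)⁻¹‖ ^ 2) ρ := fun n =>
      (((g n).continuous.measurable.sub measurable_subtype_coe.inv).norm.pow_const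
        2).aestronglyMeasurable
    have hdom : ∀ n, ∀ᵐ w ∂ρ, ‖‖g n w - (w : ℂ)⁻¹‖ ^ 2‖ ≤ energy H w ^ 2 + 1 := fun n =>
      (hH.ae_ne_zero ψ).mono fun w hw => by
        rw [Real.norm_of_nonneg (sq_nonneg _), hinv w hw]
        have := pow_le_one₀ (n := 2) (norm_nonneg _) (hbd n w)
        nlinarith [sq_nonneg (energy H w)]
    have ha : Tendsto (fun n => ∫ w, ‖g n w - (w : ℂ)⁻¹‖ ^ 2 ∂ρ) atTop (𝓝 0) := by
      have := tendsto_integral_of_dominated_convergence (μ := ρ)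
        (F := fun n w => ‖g n w - (w : ℂ)⁻¹‖ ^ 2) (f := fun _ => (0 : ℝ)) _ hmeas hint hdom
        ((hH.ae_ne_zero ψ).mono fun w hw => by
          simp_rw [hinv w hw]
          have := (((hlim w hw).sub_const 1).norm.pow 2).mul_const (energy H w ^ 2 + 1)
          simpa using this)
      simpa using this
    have hcauchy : CauchySeq fun n => hH.calculus (g n) ψ := by
      rw [Metric.cauchySeq_iff']
      intro ε hε
      obtain ⟨N, hN⟩ := (ha.eventually (gt_mem_nhds (show 0 < ε ^ 2 / 4 by
        positivity))).exists_forall_of_atTop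
      refine ⟨N, fun n hn => ?_⟩
      rw [dist_eq_norm, ← sub_apply, ← map_sub]
      refine lt_of_pow_lt_pow_left₀ 2 hε.le ?_
      rw [← integral_norm_sq_repMeasure]
      have hi : ∀ n, Integrable (fun w => ‖g n w - (w : ℂ)⁻¹‖ ^ 2) ρ := fun n =>
        hint.mono' (hmeas n) (hdom n)
      calc ∫ w, ‖(g n - g N) w‖ ^ 2 ∂ρ
          ≤ ∫ w, (2 * ‖g n w - (w : ℂ)⁻¹‖ ^ 2 + 2 * ‖g N w - (w : ℂ)⁻¹‖ ^ 2) ∂ρ := by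
            refine integral_mono_of_nonneg (Eventually.of_forall fun w => sq_nonneg _)
              (((hi n).const_mul 2).add ((hi N).const_mul 2)) (Eventually.of_forall fun w => ?_)
            have h1 : (g n - g N) w = (g n w - (w : ℂ)⁻¹) - (g N w - (w : ℂ)⁻¹) := by
              simp
            have h2 := norm_sub_le (g n w - (w : ℂ)⁻¹) (g N w - (w : ℂ)⁻¹)
            dsimp only
            rw [h1]
            nlinarith [sq_nonneg (‖g n w - (w : ℂ)⁻¹‖ - ‖g N w - (w : ℂ)⁻¹‖), norm_nonneg
              (g n w - (w : ℂ)⁻¹ - (g N w - (w : ℂ)⁻¹))]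
        _ = 2 * ∫ w, ‖g n w - (w : ℂ)⁻¹‖ ^ 2 ∂ρ + 2 * ∫ w, ‖g N w - (w : ℂ)⁻¹‖ ^ 2 ∂ρ := by
            rw [integral_add ((hi n).const_mul 2) ((hi N).const_mul 2), integral_const_mul,
              integral_const_mul]
        _ < ε ^ 2 := by linarith [hN n hn, hN N le_rfl]
    obtain ⟨φ, hφ⟩ := cauchySeq_tendsto_of_complete hcauchy
    have h1 : Tendsto (fun n => resolventOp H Complex.I (hH.calculus (g n) ψ)) atTop
        (𝓝 (resolventOp H Complex.I φ)) := ((resolventOp H Complex.I).continuous.tendsto _).comp hφ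
    have h2 : Tendsto (fun n => resolventOp H Complex.I (hH.calculus (g n) ψ)) atTop (𝓝 ψ) := by
      rw [tendsto_iff_norm_sub_tendsto_zero]
      have h3 : Tendsto (fun n => ∫ w, ‖(coord H * g n - 1) w‖ ^ 2 ∂ρ) atTop (𝓝 0) := by
        have := tendsto_integral_of_dominated_convergence (μ := ρ)
          (F := fun n w => ‖(coord H * g n - 1) w‖ ^ 2) (f := fun _ => (0 : ℝ)) (fun _ => 1)
          (fun n => by fun_prop) (integrable_const _)
          (fun n => Eventually.of_forall fun w => by
            rw [Real.norm_of_nonneg (sq_nonneg _)]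
            exact pow_le_one₀ (n := 2) (norm_nonneg _) (hbd n w))
          ((hH.ae_ne_zero ψ).mono fun w hw => by
            have := ((hlim w hw).sub_const 1).norm.pow 2
            simpa using this)
        simpa using this
      have h4 := h3.sqrt
      rw [Real.sqrt_zero] at h4
      refine h4.congr fun n => ?_
      rw [hρ, integral_norm_sq_repMeasure, Real.sqrt_sq (norm_nonneg _), map_sub, map_mul, map_one,
        hH.calculus_coord]
      rfl
    have h3 := tendsto_nhds_unique h1 h2
    rw [← h3]
    exact ((hH.isResolvent (by simp)).1 φ).1

lemma inner_apply_projection {ψ : E} (h : ψ ∈ H.domain) :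
    inner ℂ ψ (H ⟨ψ, h⟩) = ((∫ t, t ∂(hH.isPVM_projection.measure ψ) : ℝ) : ℂ) := by
  set φ : E := H ⟨ψ, h⟩ - Complex.I • ψ with hφ
  have h3 : ψ = hH.calculus (coord H) φ := by
    rw [hH.calculus_coord, hφ]
    exact ((hH.isResolvent (by simp)).apply_eq ⟨ψ, h⟩).symm
  have h4 : H ⟨ψ, h⟩ = hH.calculus (1 + Complex.I • coord H) φ := by
    rw [map_add, map_one, map_smul, add_apply, smul_apply, one_apply_eq_self, ← h3, hφ]
    abel
  rw [h4, hH.integral_projection (g := fun t => t) stronglyMeasurable_id]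
  conv_lhs => rw [h3]
  conv_rhs => rw [h3]
  rw [inner_rep_rep, integral_repMeasure_rep, ← integral_complex_ofReal]
  congr 1
  ext w
  exact (hH.norm_sq_mul_energy w).symm

/-- The spectral theorem. -/
lemma isSpectralResolution_projection : IsSpectralResolution H hH.projection where
  isSymmetric := hH.isPVM_projection.isSymmetric
  idempotent := hH.isPVM_projection.idempotent
  map_univ := hH.isPVM_projection.map_univ
  hasSum_iUnion := hH.isPVM_projection.hasSum_iUnion
  eq_integral ψ := ⟨hH.isPVM_projection.measure ψ,
    fun _ hB => hH.isPVM_projection.measure_apply hB ψ, hH.mem_domain_iff ψ,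
    hH.inner_apply_projection⟩

end IsSelfAdjointOp

end SpectralTheorem

/-! ### Uniqueness of the spectral resolution -/

section Uniqueness

variable {E : Type*} [NormedAddCommGroup E] [InnerProductSpace ℂ E] {H : E →ₗ.[ℂ] E}

namespace IsSpectralResolution

variable {P Q : Set ℝ → E →L[ℂ] E}

lemma isPVM (hP : IsSpectralResolution H P) : IsPVM P :=
  ⟨hP.isSymmetric, hP.idempotent, hP.map_univ, hP.hasSum_iUnion⟩

lemma mem_domain_iff (hP : IsSpectralResolution H P) (ψ : E) :
    ψ ∈ H.domain ↔ ∫⁻ t, ‖t‖ₑ ^ 2 ∂(hP.isPVM.measure ψ) < ∞ := by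
  obtain ⟨ν, h1, h2, -⟩ := hP.eq_integral ψ
  have : hP.isPVM.measure ψ = ν := by
    ext B hB
    rw [h1 B hB, hP.isPVM.measure_apply hB]
  rw [this, h2]

lemma inner_apply (hP : IsSpectralResolution H P) (χ : H.domain) :
    inner ℂ (χ : E) (H χ) = ((∫ t, t ∂(hP.isPVM.measure (χ : E)) : ℝ) : ℂ) := by
  obtain ⟨ν, h1, -, h2⟩ := hP.eq_integral χ
  have : hP.isPVM.measure (χ : E) = ν := by
    ext B hB
    rw [h1 B hB, hP.isPVM.measure_apply hB]
  rw [this, ← h2 χ.2]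

lemma integrable (hP : IsSpectralResolution H P) (χ : H.domain) :
    Integrable (fun t : ℝ => t) (hP.isPVM.measure (χ : E)) := by
  have h := (hP.mem_domain_iff χ).1 χ.2
  have : MemLp (fun t : ℝ => t) 2 (hP.isPVM.measure (χ : E)) := by
    refine ⟨by fun_prop, ?_⟩
    rw [eLpNorm_lt_top_iff_lintegral_rpow_enorm_lt_top (by norm_num) (by norm_num)]
    simpa using h
  exact this.integrable (by norm_num)

lemma apply_mem_domain (hP : IsSpectralResolution H P) {A : Set ℝ} (hA : MeasurableSet A)
    (χ : H.domain) : P A χ ∈ H.domain := by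
  rw [hP.mem_domain_iff, hP.isPVM.measure_map_apply hA]
  exact (setLIntegral_le_lintegral _ _).trans_lt ((hP.mem_domain_iff χ).1 χ.2)

/-- The measure of χ + ξ splits over A and its complement into those of χ and ξ, so the energy form
is additive on χ + ξ and its cross term must vanish. -/
lemma re_inner_compl_self (hP : IsSpectralResolution H P) (hH : IsSelfAdjointOp H) {A : Set ℝ}
    (hA : MeasurableSet A) (χ ξ : H.domain) (hχ : P A χ = χ) (hξ : P A ξ = 0) :
    (inner ℂ (χ : E) (H ξ)).re = 0 := by
  have h1 : P A ((χ + ξ : H.domain) : E) = χ := by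
    rw [Submodule.coe_add, map_add, hχ, hξ, add_zero]
  have h2 : P Aᶜ ((χ + ξ : H.domain) : E) = ξ := by
    rw [hP.isPVM.map_compl hA, sub_apply, h1, one_apply_eq_self]
    simp
  have h3 := integral_add_compl hA (hP.integrable (χ + ξ))
  rw [← hP.isPVM.measure_map_apply hA, ← hP.isPVM.measure_map_apply hA.compl, h1, h2] at h3
  have h4 := congrArg (fun x : ℝ => (x : ℂ)) h3
  simp only [Complex.ofReal_add] at h4
  rw [← hP.inner_apply χ, ← hP.inner_apply ξ, ← hP.inner_apply (χ + ξ), H.map_add,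
    Submodule.coe_add, inner_add_left, inner_add_right, inner_add_right, ← hH.symm ξ χ,
    ← inner_conj_symm (H ξ) (χ : E)] at h4
  have h5 := congrArg Complex.re h4
  simp only [Complex.add_re, Complex.conj_re] at h5
  linarith

lemma inner_compl (hP : IsSpectralResolution H P) (hH : IsSelfAdjointOp H) {A : Set ℝ}
    (hA : MeasurableSet A) (χ ξ : H.domain) (hχ : P A χ = χ) (hξ : P A ξ = 0) :
    inner ℂ (χ : E) (H ξ) = 0 := by
  have h1 := hP.re_inner_compl_self hH hA χ ξ hχ hξ
  have h2 := hP.re_inner_compl_self hH hA χ (Complex.I • ξ) hχ (by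
    rw [Submodule.coe_smul, map_smul, hξ, smul_zero])
  rw [H.map_smul, inner_smul_right] at h2
  refine Complex.ext h1 ?_
  simpa using h2

/-- Pairing P A (H ξ) with vectors of the domain gives 0 by `inner_compl`. The range of the
resolvent is the domain, so the conjugate resolvent annihilates P A (H ξ), and it is injective. -/
lemma apply_compl (hP : IsSpectralResolution H P) (hH : IsSelfAdjointOp H) {A : Set ℝ}
    (hA : MeasurableSet A) (ξ : H.domain) (hξ : P A ξ = 0) : P A (H ξ) = 0 := by
  refine hH.resolvent_injective (z := -Complex.I) (by simp) _ (ext_inner_left ℂ fun φ => ?_)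
  have h := hH.inner_resolvent (z := Complex.I) (by simp) φ (P A (H ξ))
  rw [Complex.conj_I] at h
  rw [← h, inner_zero_right, hP.isPVM.inner_apply hA]
  obtain ⟨χ, h1, -⟩ := (hH.isResolvent (z := Complex.I) (by simp)).exists_domain φ
  rw [h1]
  exact hP.inner_compl hH hA ⟨P A χ, hP.apply_mem_domain hA χ⟩ ξ (hP.isPVM.apply_apply hA _) hξ

/-- The spectral projections commute with the operator. -/
lemma apply_comm (hP : IsSpectralResolution H P) (hH : IsSelfAdjointOp H) {A : Set ℝ}
    (hA : MeasurableSet A) (χ : H.domain) :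
    H ⟨P A χ, hP.apply_mem_domain hA χ⟩ = P A (H χ) := by
  set χ₁ : H.domain := ⟨P A χ, hP.apply_mem_domain hA χ⟩ with hχ₁
  set χ₂ : H.domain := ⟨P Aᶜ χ, hP.apply_mem_domain hA.compl χ⟩ with hχ₂
  have h0 : χ = χ₁ + χ₂ := by
    ext
    rw [Submodule.coe_add, hχ₁, hχ₂]
    simp [hP.isPVM.map_compl hA]
  have h1 : P A (H χ₂) = 0 := hP.apply_compl hH hA _ (by
    rw [hχ₂, hP.isPVM.apply_inter hA hA.compl, Set.inter_compl_self, hP.isPVM.map_empty]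
    rfl)
  have h2 : P Aᶜ (H χ₁) = 0 := hP.apply_compl hH hA.compl _ (by
    rw [hχ₁, hP.isPVM.apply_inter hA.compl hA, Set.compl_inter_self, hP.isPVM.map_empty]
    rfl)
  rw [hP.isPVM.map_compl hA, sub_apply, one_apply_eq_self, sub_eq_zero] at h2
  conv_rhs => rw [h0]
  rw [H.map_add, map_add, h1, add_zero, ← h2]

lemma commute_resolvent (hP : IsSpectralResolution H P) (hH : IsSelfAdjointOp H) {A : Set ℝ}
    (hA : MeasurableSet A) {z : ℂ} (hz : z.im ≠ 0) : Commute (resolventOp H z) (P A) := by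
  ext ψ
  obtain ⟨χ, h1, h2⟩ := (hH.isResolvent hz).exists_domain ψ
  rw [mul_apply_eq_comp, mul_apply_eq_comp, h1, ← h2, map_sub, map_smul, ← hP.apply_comm hH hA]
  exact (hH.isResolvent hz).apply_eq ⟨P A χ, hP.apply_mem_domain hA χ⟩

/-- Two commuting spectral resolutions cannot disagree on half lines. -/
lemma apply_Iic_apply_Ioi (hP : IsSpectralResolution H P) (hQ : IsSpectralResolution H Q)
    (hc : ∀ A B, MeasurableSet A → MeasurableSet B → Commute (P A) (Q B)) (b : ℝ) :
    P (Set.Iic b) * Q (Set.Ioi b) = 0 := by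
  -- Bounding the energy from below first places the vector χ in the domain, so that its mean energy
  -- is finite.
  have key : ∀ a, P (Set.Ioc a b) * Q (Set.Ioi b) = 0 := by
    intro a
    ext ψ
    set χ := (P (Set.Ioc a b) * Q (Set.Ioi b)) ψ with hχ
    have h1 : P (Set.Ioc a b) χ = χ := by
      rw [hχ, mul_apply_eq_comp, hP.isPVM.apply_apply measurableSet_Ioc]
    have h2 : Q (Set.Ioi b) χ = χ := by
      rw [hχ, (hc _ _ measurableSet_Ioc measurableSet_Ioi).eq, mul_apply_eq_comp,
        hQ.isPVM.apply_apply measurableSet_Ioi]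
    have m1 := hP.isPVM.measure_map_apply (measurableSet_Ioc (a := a) (b := b)) χ
    have m2 := hQ.isPVM.measure_map_apply (measurableSet_Ioi (a := b)) χ
    rw [h1] at m1
    rw [h2] at m2
    have hd : χ ∈ H.domain := by
      rw [hP.mem_domain_iff, m1]
      refine lt_of_le_of_lt (setLIntegral_mono' (g := fun _ => ENNReal.ofReal ((|a| + |b|) ^ 2))
        measurableSet_Ioc fun t ht => ?_) ?_
      · rw [← ofReal_norm, ← ENNReal.ofReal_pow (norm_nonneg _)]
        refine ENNReal.ofReal_le_ofReal (pow_le_pow_left₀ (norm_nonneg _) ?_ 2)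
        rw [Real.norm_eq_abs, abs_le]
        constructor
        · linarith [neg_abs_le a, ht.1, abs_nonneg b]
        · linarith [le_abs_self b, ht.2, abs_nonneg a]
      · rw [lintegral_const]
        exact ENNReal.mul_lt_top ENNReal.ofReal_lt_top (measure_lt_top _ _)
    -- The mean energy ⟨χ, H χ⟩ can be computed from either resolution: from P it is at most b times
    -- the mass, from Q it exceeds that unless χ = 0.
    have e : ∫ t, t ∂(hP.isPVM.measure χ) = ∫ t, t ∂(hQ.isPVM.measure χ) :=
      Complex.ofReal_injective ((hP.inner_apply ⟨χ, hd⟩).symm.trans (hQ.inner_apply ⟨χ, hd⟩))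
    have hp := hP.integrable ⟨χ, hd⟩
    have hq := hQ.integrable ⟨χ, hd⟩
    have u : (hP.isPVM.measure χ).real Set.univ = (hQ.isPVM.measure χ).real Set.univ := by
      rw [Measure.real, hP.isPVM.measure_univ, Measure.real, hQ.isPVM.measure_univ]
    have i1 : ∫ t, (t - b) ∂(hP.isPVM.measure χ) ≤ 0 := by
      rw [m1]
      exact setIntegral_nonpos measurableSet_Ioc fun t ht => by linarith [ht.2]
    have i2 : ∫ t, (t - b) ∂(hQ.isPVM.measure χ) ≤ 0 := by
      rw [integral_sub hq (integrable_const _), ← e, integral_const, ← u, ← integral_const,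
        ← integral_sub hp (integrable_const _)]
      exact i1
    have i3 : ∀ᵐ t ∂(hQ.isPVM.measure χ), b < t := by
      rw [m2]
      exact ae_restrict_mem measurableSet_Ioi
    have i4 : 0 ≤ᵐ[hQ.isPVM.measure χ] fun t => t - b := i3.mono fun t ht => by
      simpa using ht.le
    have i5 := (integral_eq_zero_iff_of_nonneg_ae i4 (hq.sub (integrable_const _))).1
      (le_antisymm i2 (integral_nonneg_of_ae i4))
    have i6 : ∀ᵐ t ∂(hQ.isPVM.measure χ), False := by
      filter_upwards [i3, i5] with t h3 h5
      have h5 : t - b = 0 := h5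
      linarith
    have i7 : hQ.isPVM.measure χ Set.univ = 0 := by
      rw [ae_iff] at i6
      simpa using i6
    rw [hQ.isPVM.measure_univ] at i7
    simpa using i7
  ext ψ
  have h0 : hP.isPVM.measure (Q (Set.Ioi b) ψ) (Set.Iic b) = 0 := by
    have : Set.Iic b = ⋃ n : ℕ, Set.Ioc (-(n : ℝ)) b := by
      ext t
      simp only [Set.mem_Iic, Set.mem_iUnion, Set.mem_Ioc]
      constructor
      · intro h
        obtain ⟨n, hn⟩ := exists_nat_gt (-t)
        exact ⟨n, by linarith, h⟩
      · rintro ⟨n, -, h⟩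
        exact h
    rw [this, measure_iUnion_null_iff]
    intro n
    rw [hP.isPVM.measure_apply measurableSet_Ioc]
    have := DFunLike.congr_fun (key (-(n : ℝ))) ψ
    rw [mul_apply_eq_comp] at this
    rw [this]
    simp
  rw [hP.isPVM.measure_apply measurableSet_Iic] at h0
  simpa using h0

lemma measure_eq_of_commute (hP : IsSpectralResolution H P) (hQ : IsSpectralResolution H Q)
    (hc : ∀ A B, MeasurableSet A → MeasurableSet B → Commute (P A) (Q B)) (ψ : E) :
    hP.isPVM.measure ψ = hQ.isPVM.measure ψ := by
  refine Measure.ext_of_Iic _ _ fun b => ?_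
  have h1 := hP.apply_Iic_apply_Ioi hQ hc b
  have h2 := hQ.apply_Iic_apply_Ioi hP (fun A B hA hB => (hc B A hB hA).symm) b
  rw [← Set.compl_Iic, hQ.isPVM.map_compl measurableSet_Iic, mul_sub, mul_one, sub_eq_zero] at h1
  rw [← Set.compl_Iic, hP.isPVM.map_compl measurableSet_Iic, mul_sub, mul_one, sub_eq_zero] at h2
  have h3 : P (Set.Iic b) = Q (Set.Iic b) := by
    rw [h2, ← (hc _ _ measurableSet_Iic measurableSet_Iic).eq, ← h1]
  rw [hP.isPVM.measure_apply measurableSet_Iic, hQ.isPVM.measure_apply measurableSet_Iic, h3]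

variable [CompleteSpace E]

/-- The reflection W = 1 − 2 P A is unitary and commutes with the resolvent and its adjoint, hence
with the functional calculus. Conjugation by W therefore preserves all scalar spectral measures, and
with them the projections. -/
lemma commute_projection (hP : IsSpectralResolution H P) (hH : IsSelfAdjointOp H) {A B : Set ℝ}
    (hA : MeasurableSet A) (hB : MeasurableSet B) : Commute (P A) (hH.projection B) := by
  set W : E →L[ℂ] E := 1 - (2 : ℂ) • P A with hW
  have hsq : W * W = 1 := by
    have : W * W = 1 - (4 : ℂ) • P A + (4 : ℂ) • (P A * P A) := by
      rw [hW, sub_mul, mul_sub, mul_sub, smul_mul_smul_comm]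
      simp only [one_mul, mul_one]
      module
    rw [this, hP.isPVM.idempotent A hA]
    abel
  have hsymm : ∀ φ ψ, inner ℂ (W φ) ψ = inner ℂ φ (W ψ) := fun φ ψ => by
    rw [hW, sub_apply, sub_apply, smul_apply, smul_apply, one_apply_eq_self, one_apply_eq_self,
      inner_sub_left, inner_sub_right, inner_smul_left, inner_smul_right,
      hP.isPVM.inner_apply hA, Complex.conj_ofNat]
  have hunit : ∀ φ ψ, inner ℂ (W φ) (W ψ) = inner ℂ φ ψ := fun φ ψ => by
    rw [hsymm, ← mul_apply_eq_comp, hsq, one_apply_eq_self]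
  have hcomm : ∀ f, Commute (hH.calculus f) W := by
    have h1 : ∀ {z : ℂ}, z.im ≠ 0 → Commute (resolventOp H z) W := fun hz =>
      (Commute.one_right _).sub_right ((hP.commute_resolvent hH hA hz).smul_right _)
    refine Commute.cfcHom hH.isStarNormal (h1 (by simp)) ?_
    rw [hH.star_resolvent_I]
    exact h1 (by simp)
  have h2 : W * hH.projection B * W = hH.projection B := by
    refine ext_of_inner_self fun ψ => ?_
    rw [mul_apply_eq_comp, mul_apply_eq_comp, ← hsymm, hH.isPVM_projection.inner_apply_self hB,
      hH.isPVM_projection.inner_apply_self hB, ← hH.isPVM_projection.measureReal_apply hB,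
      ← hH.isPVM_projection.measureReal_apply hB, hH.measure_projection, hH.measure_projection,
      repMeasure_unitary hH.calculus hunit hcomm]
  have h3 : W * hH.projection B = hH.projection B * W := by
    conv_rhs => rw [← h2]
    rw [mul_assoc, hsq, mul_one]
  have h4 : P A = (2 : ℂ)⁻¹ • (1 - W) := by
    rw [hW]; simp
  rw [h4]
  have h5 : Commute W (hH.projection B) := h3
  exact ((Commute.one_left _).sub_left h5).smul_left _

/-- Uniqueness of the spectral measures. -/
lemma measure_eq (hP : IsSpectralResolution H P) (hH : IsSelfAdjointOp H) (ψ : E) :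
    hP.isPVM.measure ψ = hH.isPVM_projection.measure ψ :=
  hP.measure_eq_of_commute hH.isSpectralResolution_projection
    (fun _ _ hA hB => hP.commute_projection hH hA hB) ψ

end IsSpectralResolution

namespace IsSelfAdjointOp

variable [CompleteSpace E] (hH : IsSelfAdjointOp H)
include hH

lemma isSpectralResolution_spectralProjection :
    IsSpectralResolution H (spectralProjection H) := by
  have h : ∃ P, IsSpectralResolution H P := ⟨_, hH.isSpectralResolution_projection⟩
  have : spectralProjection H = h.choose := by
    ext1 B
    rw [spectralProjection, dif_pos h]
  rw [this]
  exact h.choose_spec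

lemma isPVM_spectralProjection : IsPVM (spectralProjection H) :=
  hH.isSpectralResolution_spectralProjection.isPVM

lemma integral_inv_sub {z : ℂ} (hz : z.im ≠ 0) (ψ : E) :
    ∫ t : ℝ, ((t : ℂ) - z)⁻¹ ∂(hH.isPVM_spectralProjection.measure ψ)
      = inner ℂ ψ (resolventOp H z ψ) := by
  rw [← hH.integral_inv_sub_projection hz,
    ← hH.isSpectralResolution_spectralProjection.measure_eq hH]

/-- `‖(H - z)⁻¹ ψ‖² = ∫ |t - z|⁻² dν_ψ(t)`. -/
lemma norm_resolvent_sq {E₀ η : ℝ} (hη : 0 < η) (ψ : E) :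
    η / Real.pi * ‖resolventOp H ((E₀ : ℂ) + η * Complex.I) ψ‖ ^ 2
      = ∫ t : ℝ, approxDelta η (t - E₀) ∂(hH.isPVM_spectralProjection.measure ψ) := by
  set z : ℂ := (E₀ : ℂ) + η * Complex.I with hz
  have hzim : z.im = η := by simp [hz]
  have hz0 : z.im ≠ 0 := by rw [hzim]; exact hη.ne'
  have h1 := hH.im_inner_resolvent hz0 ψ
  have hne : ∀ t : ℝ, (t : ℂ) - z ≠ 0 := fun t h => by
    have := congrArg Complex.im h
    simp [hzim] at this
    exact hη.ne' this
  have hint : Integrable (fun t : ℝ => ((t : ℂ) - z)⁻¹)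
      (hH.isPVM_spectralProjection.measure ψ) := by
    refine Integrable.of_bound (C := η⁻¹) (by fun_prop) (Eventually.of_forall fun t => ?_)
    rw [norm_inv]
    refine inv_anti₀ hη ?_
    have := Complex.abs_im_le_norm ((t : ℂ) - z)
    simpa [hzim, abs_of_pos hη] using this
  have h2 : (∫ t : ℝ, ((t : ℂ) - z)⁻¹ ∂(hH.isPVM_spectralProjection.measure ψ)).im
      = ∫ t : ℝ, (((t : ℂ) - z)⁻¹).im ∂(hH.isPVM_spectralProjection.measure ψ) :=
    (integral_im hint).symm
  rw [← hH.integral_inv_sub hz0, h2, hzim] at h1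
  rw [div_mul_eq_mul_div, ← h1, div_eq_inv_mul, ← integral_const_mul]
  refine integral_congr_ae (Eventually.of_forall fun t => ?_)
  have h3 : Complex.normSq ((t : ℂ) - z) = (t - E₀) ^ 2 + η ^ 2 := by
    simp [Complex.normSq_apply, hz]; ring
  simp only [approxDelta]
  rw [Complex.inv_im, h3]
  simp [hzim]
  ring

end IsSelfAdjointOp

end Uniqueness

/-! ### Shifts and convolutions on the lattice -/

section Lattice

variable {d : ℕ}

@[simp] lemma shift_apply (a : Lattice d) (ψ : HilbertSpace d) (x : Lattice d) :
    shift a ψ x = ψ (x - a) := rfl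

lemma site_apply (x y : Lattice d) : (site x : HilbertSpace d) y = if y = x then 1 else 0 := by
  rw [site, lp.single_apply, Pi.single_apply]

lemma inner_site (x : Lattice d) (ψ : HilbertSpace d) : inner ℂ (site x) ψ = ψ x := by
  rw [site, lp.inner_single_left]; simp

lemma norm_site (x : Lattice d) : ‖(site x : HilbertSpace d)‖ = 1 := by
  have h : inner ℂ (site x : HilbertSpace d) (site x) = 1 := by
    rw [inner_site, site_apply, if_pos rfl]
  rw [inner_self_eq_norm_sq_to_K] at h
  have h2 : ‖(site x : HilbertSpace d)‖ ^ 2 = 1 := by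
    apply Complex.ofReal_injective
    push_cast
    exact h
  exact (pow_eq_one_iff_of_nonneg (norm_nonneg _) two_ne_zero).1 h2

@[simp] lemma shift_site (a x : Lattice d) : shift a (site x) = site (x + a) := by
  ext y
  simp only [shift_apply, site_apply, sub_eq_iff_eq_add]

lemma norm_shift_le (a : Lattice d) : ‖shift a‖ ≤ 1 :=
  LinearMap.mkContinuous_norm_le _ zero_le_one _

lemma shift_shift (a b : Lattice d) (ψ : HilbertSpace d) :
    shift a (shift b ψ) = shift (a + b) ψ := by
  ext x
  simp [sub_sub]

@[simp] lemma shift_zero (ψ : HilbertSpace d) : shift 0 ψ = ψ := by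
  ext x; simp

lemma inner_shift (a : Lattice d) (φ ψ : HilbertSpace d) :
    inner ℂ (shift a φ) ψ = inner ℂ φ (shift (-a) ψ) := by
  rw [lp.inner_eq_tsum, lp.inner_eq_tsum, ← (Equiv.addRight a).tsum_eq]
  simp

lemma inner_shift_shift (a : Lattice d) (φ ψ : HilbertSpace d) :
    inner ℂ (shift a φ) (shift a ψ) = inner ℂ φ ψ := by
  rw [inner_shift, shift_shift]; simp

variable {w : Lattice d → ℂ}

lemma summable_smul_shift (hw : Summable w) : Summable fun a => w a • shift a := by
  refine Summable.of_norm_bounded hw.norm fun a => ?_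
  rw [norm_smul]
  exact mul_le_of_le_one_right (norm_nonneg _) (norm_shift_le a)

lemma hasSum_convolution_apply (hw : Summable w) (ψ : HilbertSpace d) :
    HasSum (fun a => w a • shift a ψ) (convolution w ψ) := by
  have := (summable_smul_shift hw).hasSum.mapL (ContinuousLinearMap.apply ℂ (HilbertSpace d) ψ)
  exact this

lemma hasSum_convolution_apply_apply (hw : Summable w) (ψ : HilbertSpace d) (x : Lattice d) :
    HasSum (fun a => w a * ψ (x - a)) (convolution w ψ x) := by
  have := (hasSum_convolution_apply hw ψ).mapL (innerSL ℂ (site x))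
  simpa [inner_site, inner_smul_right] using this

lemma convolution_shift (hw : Summable w) (a : Lattice d) (ψ : HilbertSpace d) :
    convolution w (shift a ψ) = shift a (convolution w ψ) := by
  have h1 := (hasSum_convolution_apply hw ψ).mapL (shift a)
  refine (hasSum_convolution_apply hw (shift a ψ)).unique (h1.congr_fun fun b => ?_)
  rw [map_smul, shift_shift, shift_shift, add_comm]

lemma inner_convolution (hw : Summable w) (φ ψ : HilbertSpace d) :
    inner ℂ φ (convolution w ψ)
      = inner ℂ (convolution (fun a => (starRingEnd ℂ) (w (-a))) φ) ψ := by
  have hw' : Summable fun a => (starRingEnd ℂ) (w (-a)) :=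
    Complex.summable_conj.2 ((Equiv.neg _).summable_iff.2 hw)
  have h1 := (hasSum_convolution_apply hw ψ).mapL (innerSL ℂ φ)
  have h2 := (hasSum_convolution_apply hw' φ).mapL (innerSL ℂ ψ)
  have h3 := Complex.hasSum_conj'.2 h2
  simp only [innerSL_apply_apply, inner_conj_symm, inner_smul_right] at h1 h3
  rw [← (Equiv.neg _).hasSum_iff] at h3
  refine h1.unique (h3.congr_fun fun a => ?_)
  simp only [Function.comp_apply, Equiv.neg_apply, neg_neg, map_mul, Complex.conj_conj,
    inner_conj_symm]
  rw [inner_shift, neg_neg]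

end Lattice

/-! ### Self-adjointness and continuity of the Hamiltonian -/

section Hamiltonian

variable {d : ℕ} {K : HilbertSpace d →L[ℂ] HilbertSpace d} {U : Lattice d → ℝ}

lemma mem_domain_vadd {ψ : HilbertSpace d} :
    ψ ∈ (K.toLinearMap +ᵥ multiplication U).domain ↔ Memℓp (fun x => (U x : ℂ) * ψ x) 2 :=
  Iff.rfl

lemma vadd_multiplication_apply (χ : (K.toLinearMap +ᵥ multiplication U).domain) (x : Lattice d) :
    (K.toLinearMap +ᵥ multiplication U) χ x = K χ x + U x * (χ : HilbertSpace d) x := by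
  rw [LinearPMap.vadd_apply]
  rfl

/-- An element of the domain is recognized by the action of the operator. -/
lemma exists_domain_of_forall {χ ψ : HilbertSpace d}
    (h : ∀ x, ψ x = K χ x + U x * χ x) :
    ∃ hχ : χ ∈ (K.toLinearMap +ᵥ multiplication U).domain,
      (K.toLinearMap +ᵥ multiplication U) ⟨χ, hχ⟩ = ψ := by
  have h1 : (fun x => (U x : ℂ) * χ x) = ⇑(ψ - K χ) := by
    ext x
    rw [lp.coeFn_sub, Pi.sub_apply, h]
    ring
  have h2 : χ ∈ (K.toLinearMap +ᵥ multiplication U).domain := by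
    rw [mem_domain_vadd, h1]
    exact lp.memℓp _
  refine ⟨h2, ?_⟩
  ext x
  rw [vadd_multiplication_apply, h]

lemma exists_domain_site (x : Lattice d) :
    ∃ h : site x ∈ (K.toLinearMap +ᵥ multiplication U).domain,
      (K.toLinearMap +ᵥ multiplication U) ⟨site x, h⟩ = K (site x) + (U x : ℂ) • site x := by
  refine exists_domain_of_forall fun y => ?_
  rw [lp.coeFn_add, Pi.add_apply, lp.coeFn_smul, Pi.smul_apply, smul_eq_mul, site_apply]
  split_ifs with h
  · rw [h]
  · simp

lemma vadd_multiplication_symm (hK : ∀ φ ψ, inner ℂ (K φ) ψ = inner ℂ φ (K ψ))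
    (φ ψ : (K.toLinearMap +ᵥ multiplication U).domain) :
    inner ℂ ((K.toLinearMap +ᵥ multiplication U) φ) (ψ : HilbertSpace d)
      = inner ℂ (φ : HilbertSpace d) ((K.toLinearMap +ᵥ multiplication U) ψ) := by
  rw [LinearPMap.vadd_apply, LinearPMap.vadd_apply, inner_add_left, inner_add_right]
  congr 1
  · exact hK _ _
  · rw [lp.inner_eq_tsum, lp.inner_eq_tsum]
    refine tsum_congr fun x => ?_
    change inner ℂ ((U x : ℂ) * (φ : HilbertSpace d) x) ((ψ : HilbertSpace d) x)
      = inner ℂ ((φ : HilbertSpace d) x) ((U x : ℂ) * (ψ : HilbertSpace d) x)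
    simp
    ring

/-- The vectors `(H - z) δ_x` span a dense subspace. -/
lemma span_orthogonal_eq_bot (hK : ∀ φ ψ, inner ℂ (K φ) ψ = inner ℂ φ (K ψ)) {z : ℂ}
    (hz : z.im ≠ 0) :
    (Submodule.span ℂ (Set.range fun x => K (site x) + (U x : ℂ) • site x - z • site x))ᗮ = ⊥ := by
  rw [Submodule.eq_bot_iff]
  intro φ hφ
  -- Orthogonality says that φ solves the eigenvalue equation for conj z pointwise. Then φ is in the
  -- maximal domain, and a symmetric operator has no nonreal eigenvalue.
  have h1 : ∀ x, ((starRingEnd ℂ) z • φ) x = K φ x + U x * φ x := by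
    intro x
    have := (Submodule.mem_orthogonal _ _).1 hφ _ (Submodule.subset_span ⟨x, rfl⟩)
    rw [inner_sub_left, inner_add_left, hK, inner_smul_left, inner_smul_left, inner_site,
      inner_site, Complex.conj_ofReal, sub_eq_zero] at this
    rw [this]
    rfl
  obtain ⟨hd, h2⟩ := exists_domain_of_forall h1
  have h3 := inner_conj_symm (𝕜 := ℂ) φ ((K.toLinearMap +ᵥ multiplication U) ⟨φ, hd⟩)
  have h4 := vadd_multiplication_symm hK ⟨φ, hd⟩ ⟨φ, hd⟩
  dsimp only at h4
  rw [h4, Complex.conj_eq_iff_im, h2, inner_smul_right, inner_self_eq_norm_sq_to_K] at h3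
  have h5 : ((starRingEnd ℂ) z * ((‖φ‖ : ℂ)) ^ 2).im = -(z.im * ‖φ‖ ^ 2) := by
    rw [← Complex.ofReal_pow, Complex.im_mul_ofReal, Complex.conj_im, neg_mul]
  have h6 := h5.symm.trans h3
  simpa [hz] using h6

/-- The bound |Im z| ‖χ‖ ≤ ‖(H − z)χ‖ makes H − z injective, its range closed and its inverse
bounded. The range is dense since it contains all (H − z)δ_x. -/
lemma isSelfAdjointOp_vadd (hK : ∀ φ ψ, inner ℂ (K φ) ψ = inner ℂ φ (K ψ)) :
    IsSelfAdjointOp (K.toLinearMap +ᵥ multiplication U) where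
  symm := vadd_multiplication_symm hK
  exists_resolvent := by
    intro z hz
    set H := K.toLinearMap +ᵥ multiplication U with hH
    let T : H.domain →ₗ[ℂ] HilbertSpace d := H.toFun - z • H.domain.subtype
    have hT : ∀ χ, T χ = H χ - z • (χ : HilbertSpace d) := fun χ => rfl
    have hlow : ∀ χ : H.domain, |z.im| * ‖(χ : HilbertSpace d)‖ ≤ ‖T χ‖ := by
      intro χ
      have h0 : (inner ℂ (χ : HilbertSpace d) (H χ)).im = 0 := by
        have h := inner_conj_symm (𝕜 := ℂ) (χ : HilbertSpace d) (H χ)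
        rw [vadd_multiplication_symm hK] at h
        exact Complex.conj_eq_iff_im.1 h
      have h1 : (inner ℂ (χ : HilbertSpace d) (T χ)).im = -(z.im * ‖(χ : HilbertSpace d)‖ ^ 2) := by
        rw [hT, inner_sub_right, inner_smul_right, inner_self_eq_norm_sq_to_K, Complex.sub_im, h0]
        have : (z * ((‖(χ : HilbertSpace d)‖ : ℂ)) ^ 2).im = z.im * ‖(χ : HilbertSpace d)‖ ^ 2 := by
          rw [← Complex.ofReal_pow, Complex.im_mul_ofReal]
        exact (congrArg (0 - ·) this).trans (by ring)
      have h2 := (Complex.abs_im_le_norm _).trans (norm_inner_le_norm (𝕜 := ℂ)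
        (χ : HilbertSpace d) (T χ))
      rw [h1, abs_neg, abs_mul, abs_of_nonneg (sq_nonneg ‖(χ : HilbertSpace d)‖)] at h2
      rcases (norm_nonneg (χ : HilbertSpace d)).eq_or_lt with h3 | h3
      · rw [← h3]; simp
      · nlinarith
    have hinj : Function.Injective T := by
      rw [← LinearMap.ker_eq_bot, LinearMap.ker_eq_bot']
      intro χ hχ
      have := hlow χ
      rw [hχ, norm_zero] at this
      have h3 : ‖(χ : HilbertSpace d)‖ ≤ 0 := by
        by_contra h
        exact absurd this (not_le.2 (mul_pos (abs_pos.2 hz) (not_le.1 h)))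
      exact Subtype.ext (by simpa using h3)
    have hclosed : IsClosed (LinearMap.range T : Set (HilbertSpace d)) := by
      refine IsSeqClosed.isClosed fun ψ ψ₀ hψ hlim => ?_
      choose χ hχ using hψ
      have hc : CauchySeq fun n => (χ n : HilbertSpace d) := by
        rw [Metric.cauchySeq_iff']
        intro ε hε
        obtain ⟨N, hN⟩ := Metric.cauchySeq_iff'.1 hlim.cauchySeq (|z.im| * ε)
          (mul_pos (abs_pos.2 hz) hε)
        refine ⟨N, fun n hn => ?_⟩
        have h1 := hN n hn
        rw [dist_eq_norm, ← hχ, ← hχ, ← map_sub] at h1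
        rw [dist_eq_norm, ← Submodule.coe_sub]
        exact lt_of_mul_lt_mul_left ((hlow _).trans_lt h1) (abs_nonneg _)
      obtain ⟨χ₀, hχ₀⟩ := cauchySeq_tendsto_of_complete hc
      have hev : ∀ x, Continuous fun φ : HilbertSpace d => φ x := fun x => by
        simp_rw [← inner_site]; fun_prop
      -- Closedness is checked site by site: point evaluations are continuous and the domain is the
      -- maximal one.
      have h2 : ∀ x, (ψ₀ + z • χ₀) x = K χ₀ x + U x * χ₀ x := by
        intro x
        have l1 : Tendsto (fun n => (ψ n + z • (χ n : HilbertSpace d)) x) atTop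
            (𝓝 ((ψ₀ + z • χ₀) x)) :=
          ((hev x).tendsto _).comp (hlim.add (hχ₀.const_smul z))
        have l2 : Tendsto (fun n => K (χ n) x + U x * (χ n : HilbertSpace d) x) atTop
            (𝓝 (K χ₀ x + U x * χ₀ x)) :=
          (((hev x).tendsto _).comp ((K.continuous.tendsto _).comp hχ₀)).add
            ((((hev x).tendsto _).comp hχ₀).const_mul _)
        refine tendsto_nhds_unique l1 (l2.congr fun n => ?_)
        rw [← vadd_multiplication_apply, ← hχ, hT, sub_add_cancel]
      obtain ⟨hd, h3⟩ := exists_domain_of_forall h2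
      refine ⟨⟨χ₀, hd⟩, ?_⟩
      rw [hT]
      exact sub_eq_iff_eq_add.2 h3
    have htop : LinearMap.range T = ⊤ := by
      have h1 : Submodule.span ℂ (Set.range fun x =>
          K (site x) + (U x : ℂ) • site x - z • site x) ≤ LinearMap.range T := by
        rw [Submodule.span_le]
        rintro _ ⟨x, rfl⟩
        obtain ⟨hd, h2⟩ := exists_domain_site (K := K) (U := U) x
        refine ⟨⟨site x, hd⟩, ?_⟩
        rw [hT]
        exact congrArg (· - z • site x) h2
      rw [← hclosed.submodule_topologicalClosure_eq, Submodule.topologicalClosure_eq_top_iff]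
      exact le_bot_iff.1 ((Submodule.orthogonal_le h1).trans (span_orthogonal_eq_bot hK hz).le)
    let e := LinearEquiv.ofBijective T ⟨hinj, LinearMap.range_eq_top.1 htop⟩
    have he : ∀ ψ, T (e.symm ψ) = ψ := fun ψ => e.apply_symm_apply ψ
    refine ⟨LinearMap.mkContinuous (H.domain.subtype ∘ₗ e.symm.toLinearMap) |z.im|⁻¹ fun ψ => ?_,
      fun ψ => ⟨(e.symm ψ).2, he ψ⟩, fun φ => ?_⟩
    · rw [le_inv_mul_iff₀ (abs_pos.2 hz)]
      exact (hlow _).trans_eq (congrArg norm (he ψ))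
    · exact congrArg Subtype.val (e.symm_apply_apply φ)

/-- Strong resolvent continuity in the potential and the energy. -/
lemma continuousAt_resolvent (hK : ∀ φ ψ, inner ℂ (K φ) ψ = inner ℂ φ (K ψ)) {z : ℂ}
    (hz : z.im ≠ 0) (ψ : HilbertSpace d) :
    ContinuousAt (fun p : (Lattice d → ℝ) × ℂ =>
      resolventOp (K.toLinearMap +ᵥ multiplication p.1) p.2 ψ) (U, z) := by
  set R : (Lattice d → ℝ) × ℂ → HilbertSpace d →L[ℂ] HilbertSpace d := fun p =>
    resolventOp (K.toLinearMap +ᵥ multiplication p.1) p.2 with hR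
  have hev : ∀ᶠ p : (Lattice d → ℝ) × ℂ in 𝓝 (U, z), |z.im| / 2 < |p.2.im| := by
    have hc : Continuous fun p : (Lattice d → ℝ) × ℂ => |p.2.im| := by fun_prop
    refine (hc.tendsto (U, z)).eventually (lt_mem_nhds ?_)
    have := abs_pos.2 hz
    dsimp only
    linarith
  have him : ∀ {w : ℂ}, |z.im| / 2 < |w.im| → w.im ≠ 0 := fun h h0 => by
    rw [h0, abs_zero] at h
    linarith [abs_nonneg z.im]
  have hbd : ∀ᶠ p : (Lattice d → ℝ) × ℂ in 𝓝 (U, z), ∀ φ, ‖R p φ‖ ≤ (|z.im| / 2)⁻¹ * ‖φ‖ := by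
    filter_upwards [hev] with p hp φ
    refine ((isSelfAdjointOp_vadd hK).norm_resolvent_le (him hp) φ).trans ?_
    gcongr
  -- The resolvents are locally uniformly bounded, so convergence is only needed on the dense span
  -- of the (H − z)δ_x. There, changing U and z alters the vector by a multiple of δ_x involving the
  -- single value U x, which is why the product topology on potentials suffices.
  have hsite : ∀ x, Tendsto (fun p => R p (K (site x) + (U x : ℂ) • site x - z • site x))
      (𝓝 (U, z)) (𝓝 (R (U, z) (K (site x) + (U x : ℂ) • site x - z • site x))) := by
    intro x
    have e1 : ∀ p : (Lattice d → ℝ) × ℂ, p.2.im ≠ 0 →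
        R p (K (site x) + (p.1 x : ℂ) • site x - p.2 • site x) = site x := by
      intro p hp
      obtain ⟨hd, h1⟩ := exists_domain_site (K := K) (U := p.1) x
      have := ((isSelfAdjointOp_vadd (U := p.1) hK).isResolvent hp).apply_eq ⟨site x, hd⟩
      rw [h1] at this
      exact this
    rw [e1 (U, z) hz, tendsto_iff_norm_sub_tendsto_zero]
    have hc : Tendsto (fun p : (Lattice d → ℝ) × ℂ =>
        (|z.im| / 2)⁻¹ * ‖((U x : ℂ) - p.1 x + (p.2 - z)) • (site x : HilbertSpace d)‖) (𝓝 (U, z))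
        (𝓝 0) := by
      have : Continuous fun p : (Lattice d → ℝ) × ℂ =>
        (|z.im| / 2)⁻¹ * ‖((U x : ℂ) - p.1 x + (p.2 - z)) • (site x : HilbertSpace d)‖ := by
        fun_prop
      simpa using this.tendsto (U, z)
    refine squeeze_zero' (Eventually.of_forall fun _ => norm_nonneg _) ?_ hc
    filter_upwards [hev, hbd] with p hp hp'
    have e2 : R p (((U x : ℂ) - p.1 x + (p.2 - z)) • site x)
        = R p (K (site x) + (U x : ℂ) • site x - z • site x) - site x := by
      conv_rhs => enter [2]; rw [← e1 p (him hp)]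
      rw [← map_sub]
      congr 1
      module
    rw [← e2]
    exact hp' _
  let S : Submodule ℂ (HilbertSpace d) :=
    { carrier := {φ | Tendsto (fun p => R p φ) (𝓝 (U, z)) (𝓝 (R (U, z) φ))}
      zero_mem' := by simp
      add_mem' := fun {φ φ'} h h' => by
        have := Tendsto.add (show Tendsto _ _ _ from h) (show Tendsto _ _ _ from h')
        simpa only [Set.mem_ofPred_eq, map_add] using this
      smul_mem' := fun c φ h => by
        have := Tendsto.const_smul (show Tendsto _ _ _ from h) c
        simpa only [Set.mem_ofPred_eq, map_smul] using this }
  have hle : Submodule.span ℂ (Set.range fun x =>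
      K (site x) + (U x : ℂ) • site x - z • site x) ≤ S := by
    rw [Submodule.span_le]
    rintro _ ⟨x, rfl⟩
    exact hsite x
  have hcl : IsClosed (S : Set (HilbertSpace d)) := by
    refine isClosed_of_closure_subset fun φ hφ => ?_
    change Tendsto (fun p => R p φ) (𝓝 (U, z)) (𝓝 (R (U, z) φ))
    rw [Metric.tendsto_nhds]
    intro ε hε
    set c := (|z.im| / 2)⁻¹ with hc
    have hc0 : 0 < c := by have := abs_pos.2 hz; positivity
    obtain ⟨φ', h1, h2⟩ := Metric.mem_closure_iff.1 hφ (ε / (3 * c)) (by positivity)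
    have h1 : Tendsto (fun p => R p φ') (𝓝 (U, z)) (𝓝 (R (U, z) φ')) := h1
    have h4 : c * ‖φ - φ'‖ < ε / 3 := by
      rw [dist_eq_norm, lt_div_iff₀ (by positivity)] at h2
      linarith
    filter_upwards [hbd, Metric.tendsto_nhds.1 h1 (ε / 3) (by positivity)] with p hp hp'
    have h3 := hbd.self_of_nhds
    calc dist (R p φ) (R (U, z) φ)
        ≤ dist (R p φ) (R p φ') + dist (R p φ') (R (U, z) φ') + dist (R (U, z) φ') (R (U, z) φ) :=
          dist_triangle4 _ _ _ _
      _ < ε / 3 + ε / 3 + ε / 3 := by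
          refine add_lt_add (add_lt_add ?_ hp') ?_
          · rw [dist_eq_norm, ← map_sub]
            exact (hp _).trans_lt h4
          · rw [dist_comm, dist_eq_norm, ← map_sub]
            exact (h3 _).trans_lt h4
      _ = ε := by ring
  have htop : S = ⊤ := by
    rw [← hcl.submodule_topologicalClosure_eq, Submodule.topologicalClosure_eq_top_iff]
    exact le_bot_iff.1 ((Submodule.orthogonal_le hle).trans (span_orthogonal_eq_bot hK hz).le)
  exact (htop ▸ Submodule.mem_top : ψ ∈ S)

/-- Covariance of the resolvent under translations. -/
lemma resolvent_translate (hK : ∀ φ ψ, inner ℂ (K φ) ψ = inner ℂ φ (K ψ))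
    (hKS : ∀ a ψ, K (shift a ψ) = shift a (K ψ)) {z : ℂ} (hz : z.im ≠ 0) (a : Lattice d)
    (ψ : HilbertSpace d) :
    resolventOp (K.toLinearMap +ᵥ multiplication fun x => U (x - a)) z (shift a ψ)
      = shift a (resolventOp (K.toLinearMap +ᵥ multiplication U) z ψ) := by
  obtain ⟨χ, h1, h2⟩ := ((isSelfAdjointOp_vadd (U := U) hK).isResolvent hz).exists_domain ψ
  have h3 : ∀ x, shift a ((K.toLinearMap +ᵥ multiplication U) χ) x
      = K (shift a χ) x + U (x - a) * (shift a (χ : HilbertSpace d)) x := fun x => by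
    rw [shift_apply, vadd_multiplication_apply, hKS, shift_apply, shift_apply]
  obtain ⟨hd, h4⟩ := exists_domain_of_forall (U := fun x => U (x - a)) h3
  have h5 := ((isSelfAdjointOp_vadd (U := fun x => U (x - a)) hK).isResolvent hz).apply_eq
    ⟨shift a χ, hd⟩
  rw [h4] at h5
  dsimp only at h5
  rw [h1, ← h5, ← h2, map_sub, map_smul]

end Hamiltonian

/-! ### The Poisson kernel and Stieltjes inversion -/

section Stieltjes

lemma approxDelta_nonneg {η : ℝ} (hη : 0 ≤ η) (u : ℝ) : 0 ≤ approxDelta η u := by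
  unfold approxDelta; positivity

lemma approxDelta_mul {η : ℝ} (hη : 0 < η) (u : ℝ) :
    approxDelta η (η * u) = η⁻¹ * approxDelta 1 u := by
  unfold approxDelta
  field_simp

lemma approxDelta_le {η : ℝ} (hη : 0 < η) (u : ℝ) : approxDelta η u ≤ (Real.pi * η)⁻¹ := by
  have h : approxDelta η u ≤ η / Real.pi * (η ^ 2)⁻¹ := by
    unfold approxDelta
    gcongr
    nlinarith [sq_nonneg u]
  refine h.trans (le_of_eq ?_)
  field_simp

lemma sq_mul_approxDelta_le {η : ℝ} (hη : 0 < η) (u : ℝ) :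
    u ^ 2 * approxDelta η u ≤ η / Real.pi := by
  unfold approxDelta
  have h1 : 0 < u ^ 2 + η ^ 2 := by positivity
  have h2 : u ^ 2 * (u ^ 2 + η ^ 2)⁻¹ ≤ 1 := by
    rw [← div_eq_mul_inv, div_le_one h1]
    nlinarith
  calc u ^ 2 * (η / Real.pi * (u ^ 2 + η ^ 2)⁻¹) = η / Real.pi * (u ^ 2 * (u ^ 2 + η ^ 2)⁻¹) := by
        ring
    _ ≤ η / Real.pi * 1 := by gcongr
    _ = η / Real.pi := mul_one _

@[fun_prop]
lemma continuous_approxDelta {X : Type*} [TopologicalSpace X] {η : ℝ} (hη : 0 < η) {g : X → ℝ}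
    (hg : Continuous g) : Continuous fun x => approxDelta η (g x) := by
  unfold approxDelta
  exact continuous_const.mul (((hg.pow 2).add continuous_const).inv₀ fun x =>
    (add_pos_of_nonneg_of_pos (sq_nonneg _) (pow_pos hη 2)).ne')

lemma measurable_approxDelta (η : ℝ) : Measurable (approxDelta η) := by
  unfold approxDelta
  fun_prop

lemma approxDelta_one (u : ℝ) : approxDelta 1 u = Real.pi⁻¹ * (1 + u ^ 2)⁻¹ := by
  unfold approxDelta
  rw [add_comm (u ^ 2)]
  simp

lemma integrable_approxDelta_one : Integrable (approxDelta 1) := by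
  have : approxDelta 1 = fun u => Real.pi⁻¹ * (1 + u ^ 2)⁻¹ := funext approxDelta_one
  rw [this]
  exact integrable_inv_one_add_sq.const_mul _

lemma integral_approxDelta_one : ∫ u, approxDelta 1 u = 1 := by
  simp_rw [approxDelta_one]
  rw [integral_const_mul, integral_univ_inv_one_add_sq, inv_mul_cancel₀ Real.pi_ne_zero]

lemma approxDelta_eq {η : ℝ} (hη : 0 < η) :
    approxDelta η = fun u => η⁻¹ * approxDelta 1 (η⁻¹ * u) := by
  ext u
  rw [← approxDelta_mul hη, mul_inv_cancel_left₀ hη.ne']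

lemma integrable_approxDelta {η : ℝ} (hη : 0 < η) : Integrable (approxDelta η) := by
  rw [approxDelta_eq hη]
  exact (integrable_approxDelta_one.comp_mul_left' (inv_ne_zero hη.ne')).const_mul _

lemma integral_approxDelta {η : ℝ} (hη : 0 < η) : ∫ u, approxDelta η u = 1 := by
  rw [approxDelta_eq hη, integral_const_mul, Measure.integral_comp_mul_left,
    integral_approxDelta_one, inv_inv, abs_of_pos hη]
  simp [hη.ne']

lemma integral_mul_approxDelta {η : ℝ} (hη : 0 < η) (f : ℝ → ℝ) (t : ℝ) :
    ∫ E, f E * approxDelta η (t - E) = ∫ u, f (t - η * u) * approxDelta 1 u := by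
  rw [← integral_sub_left_eq_self _ _ t]
  have h := Measure.integral_comp_mul_left
    (fun v => f (t - v) * approxDelta η (t - (t - v))) η
  simp only [sub_sub_cancel, approxDelta_mul hη] at h ⊢
  rw [abs_of_pos (inv_pos.2 hη), smul_eq_mul] at h
  rw [← mul_inv_cancel_left₀ hη.ne' (∫ x, f (t - x) * approxDelta η x), ← h, ← integral_const_mul]
  refine integral_congr_ae (Eventually.of_forall fun u => ?_)
  dsimp only
  field_simp

lemma integrable_approxDelta_prod {η : ℝ} (hη : 0 < η) (μ : Measure ℝ) [IsFiniteMeasure μ] :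
    Integrable (fun p : ℝ × ℝ => approxDelta η (p.2 - p.1)) (volume.prod μ) := by
  have hc : Continuous fun p : ℝ × ℝ => approxDelta η (p.2 - p.1) := by
    fun_prop (disch := assumption)
  rw [integrable_prod_iff' hc.aestronglyMeasurable]
  constructor
  · exact Eventually.of_forall fun t => (integrable_approxDelta hη).comp_sub_left t
  · have : (fun t => ∫ E, ‖approxDelta η (t - E)‖) = fun _ => (1 : ℝ) := by
      ext t
      simp_rw [Real.norm_of_nonneg (approxDelta_nonneg hη.le _)]
      rw [integral_sub_left_eq_self (approxDelta η), integral_approxDelta hη]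
    rw [this]
    exact integrable_const _

/-- The Stieltjes inversion formula. -/
lemma tendsto_integral_approxDelta (μ : Measure ℝ) [IsFiniteMeasure μ]
    (f : BoundedContinuousFunction ℝ ℝ) :
    Tendsto (fun η => ∫ E, f E * ∫ t, approxDelta η (t - E) ∂μ) (𝓝[>] 0) (𝓝 (∫ t, f t ∂μ)) := by
  have h1 : ∀ η : ℝ, 0 < η → ∫ E, f E * ∫ t, approxDelta η (t - E) ∂μ
      = ∫ t, (∫ u, f (t - η * u) * approxDelta 1 u) ∂μ := by
    intro η hη
    have e1 : ∀ t, ∫ u, f (t - η * u) * approxDelta 1 u = ∫ E, f E * approxDelta η (t - E) :=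
      fun t => (integral_mul_approxDelta hη f t).symm
    have e2 : ∀ E, f E * ∫ t, approxDelta η (t - E) ∂μ = ∫ t, f E * approxDelta η (t - E) ∂μ :=
      fun E => (integral_const_mul _ _).symm
    simp_rw [e1, e2]
    exact integral_integral_swap ((integrable_approxDelta_prod hη μ).bdd_mul (c := ‖f‖)
      (by fun_prop) (Eventually.of_forall fun p => f.norm_coe_le_norm _))
  refine Tendsto.congr' (eventually_nhdsWithin_of_forall fun η hη => (h1 η hη).symm) ?_
  have hbd : ∀ (η t u : ℝ), ‖f (t - η * u) * approxDelta 1 u‖ ≤ ‖f‖ * approxDelta 1 u := by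
    intro η t u
    rw [norm_mul, Real.norm_of_nonneg (approxDelta_nonneg zero_le_one u)]
    exact mul_le_mul_of_nonneg_right (f.norm_coe_le_norm _) (approxDelta_nonneg zero_le_one u)
  have hm : ∀ η : ℝ, Continuous fun p : ℝ × ℝ => f (p.1 - η * p.2) * approxDelta 1 p.2 := by
    intro η
    exact (f.continuous.comp (by fun_prop)).mul (continuous_approxDelta one_pos continuous_snd)
  have h2 : ∀ t, Tendsto (fun η => ∫ u, f (t - η * u) * approxDelta 1 u) (𝓝[>] 0) (𝓝 (f t)) := by
    intro t
    have : f t = ∫ u, f (t - 0 * u) * approxDelta 1 u := by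
      simp [integral_const_mul, integral_approxDelta_one]
    rw [this]
    refine tendsto_integral_filter_of_dominated_convergence (fun u => ‖f‖ * approxDelta 1 u)
      (Eventually.of_forall fun η => ((hm η).comp (by fun_prop :
        Continuous fun u => (t, u))).aestronglyMeasurable)
      (Eventually.of_forall fun η => Eventually.of_forall (hbd η t))
      (integrable_approxDelta_one.const_mul _) (Eventually.of_forall fun u => ?_)
    have hc : Continuous fun η : ℝ => f (t - η * u) * approxDelta 1 u :=
      (f.continuous.comp (by fun_prop)).mul continuous_const
    exact (hc.tendsto 0).mono_left nhdsWithin_le_nhds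
  refine tendsto_integral_filter_of_dominated_convergence (fun _ => ‖f‖) ?_ ?_
    (integrable_const _) (Eventually.of_forall h2)
  · refine Eventually.of_forall fun η => ?_
    exact ((hm η).stronglyMeasurable.integral_prod_right' (ν := volume)).aestronglyMeasurable
  · refine Eventually.of_forall fun η => Eventually.of_forall fun t => ?_
    refine (norm_integral_le_of_norm_le (integrable_approxDelta_one.const_mul _)
      (Eventually.of_forall (hbd η t))).trans_eq ?_
    rw [integral_const_mul, integral_approxDelta_one, mul_one]

lemma measure_eq_of_forall_approxDelta {μ ν : Measure ℝ} [IsFiniteMeasure μ] [IsFiniteMeasure ν]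
    (h : ∀ η E : ℝ, 0 < η → ∫ t, approxDelta η (t - E) ∂μ = ∫ t, approxDelta η (t - E) ∂ν) :
    μ = ν := by
  refine ext_of_forall_integral_eq_of_IsFiniteMeasure fun f => ?_
  refine tendsto_nhds_unique (tendsto_integral_approxDelta μ f)
    ((tendsto_integral_approxDelta ν f).congr' ?_)
  refine eventually_nhdsWithin_of_forall fun η hη => integral_congr_ae
    (Eventually.of_forall fun E => ?_)
  dsimp only
  rw [h η E hη]

/-- Stieltjes inversion writes integrals of bounded continuous functions as limits of E-integrals,
which is why measurability is asked jointly in the parameter and E. Closed sets follow by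
approximation, and they form a generating π-system. -/
lemma measurable_measure_of_approxDelta {Ω : Type*} [MeasurableSpace Ω] {μ : Ω → Measure ℝ}
    [∀ V, IsFiniteMeasure (μ V)]
    (h : ∀ η : ℝ, 0 < η → Measurable fun p : Ω × ℝ => ∫ t, approxDelta η (t - p.2) ∂(μ p.1)) :
    Measurable μ := by
  have h1 : ∀ f : BoundedContinuousFunction ℝ ℝ, Measurable fun V => ∫ t, f t ∂(μ V) := by
    intro f
    have hη : ∀ n : ℕ, (0 : ℝ) < 1 / ((n : ℝ) + 1) := fun n => by positivity
    refine measurable_of_tendsto_metrizable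
      (f := fun (n : ℕ) V => ∫ E, f E * ∫ t, approxDelta (1 / ((n : ℝ) + 1)) (t - E) ∂(μ V))
      (fun n => ?_) ?_
    · refine StronglyMeasurable.measurable (StronglyMeasurable.integral_prod_right' (ν := volume)
        (f := fun p : Ω × ℝ => f p.2 * ∫ t, approxDelta (1 / ((n : ℝ) + 1)) (t - p.2) ∂(μ p.1)) ?_)
      exact ((f.continuous.measurable.comp measurable_snd).mul (h _ (hη n))).stronglyMeasurable
    · rw [tendsto_pi_nhds]
      intro V
      exact (tendsto_integral_approxDelta (μ V) f).comp (tendsto_nhdsWithin_iff.2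
        ⟨tendsto_one_div_add_atTop_nhds_zero_nat, Eventually.of_forall hη⟩)
  have h2 : ∀ F : Set ℝ, IsClosed F → Measurable fun V => (μ V).real F := by
    intro F hF
    let g : ℕ → BoundedContinuousFunction ℝ ℝ := fun n =>
      BoundedContinuousFunction.ofNormedAddCommGroup (fun x => (hF.apprSeq n x : ℝ)) (by fun_prop) 1
        fun x => by
          rw [Real.norm_of_nonneg (NNReal.coe_nonneg _)]
          exact_mod_cast HasOuterApproxClosed.apprSeq_apply_le_one hF n x
    refine measurable_of_tendsto_metrizable (fun n => h1 (g n)) ?_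
    rw [tendsto_pi_nhds]
    exact fun V => tendsto_integral_apprSeq (μ V) hF
  have h3 : ∀ F : Set ℝ, IsClosed F → Measurable fun V => μ V F := by
    intro F hF
    have := (h2 F hF).ennreal_ofReal
    simpa using this
  exact Measurable.measure_of_isPiSystem measurableSpace_eq_generateFrom_isClosed
    isPiSystem_isClosed (fun F hF => h3 F hF) (h3 _ isClosed_univ)

end Stieltjes

/-! ### Dependence of resolvents and projections on the environment -/

section Environment

variable {d : ℕ} {k : Lattice d → ℝ}

lemma summable_hopping (hk : Summable fun a : Lattice d => (1 + ‖a‖) * |k a|) :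
    Summable fun a => (k a : ℂ) := by
  refine Summable.of_norm_bounded hk fun a => ?_
  rw [Complex.norm_real, Real.norm_eq_abs]
  nlinarith [norm_nonneg a, abs_nonneg (k a)]

lemma inner_hopping (hk : Summable fun a : Lattice d => (1 + ‖a‖) * |k a|)
    (hsymm : ∀ a, k (-a) = k a) (φ ψ : HilbertSpace d) :
    inner ℂ (convolution (fun a => (k a : ℂ)) φ) ψ
      = inner ℂ φ (convolution (fun a => (k a : ℂ)) ψ) := by
  rw [inner_convolution (summable_hopping hk)]
  simp [hsymm]

variable (hk : Summable fun a : Lattice d => (1 + ‖a‖) * |k a|) (hsymm : ∀ a, k (-a) = k a)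
  (lam : ℝ)
include hk hsymm

lemma isSelfAdjointOp_hamiltonian (V : Environment d) : IsSelfAdjointOp (hamiltonian k lam V) :=
  isSelfAdjointOp_vadd (inner_hopping hk hsymm)

lemma continuous_resolvent_hamiltonian {η : ℝ} (hη : 0 < η) (ψ : HilbertSpace d) :
    Continuous fun p : Environment d × ℝ =>
      resolventOp (hamiltonian k lam p.1) ((p.2 : ℂ) + η * Complex.I) ψ := by
  rw [continuous_iff_continuousAt]
  rintro ⟨V, E⟩
  have h := continuousAt_resolvent (U := fun x => lam * V x) (inner_hopping hk hsymm)
    (z := (E : ℂ) + η * Complex.I) (by simpa using hη.ne') ψ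
  have hc : Continuous fun p : Environment d × ℝ =>
      ((fun x => lam * p.1 x : Lattice d → ℝ), (p.2 : ℂ) + η * Complex.I) := by
    refine Continuous.prodMk (continuous_pi fun x => ?_) (by fun_prop)
    exact continuous_const.mul ((continuous_apply x).comp continuous_fst)
  exact ContinuousAt.comp (f := fun p : Environment d × ℝ =>
      ((fun x => lam * p.1 x : Lattice d → ℝ), (p.2 : ℂ) + η * Complex.I)) (x := (V, E)) h
    hc.continuousAt

lemma resolvent_hamiltonian_translate (V : Environment d) {z : ℂ} (hz : z.im ≠ 0) (a : Lattice d)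
    (ψ : HilbertSpace d) :
    resolventOp (hamiltonian k lam (translate a V)) z (shift a ψ)
      = shift a (resolventOp (hamiltonian k lam V) z ψ) :=
  resolvent_translate (U := fun x => lam * V x) (inner_hopping hk hsymm)
    (convolution_shift (summable_hopping hk)) hz a ψ

/-- The scalar spectral measures of the Hamiltonian. -/
lemma measure_translate (V : Environment d) (a : Lattice d) (ψ : HilbertSpace d) :
    (isSelfAdjointOp_hamiltonian hk hsymm lam (translate a V)).isPVM_spectralProjection.measure
        (shift a ψ)
      = (isSelfAdjointOp_hamiltonian hk hsymm lam V).isPVM_spectralProjection.measure ψ := by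
  refine measure_eq_of_forall_approxDelta fun η E hη => ?_
  rw [← (isSelfAdjointOp_hamiltonian hk hsymm lam (translate a V)).norm_resolvent_sq hη,
    ← (isSelfAdjointOp_hamiltonian hk hsymm lam V).norm_resolvent_sq hη,
    resolvent_hamiltonian_translate hk hsymm lam V (by simpa using hη.ne')]
  congr 2
  rw [← sq_eq_sq₀ (norm_nonneg _) (norm_nonneg _)]
  apply Complex.ofReal_injective
  have h := inner_shift_shift a (resolventOp (hamiltonian k lam V) ((E : ℂ) + η * Complex.I) ψ)
    (resolventOp (hamiltonian k lam V) ((E : ℂ) + η * Complex.I) ψ)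
  rw [inner_self_eq_norm_sq_to_K, inner_self_eq_norm_sq_to_K] at h
  push_cast
  exact h

lemma spectralProjection_translate (V : Environment d) (a : Lattice d) {B : Set ℝ}
    (hB : MeasurableSet B) (ψ : HilbertSpace d) :
    spectralProjection (hamiltonian k lam (translate a V)) B (shift a ψ)
      = shift a (spectralProjection (hamiltonian k lam V) B ψ) := by
  have hP := (isSelfAdjointOp_hamiltonian hk hsymm lam V).isPVM_spectralProjection
  have hP' := (isSelfAdjointOp_hamiltonian hk hsymm lam (translate a V)).isPVM_spectralProjection
  have h : shift (-a) * spectralProjection (hamiltonian k lam (translate a V)) B * shift a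
      = spectralProjection (hamiltonian k lam V) B := by
    refine ext_of_inner_self fun φ => ?_
    rw [mul_apply_eq_comp, mul_apply_eq_comp, ← inner_shift, hP'.inner_apply_self hB,
      hP.inner_apply_self hB, ← hP'.measureReal_apply hB, ← hP.measureReal_apply hB,
      measure_translate hk hsymm]
  rw [← h, mul_apply_eq_comp, mul_apply_eq_comp, shift_shift, add_neg_cancel, shift_zero]

/-- The projections are chosen separately for each environment, so nothing can be read off their
definition. The resolvent, however, is continuous in the environment and determines the scalar
spectral measures. -/
lemma measurable_measure_hamiltonian (ψ : HilbertSpace d) :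
    Measurable fun V => (isSelfAdjointOp_hamiltonian hk hsymm lam
      V).isPVM_spectralProjection.measure
      ψ := by
  refine measurable_measure_of_approxDelta fun η hη => ?_
  have h : ∀ p : Environment d × ℝ, ∫ t, approxDelta η (t - p.2)
      ∂((isSelfAdjointOp_hamiltonian hk hsymm lam p.1).isPVM_spectralProjection.measure ψ)
      = η / Real.pi * ‖resolventOp (hamiltonian k lam p.1) ((p.2 : ℂ) + η * Complex.I) ψ‖ ^ 2 :=
    fun p => ((isSelfAdjointOp_hamiltonian hk hsymm lam p.1).norm_resolvent_sq hη ψ).symm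
  simp_rw [h]
  exact (continuous_const.mul
    ((continuous_resolvent_hamiltonian hk hsymm lam hη ψ).norm.pow 2)).measurable

lemma measurable_inner_spectralProjection {B : Set ℝ} (hB : MeasurableSet B)
    (φ ψ : HilbertSpace d) :
    Measurable fun V => inner ℂ φ (spectralProjection (hamiltonian k lam V) B ψ) := by
  have h : ∀ ψ, Measurable fun V => inner ℂ ψ (spectralProjection (hamiltonian k lam V) B ψ) := by
    intro ψ
    have h1 : ∀ V, inner ℂ ψ (spectralProjection (hamiltonian k lam V) B ψ)
        = ((((isSelfAdjointOp_hamiltonian hk hsymm lam V).isPVM_spectralProjection.measure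
      ψ).real B : ℝ) : ℂ) := fun V => by
      rw [IsPVM.measureReal_apply _ hB, ← IsPVM.inner_apply_self
        (isSelfAdjointOp_hamiltonian hk hsymm lam V).isPVM_spectralProjection hB]
    simp_rw [h1]
    exact Complex.measurable_ofReal.comp
      ((Measure.measurable_coe hB).comp (measurable_measure_hamiltonian hk hsymm lam
        ψ)).ennreal_toReal
  simp_rw [inner_polarization _ φ ψ]
  exact ((((h _).sub (h _)).sub ((h _).const_mul _)).add ((h _).const_mul _)).div_const 4

end Environment

/-! ### Covariant operators and the trace per unit volume -/

section Covariant

variable {d : ℕ}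

/-- A bounded measurable family of operators, covariant under the lattice translations. -/
structure IsCovariant (X : Environment d → HilbertSpace d →L[ℂ] HilbertSpace d) : Prop where
  translate : ∀ a V ψ, X (translate a V) (shift a ψ) = shift a (X V ψ)
  measurable : ∀ φ ψ, Measurable fun V => inner ℂ φ (X V ψ)
  bounded : ∃ c : ℝ, ∀ V, ‖X V‖ ≤ c

namespace IsCovariant

variable {X Y : Environment d → HilbertSpace d →L[ℂ] HilbertSpace d}

lemma mul (hX : IsCovariant X) (hY : IsCovariant Y) : IsCovariant fun V => X V * Y V where
  translate a V ψ := by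
    simp only [mul_apply_eq_comp, hX.translate, hY.translate]
  measurable φ ψ := by
    -- Inserting the basis of sites writes a matrix element of the product as a countable sum of
    -- products of measurable matrix elements.
    have h : ∀ V, HasSum (fun x => inner ℂ φ (X V (site x)) * inner ℂ (site x) (Y V ψ))
        (inner ℂ φ ((X V * Y V) ψ)) := by
      intro V
      rw [mul_apply_eq_comp, ← ContinuousLinearMap.adjoint_inner_left]
      refine (lp.hasSum_inner _ _).congr_fun fun x => ?_
      rw [← ContinuousLinearMap.adjoint_inner_left, inner_site, ← inner_conj_symm, inner_site,
        RCLike.inner_apply, mul_comm]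
    refine measurable_of_tendsto_metrizable' (atTop : Filter (Finset (Lattice d)))
      (f := fun s V => ∑ x ∈ s, inner ℂ φ (X V (site x)) * inner ℂ (site x) (Y V ψ)) (fun s => ?_)
      (tendsto_pi_nhds.2 h)
    exact Finset.measurable_fun_sum _ fun x _ => (hX.measurable _ _).mul (hY.measurable _ _)
  bounded := by
    obtain ⟨c, hc⟩ := hX.bounded
    obtain ⟨c', hc'⟩ := hY.bounded
    refine ⟨c * c', fun V => (norm_mul_le _ _).trans ?_⟩
    exact mul_le_mul (hc V) (hc' V) (norm_nonneg _) ((norm_nonneg _).trans (hc V))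

lemma adjoint (hX : IsCovariant X) : IsCovariant fun V => ContinuousLinearMap.adjoint (X V) where
  translate a V ψ := by
    refine ext_inner_left ℂ fun φ => ?_
    have h := hX.translate a V (shift (-a) φ)
    rw [shift_shift, add_neg_cancel, shift_zero] at h
    rw [ContinuousLinearMap.adjoint_inner_right, h, inner_shift_shift,
      ← ContinuousLinearMap.adjoint_inner_right, inner_shift, neg_neg]
  measurable φ ψ := by
    simp_rw [ContinuousLinearMap.adjoint_inner_right, ← inner_conj_symm (X _ φ) ψ]
    exact Complex.continuous_conj.measurable.comp (hX.measurable _ _)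
  bounded := by
    obtain ⟨c, hc⟩ := hX.bounded
    exact ⟨c, fun V => (LinearIsometryEquiv.norm_map _ _).trans_le (hc V)⟩

lemma add (hX : IsCovariant X) (hY : IsCovariant Y) : IsCovariant fun V => X V + Y V where
  translate a V ψ := by simp only [add_apply, hX.translate, hY.translate, map_add]
  measurable φ ψ := by
    simp only [add_apply, inner_add_right]
    exact (hX.measurable _ _).add (hY.measurable _ _)
  bounded := by
    obtain ⟨c, hc⟩ := hX.bounded
    obtain ⟨c', hc'⟩ := hY.bounded
    exact ⟨c + c', fun V => (norm_add_le _ _).trans (add_le_add (hc V) (hc' V))⟩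

lemma const_smul (hX : IsCovariant X) (r : ℂ) : IsCovariant fun V => r • X V where
  translate a V ψ := by simp only [smul_apply, hX.translate, map_smul]
  measurable φ ψ := by
    simp only [smul_apply, inner_smul_right]
    exact (hX.measurable _ _).const_mul _
  bounded := by
    obtain ⟨c, hc⟩ := hX.bounded
    exact ⟨‖r‖ * c, fun V => (norm_smul _ _).trans_le
      (mul_le_mul_of_nonneg_left (hc V) (norm_nonneg _))⟩

lemma measurable_apply (hX : IsCovariant X) (ψ : HilbertSpace d) (x : Lattice d) :
    Measurable fun V => X V ψ x := by
  simpa only [inner_site] using hX.measurable (site x) ψ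

lemma enorm_sq_eq_tsum (ψ : HilbertSpace d) : ‖ψ‖ₑ ^ 2 = ∑' x, ‖ψ x‖ₑ ^ 2 := by
  have h := lp.hasSum_inner (𝕜 := ℂ) ψ ψ
  have h1 : HasSum (fun x => ‖ψ x‖ ^ 2) (‖ψ‖ ^ 2) := by
    rw [inner_self_eq_norm_sq_to_K] at h
    rw [← Complex.hasSum_ofReal]
    refine (by simpa using h : HasSum _ _).congr_fun fun x => ?_
    simp [← Complex.conj_mul', mul_comm]
  have h2 := ENNReal.ofReal_tsum_of_nonneg (fun x => sq_nonneg ‖ψ x‖) h1.summable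
  rw [h1.tsum_eq] at h2
  simpa [ENNReal.ofReal_pow] using h2

lemma measurable_enorm_sq (hX : IsCovariant X) (ψ : HilbertSpace d) :
    Measurable fun V => ‖X V ψ‖ₑ ^ 2 := by
  simp_rw [enorm_sq_eq_tsum]
  exact Measurable.tsum fun x => (hX.measurable_apply ψ x).enorm.pow_const 2

lemma measurable_norm (hX : IsCovariant X) (ψ : HilbertSpace d) :
    Measurable fun V => ‖X V ψ‖ := by
  have h := (hX.measurable_enorm_sq ψ).ennreal_toReal.sqrt
  simpa [Real.sqrt_sq] using h

variable {ℙ : Measure (Environment d)}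

/-- The Hilbert–Schmidt norm per unit volume is invariant under taking adjoints. -/
lemma lintegral_adjoint (h_stat : ∀ a : Lattice d, MeasurePreserving (Kubo.translate a) ℙ ℙ)
    (hX : IsCovariant X) :
    ∫⁻ V, ‖ContinuousLinearMap.adjoint (X V) (site 0)‖ₑ ^ 2 ∂ℙ
      = ∫⁻ V, ‖X V (site 0)‖ₑ ^ 2 ∂ℙ := by
  simp_rw [enorm_sq_eq_tsum]
  rw [lintegral_tsum fun x =>
      ((hX.adjoint.measurable_apply (site 0) x).enorm.pow_const 2).aemeasurable,
    lintegral_tsum fun x => ((hX.measurable_apply (site 0) x).enorm.pow_const 2).aemeasurable,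
    ← (Equiv.neg (Lattice d)).tsum_eq]
  -- Entry by entry, |⟨−x|X*|0⟩| = |⟨0|X|−x⟩|, and translating the environment by −x turns the
  -- latter into |⟨x|X|0⟩|.
  refine tsum_congr fun x => ?_
  rw [← (h_stat (-x)).lintegral_comp
    ((hX.adjoint.measurable_apply (site 0) _).enorm.pow_const 2)]
  refine lintegral_congr fun V => ?_
  rw [Equiv.neg_apply, ← inner_site (-x), ContinuousLinearMap.adjoint_inner_right,
    ← zero_add (-x), ← shift_site, zero_add, hX.translate, inner_shift, neg_neg, shift_site,
    zero_add, ← inner_conj_symm, inner_site, RCLike.enorm_conj]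

variable [IsProbabilityMeasure ℙ]

lemma integrable_norm_sq (hX : IsCovariant X) (ψ : HilbertSpace d) :
    Integrable (fun V => ‖X V ψ‖ ^ 2) ℙ := by
  obtain ⟨c, hc⟩ := hX.bounded
  refine Integrable.of_bound ((hX.measurable_norm ψ).pow_const 2).aestronglyMeasurable
    ((c * ‖ψ‖) ^ 2) (Eventually.of_forall fun V => ?_)
  rw [Real.norm_of_nonneg (sq_nonneg _)]
  gcongr
  exact (X V).le_of_opNorm_le (hc V) ψ

lemma ofReal_integral_norm_sq (hX : IsCovariant X) (ψ : HilbertSpace d) :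
    ENNReal.ofReal (∫ V, ‖X V ψ‖ ^ 2 ∂ℙ) = ∫⁻ V, ‖X V ψ‖ₑ ^ 2 ∂ℙ := by
  rw [ofReal_integral_eq_lintegral_ofReal (hX.integrable_norm_sq ψ)
    (Eventually.of_forall fun V => sq_nonneg _)]
  simp [ENNReal.ofReal_pow]

lemma integral_adjoint (h_stat : ∀ a : Lattice d, MeasurePreserving (Kubo.translate a) ℙ ℙ)
    (hX : IsCovariant X) :
    ∫ V, ‖ContinuousLinearMap.adjoint (X V) (site 0)‖ ^ 2 ∂ℙ = ∫ V, ‖X V (site 0)‖ ^ 2 ∂ℙ := by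
  rw [← ENNReal.ofReal_eq_ofReal_iff (integral_nonneg fun V => sq_nonneg _)
    (integral_nonneg fun V => sq_nonneg _), hX.ofReal_integral_norm_sq,
    hX.adjoint.ofReal_integral_norm_sq, hX.lintegral_adjoint h_stat]

/-- Polarization under the expectation: inner products are reduced to averaged squared norms, to
which invariance under adjoints applies. -/
lemma integral_inner_eq (hX : IsCovariant X) (hY : IsCovariant Y) (ψ : HilbertSpace d) :
    ∫ V, inner ℂ (X V ψ) (Y V ψ) ∂ℙ
      = (((∫ V, ‖(X V + Y V) ψ‖ ^ 2 ∂ℙ : ℝ) : ℂ) - ((∫ V,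
        ‖(X V + (-1 : ℂ) • Y V) ψ‖ ^ 2 ∂ℙ : ℝ) : ℂ)
        + (((∫ V, ‖(X V + (-Complex.I) • Y V) ψ‖ ^ 2 ∂ℙ : ℝ) : ℂ)
        - ((∫ V, ‖(X V + Complex.I • Y V) ψ‖ ^ 2 ∂ℙ : ℝ) : ℂ)) * Complex.I) / 4 := by
  have hi : ∀ c : ℂ, Integrable (fun V => ((‖(X V + c • Y V) ψ‖ ^ 2 : ℝ) : ℂ)) ℙ := fun c =>
    ((hX.add (hY.const_smul c)).integrable_norm_sq ψ).ofReal
  have hi1 : Integrable (fun V => ((‖(X V + Y V) ψ‖ ^ 2 : ℝ) : ℂ)) ℙ :=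
    ((hX.add hY).integrable_norm_sq ψ).ofReal
  simp only [← integral_complex_ofReal]
  rw [← integral_sub hi1 (hi _), ← integral_sub (hi _) (hi _), ← integral_mul_const,
    ← integral_add (by exact hi1.sub (hi _)) (by exact ((hi _).sub (hi _)).mul_const _),
    ← integral_div]
  refine integral_congr_ae (Eventually.of_forall fun V => ?_)
  dsimp only
  rw [inner_eq_sum_norm_sq_div_four]
  simp [sub_eq_add_neg]

/-- Cyclicity of the trace per unit volume. -/
lemma trace_mul_comm (h_stat : ∀ a : Lattice d, MeasurePreserving (Kubo.translate a) ℙ ℙ)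
    (hX : IsCovariant X) (hY : IsCovariant Y) :
    tracePerVolume ℙ (fun V => X V * Y V) = tracePerVolume ℙ fun V => Y V * X V := by
  have h1 : ∀ {X Y : Environment d → HilbertSpace d →L[ℂ] HilbertSpace d},
      tracePerVolume ℙ (fun V => X V * Y V)
        = ∫ V, inner ℂ (ContinuousLinearMap.adjoint (X V) (site 0)) (Y V (site 0)) ∂ℙ := by
    intro X Y
    unfold tracePerVolume
    simp_rw [ContinuousLinearMap.adjoint_inner_left, mul_apply_eq_comp]
  rw [h1, h1, integral_inner_eq hX.adjoint hY, integral_inner_eq hY.adjoint hX]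
  -- The adjoint of X* + cY is a unimodular multiple of Y* + c'X, so the four polarization terms
  -- agree one by one.
  have h2 : ∀ c c' : ℂ, ‖c‖ = 1 → c' * (starRingEnd ℂ) c = 1 →
      ∫ V, ‖(ContinuousLinearMap.adjoint (X V) + c • Y V) (site 0)‖ ^ 2 ∂ℙ
      = ∫ V, ‖(ContinuousLinearMap.adjoint (Y V) + c' • X V) (site 0)‖ ^ 2 ∂ℙ := by
    intro c c' hc hcc
    rw [← (hX.adjoint.add (hY.const_smul c)).integral_adjoint h_stat]
    refine integral_congr_ae (Eventually.of_forall fun V => ?_)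
    have : ContinuousLinearMap.adjoint (ContinuousLinearMap.adjoint (X V) + c • Y V)
        = (starRingEnd ℂ c) • (ContinuousLinearMap.adjoint (Y V) + c' • X V) := by
      rw [map_add, ContinuousLinearMap.adjoint_adjoint, map_smulₛₗ, smul_add, smul_smul,
        mul_comm _ c', hcc, one_smul, add_comm]
    dsimp only
    rw [this, smul_apply, norm_smul, RCLike.norm_conj, hc, one_mul]
  rw [h2 (-1) (-1) (by simp) (by simp), h2 (-Complex.I) (-Complex.I) (by simp) (by simp),
    h2 Complex.I Complex.I (by simp) (by simp)]
  have h3 := h2 1 1 (by simp) (by simp)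
  simp only [one_smul] at h3
  rw [h3]

end IsCovariant

variable {k : Lattice d → ℝ}

lemma isCovariant_convolution {w : Lattice d → ℂ} (hw : Summable w) :
    IsCovariant fun _ : Environment d => convolution w where
  translate a _ ψ := convolution_shift hw a ψ
  measurable _ _ := measurable_const
  bounded := ⟨_, fun _ => le_rfl⟩

variable (hk : Summable fun a : Lattice d => (1 + ‖a‖) * |k a|) (hsymm : ∀ a, k (-a) = k a)
  (lam : ℝ)
include hk hsymm

lemma isCovariant_spectralProjection {B : Set ℝ} (hB : MeasurableSet B) :
    IsCovariant fun V : Environment d => spectralProjection (hamiltonian k lam V) B where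
  translate a V ψ := spectralProjection_translate hk hsymm lam V a hB ψ
  measurable φ ψ := measurable_inner_spectralProjection hk hsymm lam hB φ ψ
  bounded := ⟨1, fun V => ContinuousLinearMap.opNorm_le_bound _ zero_le_one fun ψ => by
    rw [one_mul]
    exact (isSelfAdjointOp_hamiltonian hk hsymm lam V).isPVM_spectralProjection.norm_apply_le hB ψ⟩

lemma isCovariant_resolvent {z : ℂ} (hz : z.im ≠ 0) :
    IsCovariant fun V : Environment d => resolventOp (hamiltonian k lam V) z where
  translate a V ψ := resolvent_hamiltonian_translate hk hsymm lam V hz a ψ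
  measurable φ ψ := by
    have h : Continuous fun V : Environment d => resolventOp (hamiltonian k lam V) z ψ := by
      rw [continuous_iff_continuousAt]
      intro V
      have h := continuousAt_resolvent (U := fun x => lam * V x) (inner_hopping hk hsymm) hz ψ
      have hc : Continuous fun V : Environment d => ((fun x => lam * V x : Lattice d → ℝ), z) :=
        (continuous_pi fun x => continuous_const.mul (continuous_apply x)).prodMk continuous_const
      exact ContinuousAt.comp (f := fun V : Environment d =>
        ((fun x => lam * V x : Lattice d → ℝ), z)) (x := V) h hc.continuousAt
    exact (continuous_const.inner h).measurable
  bounded := ⟨|z.im|⁻¹, fun V => ContinuousLinearMap.opNorm_le_bound _ (by positivity)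
    ((isSelfAdjointOp_hamiltonian hk hsymm lam V).norm_resolvent_le hz)⟩

end Covariant

/-! ### Integration against combinations of positive measures -/

section VectorIntegral

variable {X ι : Type*} [MeasurableSpace X] [Fintype ι] {m : ComplexMeasure X} {μ : ι → Measure X}
  [∀ l, IsFiniteMeasure (μ l)] {c : ι → ℂ}

/-- By the triangle inequality ∑ |c_l| μ_l dominates the variation. Finiteness is what makes bounded
functions integrable against m. -/
lemma isFiniteMeasure_variation (h : ∀ S, MeasurableSet S → m S = ∑ l, c l * ((μ l).real S : ℂ)) :
    IsFiniteMeasure m.variation := by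
  have hle : m.variation ≤ ∑ l, ‖c l‖₊ • μ l := by
    refine VectorMeasure.variation_le_of_forall_enorm_le fun S hS => ?_
    rw [h S hS, Measure.finsetSum_apply]
    refine (enorm_sum_le _ _).trans (Finset.sum_le_sum fun l _ => ?_)
    rw [enorm_mul, Measure.smul_apply, ENNReal.smul_def, smul_eq_mul]
    refine mul_le_mul' le_rfl ?_
    rw [← ofReal_norm, Complex.norm_real, Real.norm_of_nonneg measureReal_nonneg,
      ofReal_measureReal]
  exact isFiniteMeasure_of_le _ hle

/-- Integration of bounded functions against a linear combination of finite measures. -/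
lemma vectorIntegral_eq_sum (h : ∀ S, MeasurableSet S → m S = ∑ l, c l * ((μ l).real S : ℂ))
    {f : X → ℝ} (hf : Measurable f) {b : ℝ} (hb : ∀ x, ‖f x‖ ≤ b) :
    ∫ᵛ x, f x ∂•m = ∑ l, c l * ((∫ x, f x ∂(μ l) : ℝ) : ℂ) := by
  have := isFiniteMeasure_variation h
  have hsimple : ∀ s : SimpleFunc X ℝ,
      ∫ᵛ x, s x ∂•m = ∑ l, c l * ((∫ x, s x ∂(μ l) : ℝ) : ℂ) := by
    intro s
    induction s using SimpleFunc.induction with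
    | const r hS =>
      rename_i S
      have e : ⇑(SimpleFunc.piecewise S hS (SimpleFunc.const X r) (SimpleFunc.const X 0))
          = S.indicator fun _ => r := by
        ext x
        simp [Set.indicator, Set.piecewise]
      simp_rw [e]
      rw [VectorMeasure.integral_eq_setToFun, setToFun_indicator_const _ hS (measure_ne_top _ _)]
      change r • m S = _
      rw [h S hS, Finset.smul_sum]
      refine Finset.sum_congr rfl fun l _ => ?_
      rw [integral_indicator_const _ hS, smul_eq_mul, Complex.real_smul]
      push_cast
      ring
    | add hd hs ht =>
      rename_i s t
      simp only [SimpleFunc.coe_add, Pi.add_apply]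
      rw [VectorMeasure.integral_fun_add (SimpleFunc.integrable_of_isFiniteMeasure _)
        (SimpleFunc.integrable_of_isFiniteMeasure _), hs, ht, ← Finset.sum_add_distrib]
      refine Finset.sum_congr rfl fun l _ => ?_
      rw [integral_add (SimpleFunc.integrable_of_isFiniteMeasure _)
        (SimpleFunc.integrable_of_isFiniteMeasure _)]
      push_cast
      ring
  have hs := hf.stronglyMeasurable
  rcases isEmpty_or_nonempty X with hX | ⟨⟨x₀⟩⟩
  · simp [VectorMeasure.integral_of_isEmpty, Measure.eq_zero_of_isEmpty]
  have hb0 : 0 ≤ b := (norm_nonneg _).trans (hb x₀)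
  have hpt : ∀ x, Tendsto (fun n => hs.approxBounded b n x) atTop (𝓝 (f x)) := fun x =>
    hs.tendsto_approxBounded_of_norm_le (hb x)
  have hbd : ∀ n x, ‖hs.approxBounded b n x‖ ≤ b := fun n x =>
    hs.norm_approxBounded_le hb0 n x
  refine tendsto_nhds_unique (VectorMeasure.tendsto_integral_of_dominated_convergence (fun _ => b)
    (fun n => (SimpleFunc.stronglyMeasurable _).aestronglyMeasurable) (integrable_const _)
    (fun n => Eventually.of_forall (hbd n)) (Eventually.of_forall hpt)) ?_
  simp_rw [hsimple]
  refine tendsto_finsetSum _ fun l _ => Tendsto.const_mul _ ?_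
  refine (Complex.continuous_ofReal.tendsto _).comp ?_
  exact tendsto_integral_of_dominated_convergence (fun _ => b)
    (fun n => (SimpleFunc.stronglyMeasurable _).aestronglyMeasurable) (integrable_const _)
    (fun n => Eventually.of_forall (hbd n)) (Eventually.of_forall hpt)

end VectorIntegral

/-! ### Positive bimeasures extend to measures -/

section Bimeasure

/-- Conditions under which a function on the rationals is the restriction of a distribution
function. -/
lemma isRatStieltjesPoint_of_ennreal {F : ℝ → ℚ → ℝ≥0∞} {a : ℝ} (hmono : Monotone (F a))
    (hle : ∀ q, F a q ≤ 1) (htop : ⨆ n : ℕ, F a n = 1) (hbot : ⨅ n : ℕ, F a (-n) = 0)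
    (hright : ∀ q, ⨅ n : ℕ, F a (q + 1 / ((n : ℚ) + 1)) = F a q) :
    ProbabilityTheory.IsRatStieltjesPoint (fun a q => (F a q).toReal) a := by
  have hfin : ∀ q, F a q ≠ ∞ := fun q => ne_top_of_le_ne_top ENNReal.one_ne_top (hle q)
  have hm : Monotone fun q => (F a q).toReal := fun q r hqr =>
    ENNReal.toReal_mono (hfin r) (hmono hqr)
  refine ⟨hm, ?_, ?_, ?_⟩
  · have h1 : Tendsto (fun q => F a q) atTop (𝓝 (⨆ q, F a q)) := tendsto_atTop_iSup hmono
    have h2 : ⨆ q, F a q = 1 :=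
      le_antisymm (iSup_le hle) (htop ▸ iSup_le fun n : ℕ => le_iSup (F a) (n : ℚ))
    rw [h2] at h1
    exact (ENNReal.tendsto_toReal ENNReal.one_ne_top).comp h1
  · have h1 : Tendsto (fun q => F a q) atBot (𝓝 (⨅ q, F a q)) := tendsto_atBot_iInf hmono
    have h2 : ⨅ q, F a q = 0 :=
      le_antisymm (hbot ▸ le_iInf fun n : ℕ => iInf_le (F a) (-n : ℚ)) zero_le
    rw [h2] at h1
    exact (ENNReal.tendsto_toReal ENNReal.zero_ne_top).comp h1
  · intro t
    have hbdd : BddBelow (Set.range fun r : Set.Ioi t => (F a r).toReal) :=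
      ⟨0, by rintro _ ⟨r, rfl⟩; exact ENNReal.toReal_nonneg⟩
    refine le_antisymm ?_ (le_ciInf fun r => hm r.2.le)
    have h1 : Tendsto (fun n : ℕ => F a (t + 1 / ((n : ℚ) + 1))) atTop
        (𝓝 (⨅ n : ℕ, F a (t + 1 / ((n : ℚ) + 1)))) := by
      refine tendsto_atTop_iInf fun n n' hn => hmono ?_
      gcongr
    rw [hright] at h1
    refine ge_of_tendsto ((ENNReal.tendsto_toReal (hfin t)).comp h1) (Eventually.of_forall fun n
        => ?_)
    refine ciInf_le hbdd (⟨t + 1 / ((n : ℚ) + 1), ?_⟩ : Set.Ioi t)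
    have : (0 : ℚ) < 1 / ((n : ℚ) + 1) := by positivity
    exact lt_add_of_pos_right t this

/-- A finite positive bimeasure on the real line extends to a measure on the plane. -/
theorem exists_measure_prod_of_bimeasure {b : Set ℝ → Set ℝ → ℝ≥0∞}
    (h1 : ∀ A, MeasurableSet A → ∃ τ : Measure ℝ, ∀ B, MeasurableSet B → τ B = b A B)
    (h2 : ∀ B, MeasurableSet B → ∃ ρ : Measure ℝ, ∀ A, MeasurableSet A → ρ A = b A B)
    (hfin : b Set.univ Set.univ ≠ ∞) :
    ∃ μ : Measure (ℝ × ℝ), IsFiniteMeasure μ ∧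
      ∀ A B, MeasurableSet A → MeasurableSet B → μ (A ×ˢ B) = b A B := by
  choose! τ hτ using h1
  choose! ρ hρ using h2
  set μ := ρ Set.univ with hμ
  have hμfin : IsFiniteMeasure μ := ⟨by
    rw [hμ, hρ _ .univ _ .univ]; exact hfin.lt_top⟩
  have hmono : ∀ {A B B'}, MeasurableSet A → MeasurableSet B → MeasurableSet B' → B ⊆ B' →
      b A B ≤ b A B' := by
    intro A B B' hA hB hB' hBB
    rw [← hτ A hA B hB, ← hτ A hA B' hB']
    exact measure_mono hBB
  have hle : ∀ B, MeasurableSet B → ρ B ≤ μ := fun B hB => Measure.le_iff.2 fun A hA => by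
    rw [hρ B hB A hA, hμ, hρ _ .univ A hA]
    exact hmono hA hB .univ (Set.subset_univ _)
  have hI : ∀ q : ℚ, MeasurableSet (Set.Iic (q : ℝ)) := fun q => measurableSet_Iic
  -- The conditional distribution function of the second variable given the first, at rational
  -- points: the density of A ↦ b A (Iic q) relative to the first marginal μ.
  let F : ℝ → ℚ → ℝ≥0∞ := fun a q => (ρ (Set.Iic (q : ℝ))).rnDeriv μ a
  have hFm : ∀ q, Measurable fun a => F a q := fun q => Measure.measurable_rnDeriv _ _
  have hFint : ∀ q A, MeasurableSet A → ∫⁻ a in A, F a q ∂μ = b A (Set.Iic (q : ℝ)) := by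
    intro q A hA
    have := isFiniteMeasure_of_le μ (hle _ (hI q))
    rw [Measure.setLIntegral_rnDeriv' (hle _ (hI q)).absolutelyContinuous hA, hρ _ (hI q) A hA]
  have hFint' : ∀ q, ∫⁻ a, F a q ∂μ = b Set.univ (Set.Iic (q : ℝ)) := fun q => by
    rw [← hFint q _ .univ, Measure.restrict_univ]
  have hFne : ∀ q, ∫⁻ a, F a q ∂μ ≠ ∞ := fun q => by
    rw [hFint']
    exact ne_top_of_le_ne_top hfin (hmono .univ (hI q) .univ (Set.subset_univ _))
  have hcmono : ∀ᵐ a ∂μ, Monotone (F a) := by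
    have : ∀ᵐ a ∂μ, ∀ q r : ℚ, q ≤ r → F a q ≤ F a r := by
      rw [ae_all_iff]; intro q
      rw [ae_all_iff]; intro r
      by_cases hqr : q ≤ r
      · have := ae_le_of_forall_setLIntegral_le_of_sigmaFinite (μ := μ) (hFm q)
          (g := fun a => F a r) fun A hA _ => by
            rw [hFint q A hA, hFint r A hA]
            exact hmono hA (hI q) (hI r) (Set.Iic_subset_Iic.2 (by exact_mod_cast hqr))
        filter_upwards [this] with a ha _ using ha
      · exact Eventually.of_forall fun a h => absurd h hqr
    filter_upwards [this] with a ha q r hqr using ha q r hqr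
  have hcle : ∀ᵐ a ∂μ, ∀ q, F a q ≤ 1 := by
    rw [ae_all_iff]; intro q
    refine ae_le_of_forall_setLIntegral_le_of_sigmaFinite (μ := μ) (hFm q)
      (g := fun _ => 1) fun A hA _ => ?_
    rw [hFint q A hA, setLIntegral_one, hμ, hρ _ .univ A hA]
    exact hmono hA (hI q) .univ (Set.subset_univ _)
  have htopT := hτ Set.univ .univ
  have hτfin : IsFiniteMeasure (τ Set.univ) := ⟨by rw [htopT _ .univ]; exact hfin.lt_top⟩
  -- The supremum is at most 1 almost everywhere and has the same integral as 1, so it equals 1. The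
  -- limits at −∞ and from the right are likewise deduced from equality of integrals.
  have hctop : ∀ᵐ a ∂μ, ⨆ n : ℕ, F a n = 1 := by
    have hsup : ∫⁻ a, ⨆ n : ℕ, F a n ∂μ = μ Set.univ := by
      rw [lintegral_iSup' (fun n => (hFm n).aemeasurable)
        (by filter_upwards [hcmono] with a ha n m hnm using ha (by exact_mod_cast hnm))]
      simp_rw [hFint', ← htopT _ (hI _)]
      rw [hμ, hρ _ .univ _ .univ, ← htopT _ .univ]
      have hU : (⋃ n : ℕ, Set.Iic (((n : ℚ) : ℝ))) = Set.univ := by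
        rw [Set.eq_univ_iff_forall]
        intro x
        obtain ⟨n, hn⟩ := exists_nat_ge x
        exact Set.mem_iUnion.2 ⟨n, by simpa using hn⟩
      rw [← hU]
      refine (Monotone.measure_iUnion fun n m hnm => Set.Iic_subset_Iic.2 ?_).symm
      exact_mod_cast hnm
    refine ae_eq_of_ae_le_of_lintegral_le (g := fun _ => (1 : ℝ≥0∞))
      (hcle.mono fun a ha => iSup_le fun n => ha n) (by rw [hsup]; exact measure_ne_top _ _)
      aemeasurable_const ?_
    rw [hsup, lintegral_one]
  have hcbot : ∀ᵐ a ∂μ, ⨅ n : ℕ, F a (-n) = 0 := by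
    have hinf : ∫⁻ a, ⨅ n : ℕ, F a (-n) ∂μ = 0 := by
      rw [lintegral_iInf' (fun n => (hFm _).aemeasurable)
        (by filter_upwards [hcmono] with a ha n m hnm using ha (by simpa using hnm)) (hFne _)]
      simp_rw [hFint', ← htopT _ (hI _)]
      have hE : (⋂ n : ℕ, Set.Iic (((-n : ℚ) : ℝ))) = ∅ := by
        rw [Set.eq_empty_iff_forall_notMem]
        intro x hx
        obtain ⟨n, hn⟩ := exists_nat_gt (-x)
        have := Set.mem_iInter.1 hx n
        rw [Set.mem_Iic] at this
        push_cast at this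
        linarith
      rw [← Antitone.measure_iInter (fun n m hnm => Set.Iic_subset_Iic.2 (by
        push_cast; simpa using hnm)) (fun n => (hI _).nullMeasurableSet)
        ⟨0, measure_ne_top _ _⟩, hE, measure_empty]
    exact (lintegral_eq_zero_iff (Measurable.iInf fun n => hFm _)).1 hinf
  have hcright : ∀ᵐ a ∂μ, ∀ q, ⨅ n : ℕ, F a (q + 1 / ((n : ℚ) + 1)) = F a q := by
    rw [ae_all_iff]; intro q
    have hanti : Antitone fun n : ℕ => q + 1 / ((n : ℚ) + 1) := fun n m hnm => by
      dsimp only; gcongr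
    have hinf : ∫⁻ a, ⨅ n : ℕ, F a (q + 1 / ((n : ℚ) + 1)) ∂μ = ∫⁻ a, F a q ∂μ := by
      rw [lintegral_iInf' (fun n => (hFm _).aemeasurable)
        (by filter_upwards [hcmono] with a ha n m hnm using ha (hanti hnm)) (hFne _)]
      simp_rw [hFint', ← htopT _ (hI _)]
      have hE : (⋂ n : ℕ, Set.Iic (((q + 1 / ((n : ℚ) + 1) : ℚ) : ℝ))) = Set.Iic (q : ℝ) := by
        ext x
        simp only [Set.mem_iInter, Set.mem_Iic]
        refine ⟨fun h => ?_, fun h n => h.trans ?_⟩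
        · refine ge_of_tendsto' (f := fun n : ℕ => (q : ℝ) + 1 / ((n : ℝ) + 1)) (x := atTop) ?_
            fun n => ?_
          · simpa using (tendsto_one_div_add_atTop_nhds_zero_nat (𝕜 := ℝ)).const_add (q : ℝ)
          · simpa using h n
        · have : (0 : ℚ) ≤ 1 / ((n : ℚ) + 1) := by positivity
          exact_mod_cast le_add_of_nonneg_right this
      rw [← Antitone.measure_iInter (fun n m hnm => Set.Iic_subset_Iic.2 (by
        exact_mod_cast hanti hnm)) (fun n => (hI _).nullMeasurableSet)
        ⟨0, measure_ne_top _ _⟩, hE]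
    refine (ae_eq_of_ae_le_of_lintegral_le (f := fun a => F a q) ?_ (hFne q)
      (Measurable.iInf fun n => hFm _).aemeasurable hinf.le).symm
    filter_upwards [hcmono] with a ha
    refine le_iInf fun n => ha ?_
    have : (0 : ℚ) ≤ 1 / ((n : ℚ) + 1) := by positivity
    exact le_add_of_nonneg_right this
  let f : ℝ → ℚ → ℝ := fun a q => (F a q).toReal
  have hf : Measurable f := measurable_pi_iff.2 fun q => (hFm q).ennreal_toReal
  have hfS : ∀ᵐ a ∂μ, ProbabilityTheory.IsRatStieltjesPoint f a := by
    filter_upwards [hcmono, hcle, hctop, hcbot, hcright] with a ha1 ha2 ha3 ha4 ha5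
    exact isRatStieltjesPoint_of_ennreal ha1 ha2 ha3 ha4 ha5
  -- Outside a μ-null set F is a distribution function; the Stieltjes construction repairs it on
  -- that set and gives a Markov kernel. The measure sought is μ composed with κ.
  let κ : ProbabilityTheory.Kernel ℝ ℝ :=
    ⟨fun a => (ProbabilityTheory.stieltjesOfMeasurableRat f hf a).measure,
      ProbabilityTheory.measurable_measure_stieltjesOfMeasurableRat hf⟩
  have hκp : ProbabilityTheory.IsMarkovKernel κ :=
    ⟨fun a => ProbabilityTheory.instIsProbabilityMeasure_stieltjesOfMeasurableRat hf a⟩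
  have hκ : ∀ᵐ a ∂μ, ∀ q : ℚ, κ a (Set.Iic (q : ℝ)) = F a q := by
    filter_upwards [hfS, hcle] with a ha ha' q
    have : κ a (Set.Iic (q : ℝ)) = _ :=
      ProbabilityTheory.measure_stieltjesOfMeasurableRat_Iic hf a q
    rw [this, ProbabilityTheory.stieltjesOfMeasurableRat_eq,
      ProbabilityTheory.toRatCDF_of_isRatStieltjesPoint ha, ENNReal.ofReal_toReal]
    exact ne_top_of_le_ne_top ENNReal.one_ne_top (ha' q)
  refine ⟨μ.compProd κ, inferInstance, fun A B hA hB => ?_⟩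
  have hmap : ∀ B, MeasurableSet B →
      Measure.map Prod.snd ((μ.compProd κ).restrict (A ×ˢ Set.univ)) B = (μ.compProd κ) (A ×ˢ B)
        := by
    intro B hB
    rw [Measure.map_apply measurable_snd hB, Measure.restrict_apply (measurable_snd hB)]
    congr 1
    ext p
    simp [and_comm]
  have hτA : IsFiniteMeasure (τ A) := ⟨by
    rw [hτ A hA _ .univ, ← hρ _ .univ A hA]; exact measure_lt_top μ A⟩
  rw [← hmap B hB, ← hτ A hA B hB]
  congr 1
  -- With A fixed, both sides are finite measures of B that agree on rational half lines and in
  -- total mass.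
  refine ext_of_generate_finite _ Real.borel_eq_generateFrom_Iic_rat Real.isPiSystem_Iic_rat ?_ ?_
  · intro S hS
    obtain ⟨q, hq⟩ := Set.mem_iUnion.1 hS
    rw [Set.mem_singleton_iff] at hq
    subst hq
    rw [hmap _ (hI q), Measure.compProd_apply_prod hA (hI q), hτ A hA _ (hI q), ← hFint q A hA]
    exact lintegral_congr_ae (ae_restrict_of_ae (hκ.mono fun a ha => ha q))
  · rw [hmap _ .univ, Measure.compProd_apply_prod hA .univ, hτ A hA _ .univ, ← hρ _ .univ A hA]
    simp [hμ]

/-- Rectangles are a generating π-system containing the whole space. This makes the choice in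
`conductivityMeasure` unambiguous. -/
lemma measure_prod_ext {X Y : Type*} [MeasurableSpace X] [MeasurableSpace Y]
    {m m' : ComplexMeasure (X × Y)}
    (h : ∀ A B, MeasurableSet A → MeasurableSet B → m (A ×ˢ B) = m' (A ×ˢ B)) : m = m' := by
  have hU : m Set.univ = m' Set.univ := by
    rw [← Set.univ_prod_univ]
    exact h _ _ .univ .univ
  refine VectorMeasure.ext fun S hS => ?_
  induction S, hS using MeasurableSpace.induction_on_inter generateFrom_prod.symm isPiSystem_prod
    with
  | empty => simp
  | basic t ht =>
    obtain ⟨A, hA, B, hB, rfl⟩ := ht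
    exact h A B hA hB
  | compl t ht ih =>
    rw [VectorMeasure.of_compl ht, VectorMeasure.of_compl ht, ih, hU]
  | iUnion g hd hg ih =>
    rw [VectorMeasure.of_disjoint_iUnion hg hd, VectorMeasure.of_disjoint_iUnion hg hd]
    exact tsum_congr ih

end Bimeasure

/-! ### Normality of the resolvent -/

section Operators

variable {E : Type*} [NormedAddCommGroup E] [InnerProductSpace ℂ E] [CompleteSpace E]

/-- The adjoint is the resolvent at conj z, and it commutes with the resolvent at z. -/
lemma IsSelfAdjointOp.enorm_adjoint_resolvent {H : E →ₗ.[ℂ] E} (hH : IsSelfAdjointOp H) {z : ℂ}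
    (hz : z.im ≠ 0) (ψ : E) :
    ‖ContinuousLinearMap.adjoint (resolventOp H z) ψ‖ₑ = ‖resolventOp H z ψ‖ₑ := by
  have hz' : ((starRingEnd ℂ) z).im ≠ 0 := by simpa using hz
  have h : inner ℂ (ContinuousLinearMap.adjoint (resolventOp H z) ψ)
      (ContinuousLinearMap.adjoint (resolventOp H z) ψ)
      = inner ℂ (resolventOp H z ψ) (resolventOp H z ψ) := by
    rw [ContinuousLinearMap.adjoint_inner_left, ← ContinuousLinearMap.adjoint_inner_right,
      hH.adjoint_resolvent hz, ← mul_apply_eq_comp, ← mul_apply_eq_comp,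
      (hH.commute_resolvent hz hz').eq]
  rw [inner_self_eq_norm_sq_to_K, inner_self_eq_norm_sq_to_K] at h
  have h2 : ‖ContinuousLinearMap.adjoint (resolventOp H z) ψ‖ ^ 2 = ‖resolventOp H z ψ‖ ^ 2 := by
    apply Complex.ofReal_injective
    push_cast
    exact h
  rw [← ofReal_norm, ← ofReal_norm, (sq_eq_sq₀ (norm_nonneg _) (norm_nonneg _)).1 h2]

end Operators

/-! ### Velocities and their spectral correlation measures -/

section Velocity

variable {d : ℕ} {k : Lattice d → ℝ}

/-- The linear combination `∑ n_l v_l` of the velocities. -/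
def velocityAlong (k : Lattice d → ℝ) (n : Fin d → ℂ) : HilbertSpace d →L[ℂ] HilbertSpace d :=
  convolution fun a => -Complex.I * (∑ l, n l * (a l : ℂ)) * (k a : ℂ)

lemma velocityAlong_single (i : Fin d) : velocityAlong k (Pi.single i 1) = velocity k i := by
  unfold velocityAlong velocity
  congr 1
  ext a
  congr 2
  rw [Finset.sum_eq_single i (fun l _ hl => by simp [Pi.single_eq_of_ne hl]) (by simp)]
  simp

section

variable (hk : Summable fun a : Lattice d => (1 + ‖a‖) * |k a|)
include hk

lemma summable_velocity (n : Fin d → ℂ) :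
    Summable fun a : Lattice d => -Complex.I * (∑ l, n l * (a l : ℂ)) * (k a : ℂ) := by
  refine Summable.of_norm_bounded (hk.mul_left (∑ l, ‖n l‖)) fun a => ?_
  rw [norm_mul, norm_mul, norm_neg, Complex.norm_I, one_mul, Complex.norm_real, Real.norm_eq_abs,
    ← mul_assoc]
  refine mul_le_mul_of_nonneg_right ?_ (abs_nonneg _)
  rw [Finset.sum_mul]
  refine (norm_sum_le _ _).trans (Finset.sum_le_sum fun l _ => ?_)
  rw [norm_mul]
  refine mul_le_mul_of_nonneg_left ?_ (norm_nonneg _)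
  have h := norm_le_pi_norm a l
  rw [Int.norm_eq_abs] at h
  rw [Complex.norm_intCast]
  linarith

lemma velocityAlong_add_smul (n m : Fin d → ℂ) (c : ℂ) :
    velocityAlong k (n + c • m) = velocityAlong k n + c • velocityAlong k m := by
  ext1 ψ
  refine (hasSum_convolution_apply (summable_velocity hk _) ψ).unique ?_
  rw [add_apply, smul_apply]
  refine ((hasSum_convolution_apply (summable_velocity hk n) ψ).add
    ((hasSum_convolution_apply (summable_velocity hk m) ψ).const_smul c)).congr_fun fun a => ?_
  rw [smul_smul, ← add_smul]
  congr 1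
  simp only [Pi.add_apply, Pi.smul_apply, smul_eq_mul, add_mul, Finset.sum_add_distrib, mul_assoc,
    ← Finset.mul_sum]
  ring

lemma isCovariant_velocityAlong (n : Fin d → ℂ) :
    IsCovariant fun _ : Environment d => velocityAlong k n :=
  isCovariant_convolution (summable_velocity hk n)

lemma adjoint_velocityAlong (hsymm : ∀ a, k (-a) = k a) (n : Fin d → ℂ) :
    ContinuousLinearMap.adjoint (velocityAlong k n) = velocityAlong k (star n) := by
  refine ContinuousLinearMap.ext fun φ => ext_inner_right ℂ fun ψ => ?_
  rw [ContinuousLinearMap.adjoint_inner_left, velocityAlong,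
    inner_convolution (summable_velocity hk n), velocityAlong]
  congr 3
  ext a
  simp [hsymm, map_sum]

end

variable {ℙ : Measure (Environment d)}
variable (hk : Summable fun a : Lattice d => (1 + ‖a‖) * |k a|) (hsymm : ∀ a, k (-a) = k a)
  (lam : ℝ)

lemma measurable_measure_of_isCovariant
    {X : Environment d → HilbertSpace d →L[ℂ] HilbertSpace d} (hX : IsCovariant X)
    (ψ : HilbertSpace d) :
    Measurable fun V => (isSelfAdjointOp_hamiltonian hk hsymm lam
      V).isPVM_spectralProjection.measure
      (X V ψ) := by
  refine Measure.measurable_of_measurable_coe _ fun B hB => ?_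
  simp_rw [IsPVM.measure_apply _ hB]
  exact ((isCovariant_spectralProjection hk hsymm lam hB).mul hX).measurable_enorm_sq ψ

/-- The averaged spectral measure of the state `X δ₀`. -/
def averageMeasure (ℙ : Measure (Environment d))
    (X : Environment d → HilbertSpace d →L[ℂ] HilbertSpace d) : Measure ℝ :=
  ℙ.bind fun V => (isSelfAdjointOp_hamiltonian hk hsymm lam V).isPVM_spectralProjection.measure
      (X V (site 0))

lemma averageMeasure_apply {X : Environment d → HilbertSpace d →L[ℂ] HilbertSpace d}
    (hX : IsCovariant X) {B : Set ℝ} (hB : MeasurableSet B) :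
    averageMeasure hk hsymm lam ℙ X B
      = ∫⁻ V, ‖(spectralProjection (hamiltonian k lam V) B * X V) (site 0)‖ₑ ^ 2 ∂ℙ := by
  rw [averageMeasure, Measure.bind_apply hB
    (measurable_measure_of_isCovariant hk hsymm lam hX _).aemeasurable]
  simp_rw [IsPVM.measure_apply _ hB]
  rfl

lemma lintegral_averageMeasure {X : Environment d → HilbertSpace d →L[ℂ] HilbertSpace d}
    (hX : IsCovariant X) {η : ℝ} (hη : 0 < η) (E : ℝ) :
    ∫⁻ t, ENNReal.ofReal (approxDelta η (t - E)) ∂(averageMeasure hk hsymm lam ℙ X)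
      = ENNReal.ofReal (η / Real.pi) * ∫⁻ V,
        ‖(resolventOp (hamiltonian k lam V) ((E : ℂ) + η * Complex.I) * X V) (site 0)‖ₑ ^ 2 ∂ℙ := by
  have hm : Measurable fun t => ENNReal.ofReal (approxDelta η (t - E)) :=
    ((measurable_approxDelta η).comp (measurable_id.sub_const E)).ennreal_ofReal
  rw [averageMeasure, Measure.lintegral_bind
    (measurable_measure_of_isCovariant hk hsymm lam hX _).aemeasurable hm.aemeasurable,
    ← lintegral_const_mul _ (((isCovariant_resolvent hk hsymm lam
      (by simpa using hη.ne')).mul hX).measurable_enorm_sq _)]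
  refine lintegral_congr fun V => ?_
  have hi : Integrable (fun t => approxDelta η (t - E))
      ((isSelfAdjointOp_hamiltonian hk hsymm lam V).isPVM_spectralProjection.measure
        (X V (site 0))) := by
    refine Integrable.of_bound ((measurable_approxDelta η).comp
      (measurable_id.sub_const E)).aestronglyMeasurable (Real.pi * η)⁻¹
      (Eventually.of_forall fun t => ?_)
    rw [Real.norm_of_nonneg (approxDelta_nonneg hη.le _)]
    exact approxDelta_le hη _
  rw [← ofReal_integral_eq_lintegral_ofReal hi
    (Eventually.of_forall fun t => approxDelta_nonneg hη.le _),
    ← (isSelfAdjointOp_hamiltonian hk hsymm lam V).norm_resolvent_sq hη,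
    ENNReal.ofReal_mul (by positivity), ENNReal.ofReal_pow (norm_nonneg _), ofReal_norm,
    mul_apply_eq_comp]

include hk hsymm in
lemma adjoint_spectralProjection (V : Environment d) {B : Set ℝ} (hB : MeasurableSet B) :
    ContinuousLinearMap.adjoint (spectralProjection (hamiltonian k lam V) B)
      = spectralProjection (hamiltonian k lam V) B := by
  refine ((ContinuousLinearMap.eq_adjoint_iff _ _).2 fun φ ψ => ?_).symm
  exact (isSelfAdjointOp_hamiltonian hk hsymm lam V).isPVM_spectralProjection.isSymmetric B hB φ ψ

variable (h_stat : ∀ a : Lattice d, MeasurePreserving (translate a) ℙ ℙ)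

/-- `μ` is the spectral correlation measure of the operator `u`:
`μ (A × B) = 𝔼 ‖P_B u* P_A δ₀‖²`. -/
def IsCorrelationMeasure (k : Lattice d → ℝ) (lam : ℝ) (ℙ : Measure (Environment d))
    (u : HilbertSpace d →L[ℂ] HilbertSpace d) (μ : Measure (ℝ × ℝ)) : Prop :=
  ∀ A B, MeasurableSet A → MeasurableSet B → μ (A ×ˢ B) = ∫⁻ V,
    ‖(spectralProjection (hamiltonian k lam V) B * (ContinuousLinearMap.adjoint u *
      spectralProjection (hamiltonian k lam V) A)) (site 0)‖ₑ ^ 2 ∂ℙ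

include hk hsymm h_stat

/-- The two operators are adjoint to each other, so their Hilbert–Schmidt norms per unit volume
agree. This exchanges the roles of A and B, so that the correlation is also an averaged spectral
measure in A. -/
lemma lintegral_projection_mul {u : HilbertSpace d →L[ℂ] HilbertSpace d}
    (hu : IsCovariant fun _ : Environment d => u) {A B : Set ℝ} (hA : MeasurableSet A)
    (hB : MeasurableSet B) :
    ∫⁻ V, ‖(spectralProjection (hamiltonian k lam V) B * (ContinuousLinearMap.adjoint u *
      spectralProjection (hamiltonian k lam V) A)) (site 0)‖ₑ ^ 2 ∂ℙ
    = ∫⁻ V, ‖(spectralProjection (hamiltonian k lam V) A * (u *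
      spectralProjection (hamiltonian k lam V) B)) (site 0)‖ₑ ^ 2 ∂ℙ := by
  have hPA := isCovariant_spectralProjection hk hsymm lam hA
  have hPB := isCovariant_spectralProjection hk hsymm lam hB
  rw [← (hPA.mul (hu.mul hPB)).lintegral_adjoint h_stat]
  refine lintegral_congr fun V => ?_
  have : ContinuousLinearMap.adjoint (spectralProjection (hamiltonian k lam V) A * (u *
      spectralProjection (hamiltonian k lam V) B)) = spectralProjection (hamiltonian k lam V) B *
        (ContinuousLinearMap.adjoint u * spectralProjection (hamiltonian k lam V) A) := by
    simp only [← ContinuousLinearMap.star_eq_adjoint, star_mul]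
    simp only [ContinuousLinearMap.star_eq_adjoint, adjoint_spectralProjection hk hsymm lam V hA,
      adjoint_spectralProjection hk hsymm lam V hB, mul_assoc]
  rw [this]

lemma exists_isCorrelationMeasure [IsProbabilityMeasure ℙ]
    {u : HilbertSpace d →L[ℂ] HilbertSpace d} (hu : IsCovariant fun _ : Environment d => u) :
    ∃ μ : Measure (ℝ × ℝ), IsFiniteMeasure μ ∧ IsCorrelationMeasure k lam ℙ u μ := by
  refine exists_measure_prod_of_bimeasure (b := fun A B => ∫⁻ V,
    ‖(spectralProjection (hamiltonian k lam V) B * (ContinuousLinearMap.adjoint u *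
      spectralProjection (hamiltonian k lam V) A)) (site 0)‖ₑ ^ 2 ∂ℙ) (fun A hA => ?_)
    (fun B hB => ?_) ?_
  · exact ⟨_, fun B hB => averageMeasure_apply hk hsymm lam
      (hu.adjoint.mul (isCovariant_spectralProjection hk hsymm lam hA)) hB⟩
  · refine ⟨averageMeasure hk hsymm lam ℙ fun V =>
      u * spectralProjection (hamiltonian k lam V) B, fun A hA => (averageMeasure_apply hk hsymm lam
      (hu.mul (isCovariant_spectralProjection hk hsymm lam hB)) hA).trans ?_⟩
    exact (lintegral_projection_mul hk hsymm lam h_stat hu hA hB).symm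
  · have hP := isCovariant_spectralProjection hk hsymm lam MeasurableSet.univ
    rw [← (hP.mul (hu.adjoint.mul hP)).ofReal_integral_norm_sq]
    exact ENNReal.ofReal_ne_top

/-- The Poisson integral is taken in one variable at a time. For fixed A, the second variable is
distributed as the averaged spectral measure of u* P_A δ₀, which gives 𝔼‖R u* P_A δ₀‖². Passing to
adjoints, with R normal, this equals 𝔼‖P_A u R δ₀‖², the averaged spectral measure of u R δ₀ in A.
The first variable then supplies the second resolvent. -/
lemma lintegral_approxDelta_correlation {u : HilbertSpace d →L[ℂ] HilbertSpace d}
    (hu : IsCovariant fun _ : Environment d => u) {μ : Measure (ℝ × ℝ)} [IsFiniteMeasure μ]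
    (hμ : IsCorrelationMeasure k lam ℙ u μ) {η : ℝ} (hη : 0 < η) (E : ℝ) :
    ∫⁻ p, ENNReal.ofReal (approxDelta η (p.1 - E)) * ENNReal.ofReal (approxDelta η (p.2 - E)) ∂μ
      = ENNReal.ofReal (η / Real.pi) ^ 2 * ∫⁻ V,
        ‖(resolventOp (hamiltonian k lam V) ((E : ℂ) + η * Complex.I) * (u *
          resolventOp (hamiltonian k lam V) ((E : ℂ) + η * Complex.I))) (site 0)‖ₑ ^ 2 ∂ℙ := by
  set z : ℂ := (E : ℂ) + η * Complex.I with hz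
  have hzim : z.im ≠ 0 := by simpa [hz] using hη.ne'
  have hR := isCovariant_resolvent hk hsymm lam hzim
  set g : ℝ → ℝ≥0∞ := fun t => ENNReal.ofReal (approxDelta η (t - E)) with hg
  have hgm : Measurable g :=
    ((measurable_approxDelta η).comp (measurable_id.sub_const E)).ennreal_ofReal
  have h1 : ∀ A, MeasurableSet A → ∫⁻ p in A ×ˢ Set.univ, g p.2 ∂μ
      = ENNReal.ofReal (η / Real.pi) *
        averageMeasure hk hsymm lam ℙ (fun V => u * resolventOp (hamiltonian k lam V) z) A := by
    intro A hA
    have hPA := isCovariant_spectralProjection hk hsymm lam hA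
    have hX := hu.adjoint.mul hPA
    have e1 : Measure.map Prod.snd (μ.restrict (A ×ˢ Set.univ)) = averageMeasure hk hsymm lam ℙ
        (fun V => ContinuousLinearMap.adjoint u * spectralProjection (hamiltonian k lam V) A) := by
      refine Measure.ext fun B hB => ?_
      rw [Measure.map_apply measurable_snd hB, Measure.restrict_apply (measurable_snd hB),
        averageMeasure_apply hk hsymm lam hX hB, ← hμ A B hA hB]
      congr 1
      ext p
      simp [and_comm]
    rw [← lintegral_map hgm measurable_snd, e1, lintegral_averageMeasure hk hsymm lam hX hη,
      averageMeasure_apply hk hsymm lam (hu.mul hR) hA, ← (hPA.mul (hu.mul hR)).lintegral_adjoint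
        h_stat]
    congr 1
    refine lintegral_congr fun V => ?_
    have hH := isSelfAdjointOp_hamiltonian hk hsymm lam V
    have e2 : ContinuousLinearMap.adjoint (spectralProjection (hamiltonian k lam V) A * (u *
        resolventOp (hamiltonian k lam V) z))
        = ContinuousLinearMap.adjoint (resolventOp (hamiltonian k lam V) z) *
          (ContinuousLinearMap.adjoint u * spectralProjection (hamiltonian k lam V) A) := by
      simp only [← ContinuousLinearMap.star_eq_adjoint, star_mul]
      simp only [ContinuousLinearMap.star_eq_adjoint, adjoint_spectralProjection hk hsymm lam V hA,
        mul_assoc]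
    rw [e2, mul_apply_eq_comp, mul_apply_eq_comp _ (_ * _)]
    rw [hH.enorm_adjoint_resolvent hzim]
  have h2 : Measure.map Prod.fst (μ.withDensity fun p => g p.2) = ENNReal.ofReal (η / Real.pi) •
      averageMeasure hk hsymm lam ℙ (fun V => u * resolventOp (hamiltonian k lam V) z) := by
    refine Measure.ext fun A hA => ?_
    rw [Measure.map_apply measurable_fst hA, withDensity_apply _ (measurable_fst hA),
      Measure.smul_apply, smul_eq_mul, ← h1 A hA, Set.prod_univ]
  have h3 : ∫⁻ p, g p.1 * g p.2 ∂μ = ∫⁻ t, g t ∂(Measure.map Prod.fst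
      (μ.withDensity fun p => g p.2)) := by
    rw [lintegral_map hgm measurable_fst]
    refine Eq.trans ?_ (lintegral_withDensity_eq_lintegral_mul _
      (hgm.comp measurable_snd) (hgm.comp measurable_fst)).symm
    exact lintegral_congr fun p => mul_comm _ _
  rw [h3, h2, lintegral_smul_measure, lintegral_averageMeasure hk hsymm lam (hu.mul hR) hη,
    smul_eq_mul, ← mul_assoc, sq]

end Velocity

/-! ### Polarization of the conductivity measure -/

section ConductivityMeasure

variable {d : ℕ} {k : Lattice d → ℝ} {ℙ : Measure (Environment d)}

/-- The vector `e_i + s e_j`. -/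
def direction (i j : Fin d) (s : ℂ) : Fin d → ℂ := Pi.single i 1 + s • Pi.single j 1

/-- The fourth roots of unity. -/
def phase : Fin 4 → ℂ := ![1, -1, Complex.I, -Complex.I]

lemma star_direction (i j : Fin d) (s : ℂ) :
    star (direction i j s) = direction i j ((starRingEnd ℂ) s) := by
  ext l
  simp [direction, Pi.single_apply, apply_ite (starRingEnd ℂ)]

variable (hk : Summable fun a : Lattice d => (1 + ‖a‖) * |k a|) (hsymm : ∀ a, k (-a) = k a)
  (lam : ℝ) (h_stat : ∀ a : Lattice d, MeasurePreserving (translate a) ℙ ℙ)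

include hk in
lemma velocityAlong_direction (i j : Fin d) (s : ℂ) :
    velocityAlong k (direction i j s) = velocity k i + s • velocity k j := by
  rw [direction, velocityAlong_add_smul hk, velocityAlong_single, velocityAlong_single]

include hk in
lemma isCovariant_velocity (i : Fin d) : IsCovariant fun _ : Environment d => velocity k i := by
  rw [← velocityAlong_single]
  exact isCovariant_velocityAlong hk _

include hk hsymm in
lemma adjoint_velocity (i : Fin d) :
    ContinuousLinearMap.adjoint (velocity k i) = velocity k i := by
  rw [← velocityAlong_single, adjoint_velocityAlong hk hsymm]
  congr 1
  ext l
  simp [Pi.single_apply, apply_ite (starRingEnd ℂ)]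

include hk hsymm h_stat

variable [IsProbabilityMeasure ℙ]

/-- Write P_A = P_A P_A and move one factor to the right end by cyclicity; split P_B = P_B P_B
likewise. The result is a sesquilinear expression in v_i and v_j that polarizes into positive
measures. -/
lemma trace_velocity_eq (i j : Fin d) {A B : Set ℝ} (hA : MeasurableSet A) (hB : MeasurableSet B) :
    (tracePerVolume ℙ fun V => spectralProjection (hamiltonian k lam V) A * velocity k i *
        spectralProjection (hamiltonian k lam V) B * velocity k j)
      = ∫ V, inner ℂ ((spectralProjection (hamiltonian k lam V) B * (velocity k i *
          spectralProjection (hamiltonian k lam V) A)) (site 0))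
        ((spectralProjection (hamiltonian k lam V) B * (velocity k j *
          spectralProjection (hamiltonian k lam V) A)) (site 0)) ∂ℙ := by
  have hPA := isCovariant_spectralProjection hk hsymm lam hA
  have hPB := isCovariant_spectralProjection hk hsymm lam hB
  have hvi := isCovariant_velocity (d := d) hk i
  have hvj := isCovariant_velocity (d := d) hk j
  have hid : ∀ (V : Environment d) {S : Set ℝ}, MeasurableSet S →
      spectralProjection (hamiltonian k lam V) S * spectralProjection (hamiltonian k lam V) S
      = spectralProjection (hamiltonian k lam V) S := fun V S hS =>
    (isSelfAdjointOp_hamiltonian hk hsymm lam V).isPVM_spectralProjection.idempotent S hS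
  have h1 : ∀ V : Environment d, spectralProjection (hamiltonian k lam V) A * velocity k i *
        spectralProjection (hamiltonian k lam V) B * velocity k j
      = spectralProjection (hamiltonian k lam V) A * (spectralProjection (hamiltonian k lam V) A *
        velocity k i * spectralProjection (hamiltonian k lam V) B * velocity k j) := by
    intro V
    simp only [← mul_assoc, hid V hA]
  rw [funext h1]
  rw [IsCovariant.trace_mul_comm h_stat hPA (((hPA.mul hvi).mul hPB).mul hvj)]
  unfold tracePerVolume
  refine integral_congr_ae (Eventually.of_forall fun V => ?_)
  have h2 : spectralProjection (hamiltonian k lam V) A * velocity k i *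
        spectralProjection (hamiltonian k lam V) B * velocity k j *
        spectralProjection (hamiltonian k lam V) A
      = ContinuousLinearMap.adjoint (spectralProjection (hamiltonian k lam V) B *
        (velocity k i * spectralProjection (hamiltonian k lam V) A)) *
        (spectralProjection (hamiltonian k lam V) B * (velocity k j *
          spectralProjection (hamiltonian k lam V) A)) := by
    simp only [← ContinuousLinearMap.star_eq_adjoint, star_mul]
    simp only [ContinuousLinearMap.star_eq_adjoint, adjoint_spectralProjection hk hsymm lam V hA,
      adjoint_spectralProjection hk hsymm lam V hB, adjoint_velocity hk hsymm]
    rw [mul_assoc _ (spectralProjection (hamiltonian k lam V) B) (_ * _),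
      ← mul_assoc (spectralProjection (hamiltonian k lam V) B) (spectralProjection _ B), hid V hB]
    simp only [mul_assoc]
  dsimp only
  rw [h2, mul_apply_eq_comp, ContinuousLinearMap.adjoint_inner_right]

lemma isConductivityMeasure_of_isCorrelationMeasure {i j : Fin d} {μ : Fin 4 → Measure (ℝ × ℝ)}
    (hμ : ∀ l, IsCorrelationMeasure k lam ℙ (velocityAlong k (direction i j (phase l))) (μ l))
    {m : ComplexMeasure (ℝ × ℝ)}
    (hm : ∀ S, MeasurableSet S → m S = ∑ l, phase l / 4 * ((μ l).real S : ℂ)) :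
    IsConductivityMeasure k lam ℙ i j m := by
  intro A B hA hB
  have hPA := isCovariant_spectralProjection hk hsymm lam hA
  have hPB := isCovariant_spectralProjection hk hsymm lam hB
  have hX := hPB.mul ((isCovariant_velocity (d := d) hk i).mul hPA)
  have hY := hPB.mul ((isCovariant_velocity (d := d) hk j).mul hPA)
  -- The correlation measure involves the adjoint of the velocity along e_i + s e_j, which is v_i +
  -- conj(s) v_j; hence the conjugate between c and the phase.
  have h1 : ∀ (c : ℂ) (l : Fin 4), phase l = (starRingEnd ℂ) c →
      ∫ V, ‖(spectralProjection (hamiltonian k lam V) B * (velocity k i *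
          spectralProjection (hamiltonian k lam V) A) +
        c • (spectralProjection (hamiltonian k lam V) B * (velocity k j *
          spectralProjection (hamiltonian k lam V) A))) (site 0)‖ ^ 2 ∂ℙ
      = (μ l).real (A ×ˢ B) := by
    intro c l hc
    rw [measureReal_def, hμ l A B hA hB]
    rw [← ENNReal.toReal_ofReal (integral_nonneg fun V => sq_nonneg _),
      (hX.add (hY.const_smul c)).ofReal_integral_norm_sq]
    congr 1
    refine lintegral_congr fun V => ?_
    congr 4
    rw [adjoint_velocityAlong hk hsymm, star_direction, hc, Complex.conj_conj,
      velocityAlong_direction hk, add_mul, mul_add, smul_mul_assoc, mul_smul_comm]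
  rw [hm _ (hA.prod hB), trace_velocity_eq hk hsymm lam h_stat i j hA hB,
    IsCovariant.integral_inner_eq hX hY, h1 (-1) 1 (by simp [phase]),
    h1 (-Complex.I) 2 (by simp [phase]), h1 Complex.I 3 (by simp [phase])]
  have h2 := h1 1 0 (by simp [phase])
  simp only [one_smul] at h2
  rw [h2]
  simp [Fin.sum_univ_four, phase]
  ring

/-- The conductivity measure is a linear combination of four positive measures. -/
lemma exists_conductivityMeasure_eq (i j : Fin d) : ∃ μ : Fin 4 → Measure (ℝ × ℝ),
    (∀ l, IsFiniteMeasure (μ l)) ∧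
    (∀ l, IsCorrelationMeasure k lam ℙ (velocityAlong k (direction i j (phase l))) (μ l)) ∧
    ∀ S, MeasurableSet S →
      conductivityMeasure k lam ℙ i j S = ∑ l, phase l / 4 * ((μ l).real S : ℂ) := by
  choose μ hfin hμ using fun l : Fin 4 => exists_isCorrelationMeasure hk hsymm lam h_stat
    (isCovariant_velocityAlong (d := d) hk (direction i j (phase l)))
  let m : ComplexMeasure (ℝ × ℝ) := ∑ l, (phase l / 4) •
    (μ l).toSignedMeasure.mapRange Complex.ofRealHom.toAddMonoidHom Complex.continuous_ofReal
  have hm : ∀ S, MeasurableSet S → m S = ∑ l, phase l / 4 * ((μ l).real S : ℂ) := by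
    intro S hS
    simp [m, hS]
  have hc := isConductivityMeasure_of_isCorrelationMeasure hk hsymm lam h_stat hμ hm
  refine ⟨μ, hfin, hμ, fun S hS => ?_⟩
  rw [← hm S hS]
  have hex : ∃ m, IsConductivityMeasure k lam ℙ i j m := ⟨m, hc⟩
  have hc' : IsConductivityMeasure k lam ℙ i j (conductivityMeasure k lam ℙ i j) := by
    rw [conductivityMeasure, dif_pos hex]
    exact hex.choose_spec
  have : conductivityMeasure k lam ℙ i j = m := measure_prod_ext fun A B hA hB => by
    rw [hc' A B hA hB, hc A B hA hB]
  rw [this]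

end ConductivityMeasure

/-! ### The commutator identity for the Green function -/

section Green

variable {d : ℕ} {k : Lattice d → ℝ} {ℙ : Measure (Environment d)}
variable (hk : Summable fun a : Lattice d => (1 + ‖a‖) * |k a|) (hsymm : ∀ a, k (-a) = k a)
  (lam : ℝ)

include hk hsymm in
/-- The multiplication by `n · x` is intertwined with the velocity by the resolvent. -/
lemma resolvent_velocity_resolvent (V : Environment d) {z : ℂ} (hz : z.im ≠ 0) (n : Fin d → ℂ)
    (hmem : Memℓp (fun x : Lattice d => (∑ l, n l * (x l : ℂ)) * green k lam V x 0 z) 2) :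
    (resolventOp (hamiltonian k lam V) z * (velocityAlong k n *
      resolventOp (hamiltonian k lam V) z)) (site 0) = Complex.I • ⟨_, hmem⟩ := by
  have hR := (isSelfAdjointOp_hamiltonian hk hsymm lam V).isResolvent hz
  set R := resolventOp (hamiltonian k lam V) z with hRdef
  obtain ⟨ψ, h1, h2⟩ := hR.exists_domain (site 0)
  have hg : ∀ x, green k lam V x 0 z = (ψ : HilbertSpace d) x := fun x => by
    rw [green, inner_site, ← hRdef, h1]
  let χ : HilbertSpace d := ⟨_, hmem⟩
  have hχ : ∀ x, χ x = (∑ l, n l * (x l : ℂ)) * (ψ : HilbertSpace d) x := fun x => by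
    rw [← hg]
  have hK := summable_hopping hk
  -- With ψ = Rδ₀ and χ = (n·x)ψ, commuting n·x through the hopping gives (H − z)χ = (n·x)δ₀ − i vψ.
  -- The first term vanishes because the weight is zero at the origin, hence χ = −i R v R δ₀.
  have h3 : ∀ x, (z • χ + (-Complex.I) • velocityAlong k n (ψ : HilbertSpace d)) x
      = convolution (fun a => (k a : ℂ)) χ x + ((lam * V x : ℝ) : ℂ) * χ x := by
    intro x
    have e1 := hasSum_convolution_apply_apply (summable_velocity hk n) (ψ : HilbertSpace d) x
    have e2 := hasSum_convolution_apply_apply hK (ψ : HilbertSpace d) x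
    have e3 := hasSum_convolution_apply_apply hK χ x
    have e4 : convolution (fun a => (k a : ℂ)) χ x
        = (∑ l, n l * (x l : ℂ)) * convolution (fun a => (k a : ℂ)) (ψ : HilbertSpace d) x
          - Complex.I * velocityAlong k n (ψ : HilbertSpace d) x := by
      refine e3.unique (((e2.mul_left _).sub (e1.mul_left Complex.I)).congr_fun fun a => ?_)
      rw [hχ]
      have : ∑ l, n l * (((x - a) l : ℤ) : ℂ) = (∑ l, n l * (x l : ℂ)) - ∑ l, n l * (a l : ℂ) := by
        rw [← Finset.sum_sub_distrib]
        refine Finset.sum_congr rfl fun l _ => ?_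
        rw [Pi.sub_apply]; push_cast; ring
      rw [this]
      linear_combination (-(∑ l, n l * (a l : ℂ)) * (k a : ℂ) * (ψ : HilbertSpace d) (x - a)) *
        Complex.I_sq
    have e5 : convolution (fun a => (k a : ℂ)) (ψ : HilbertSpace d) x
        + ((lam * V x : ℝ) : ℂ) * (ψ : HilbertSpace d) x - z * (ψ : HilbertSpace d) x
        = (site 0 : HilbertSpace d) x := by
      have e7 : hamiltonian k lam V ψ x = convolution (fun a => (k a : ℂ)) (ψ : HilbertSpace d) x
          + ((lam * V x : ℝ) : ℂ) * (ψ : HilbertSpace d) x :=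
        vadd_multiplication_apply (U := fun x => lam * V x) ψ x
      rw [← h2, lp.coeFn_sub, Pi.sub_apply, lp.coeFn_smul, Pi.smul_apply, smul_eq_mul, e7]
    have e6 : (∑ l, n l * (x l : ℂ)) * (site 0 : HilbertSpace d) x = 0 := by
      rw [site_apply]
      split_ifs with hx
      · simp [hx]
      · simp
    rw [e4, lp.coeFn_add, Pi.add_apply, lp.coeFn_smul, lp.coeFn_smul, Pi.smul_apply, Pi.smul_apply,
      smul_eq_mul, smul_eq_mul, hχ]
    linear_combination (-(∑ l, n l * (x l : ℂ))) * e5 - e6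
  obtain ⟨hd, he⟩ := exists_domain_of_forall (U := fun x => lam * V x) h3
  have he' : hamiltonian k lam V ⟨χ, hd⟩ = _ := he
  have h4 := hR.apply_eq ⟨χ, hd⟩
  rw [he', add_sub_cancel_left, map_smul] at h4
  rw [mul_apply_eq_comp, mul_apply_eq_comp, h1]
  change _ = Complex.I • χ
  change _ = χ at h4
  rw [← h4, smul_smul]
  simp

end Green

/-! ### Green function sums as Poisson integrals -/

section GreenSum

variable {d : ℕ} {k : Lattice d → ℝ} {ℙ : Measure (Environment d)}

lemma norm_sum_mul_sq_le (n : Fin d → ℂ) (x : Lattice d) :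
    ‖∑ l, n l * (x l : ℂ)‖ ^ 2 ≤ (∑ l, ‖n l‖ ^ 2) * ∑ l, (x l : ℝ) ^ 2 := by
  have h1 : ‖∑ l, n l * (x l : ℂ)‖ ≤ ∑ l, ‖n l‖ * |(x l : ℝ)| := by
    refine (norm_sum_le _ _).trans_eq (Finset.sum_congr rfl fun l _ => ?_)
    rw [norm_mul, Complex.norm_intCast]
  refine (pow_le_pow_left₀ (norm_nonneg _) h1 2).trans ?_
  refine (Finset.sum_mul_sq_le_sq_mul_sq _ _ _).trans_eq ?_
  simp_rw [sq_abs]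

variable (hk : Summable fun a : Lattice d => (1 + ‖a‖) * |k a|) (hsymm : ∀ a, k (-a) = k a)
  (lam : ℝ)
include hk hsymm

lemma green_translate (V : Environment d) {z : ℂ} (hz : z.im ≠ 0) (a x y : Lattice d) :
    green k lam (translate a V) (x + a) (y + a) z = green k lam V x y z := by
  rw [green, green, ← shift_site, ← shift_site, resolvent_hamiltonian_translate hk hsymm lam V hz,
    inner_shift_shift]

lemma measurable_green {z : ℂ} (hz : z.im ≠ 0) (x y : Lattice d) :
    Measurable fun V : Environment d => green k lam V x y z :=
  (isCovariant_resolvent hk hsymm lam hz).measurable (site x) (site y)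

lemma lintegral_green_neg (h_stat : ∀ a : Lattice d, MeasurePreserving (translate a) ℙ ℙ)
    {z : ℂ} (hz : z.im ≠ 0) (x : Lattice d) :
    ∫⁻ V, ‖green k lam V (-x) 0 z‖ₑ ^ 2 ∂ℙ = ∫⁻ V, ‖green k lam V 0 x z‖ₑ ^ 2 ∂ℙ := by
  rw [← (h_stat x).lintegral_comp ((measurable_green hk hsymm lam hz 0 x).enorm.pow_const 2)]
  refine lintegral_congr fun V => ?_
  rw [← green_translate hk hsymm lam V hz x (-x) 0, neg_add_cancel, zero_add]

/-- Finiteness of the averaged second moment puts (n·x) G(x,0) in ℓ² for almost every environment,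
and there the commutator identity applies. Stationarity and the reflection x ↦ −x replace G(x,0) by
G(0,x), the weights being even. -/
lemma lintegral_resolvent_velocity
    (h_stat : ∀ a : Lattice d, MeasurePreserving (translate a) ℙ ℙ) {η : ℝ} (hη : 0 < η) (E : ℝ)
    (hfin : greenSecondMoment k lam ℙ E η ≠ ∞) (n : Fin d → ℂ) :
    ∫⁻ V, ‖(resolventOp (hamiltonian k lam V) ((E : ℂ) + η * Complex.I) * (velocityAlong k n *
        resolventOp (hamiltonian k lam V) ((E : ℂ) + η * Complex.I))) (site 0)‖ₑ ^ 2 ∂ℙ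
      = ∑' x : Lattice d, ENNReal.ofReal (‖∑ l, n l * (x l : ℂ)‖ ^ 2) *
        ∫⁻ V, ‖green k lam V 0 x ((E : ℂ) + η * Complex.I)‖ₑ ^ 2 ∂ℙ := by
  set z : ℂ := (E : ℂ) + η * Complex.I with hz
  have hzim : z.im ≠ 0 := by simpa [hz] using hη.ne'
  have hgm : ∀ x, Measurable fun V : Environment d => ‖green k lam V x 0 z‖ₑ ^ 2 := fun x =>
    (measurable_green hk hsymm lam hzim x 0).enorm.pow_const 2
  have hsum : ∀ w : Lattice d → ℝ, (∀ x, w (-x) = w x) →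
      ∑' x, ENNReal.ofReal (w x) * ∫⁻ V, ‖green k lam V 0 x z‖ₑ ^ 2 ∂ℙ
      = ∫⁻ V, ∑' x, ENNReal.ofReal (w x) * ‖green k lam V x 0 z‖ₑ ^ 2 ∂ℙ := by
    intro w hw
    rw [lintegral_tsum fun x => ((hgm x).const_mul _).aemeasurable, ← (Equiv.neg _).tsum_eq]
    refine tsum_congr fun x => ?_
    rw [lintegral_const_mul _ (hgm x), Equiv.neg_apply, hw,
      ← lintegral_green_neg hk hsymm lam h_stat hzim, neg_neg]
  have hfin2 : ∫⁻ V, ∑' x : Lattice d, ENNReal.ofReal (∑ l, (x l : ℝ) ^ 2) *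
      ‖green k lam V x 0 z‖ₑ ^ 2 ∂ℙ ≠ ∞ := by
    rw [← hsum _ fun x => by simp]
    intro h
    apply hfin
    rw [greenSecondMoment, h, ENNReal.mul_top]
    rw [Ne, ENNReal.ofReal_eq_zero, not_le]
    positivity
  rw [hsum _ fun x => by simp]
  refine lintegral_congr_ae ?_
  have hae := ae_lt_top (Measurable.tsum fun x => (hgm x).const_mul _) hfin2
  filter_upwards [hae] with V hV
  have hmem : Memℓp (fun x : Lattice d => (∑ l, n l * (x l : ℂ)) * green k lam V x 0 z) 2 := by
    refine memℓp_gen ?_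
    have h1 := ENNReal.summable_toReal hV.ne
    refine Summable.of_nonneg_of_le (fun x => by positivity) (fun x => ?_)
      (h1.mul_left (∑ l, ‖n l‖ ^ 2))
    simp only [ENNReal.toReal_ofNat, Real.rpow_ofNat, ENNReal.toReal_mul, ENNReal.toReal_pow,
      toReal_enorm]
    rw [ENNReal.toReal_ofReal (by positivity), norm_mul, mul_pow, ← mul_assoc]
    exact mul_le_mul_of_nonneg_right (norm_sum_mul_sq_le n x) (sq_nonneg _)
  let χ : HilbertSpace d := ⟨_, hmem⟩
  have e1 := resolvent_velocity_resolvent hk hsymm lam V hzim n hmem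
  change _ = Complex.I • χ at e1
  have e2 : ‖Complex.I • χ‖ₑ = ‖χ‖ₑ := by
    rw [← ofReal_norm, ← ofReal_norm, norm_smul, Complex.norm_I, one_mul]
  rw [e1, e2, IsCovariant.enorm_sq_eq_tsum]
  refine tsum_congr fun x => ?_
  have e3 : χ x = (∑ l, n l * (x l : ℂ)) * green k lam V x 0 z := rfl
  rw [e3, enorm_mul, mul_pow, ENNReal.ofReal_pow (norm_nonneg _), ofReal_norm]

variable [IsProbabilityMeasure ℙ]

lemma ofReal_integral_green {z : ℂ} (hz : z.im ≠ 0) (x : Lattice d) :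
    ENNReal.ofReal (∫ V, ‖green k lam V 0 x z‖ ^ 2 ∂ℙ)
      = ∫⁻ V, ‖green k lam V 0 x z‖ₑ ^ 2 ∂ℙ := by
  have hm := measurable_green hk hsymm lam hz 0 x
  have hi : Integrable (fun V => ‖green k lam V 0 x z‖ ^ 2) ℙ := by
    refine Integrable.of_bound (hm.norm.pow_const 2).aestronglyMeasurable (|z.im|⁻¹ ^ 2)
      (Eventually.of_forall fun V => ?_)
    rw [norm_pow, norm_norm]
    refine pow_le_pow_left₀ (norm_nonneg _) ?_ 2
    refine (norm_inner_le_norm _ _).trans ?_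
    rw [norm_site, one_mul]
    refine ((isSelfAdjointOp_hamiltonian hk hsymm lam V).norm_resolvent_le hz _).trans_eq ?_
    rw [norm_site, mul_one]
  rw [ofReal_integral_eq_lintegral_ofReal hi (Eventually.of_forall fun V => sq_nonneg _)]
  simp [ENNReal.ofReal_pow]

/-- The Green function sum in terms of the correlation measure. -/
lemma hasSum_integral_correlation
    (h_stat : ∀ a : Lattice d, MeasurePreserving (translate a) ℙ ℙ) {C : ℝ≥0}
    (h_bound : ∀ E η : ℝ, 0 < η → greenSecondMoment k lam ℙ E η ≤ C) {n : Fin d → ℂ}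
    {μ : Measure (ℝ × ℝ)} [IsFiniteMeasure μ]
    (hμ : IsCorrelationMeasure k lam ℙ (velocityAlong k n) μ) {η : ℝ} (hη : 0 < η) (E : ℝ) :
    HasSum (fun x : Lattice d => (η / Real.pi) ^ 2 * (‖∑ l, n l * (x l : ℂ)‖ ^ 2 *
        ∫ V, ‖green k lam V 0 x ((E : ℂ) + η * Complex.I)‖ ^ 2 ∂ℙ))
      (∫ p, approxDelta η (p.1 - E) * approxDelta η (p.2 - E) ∂μ) ∧
    ∫ p, approxDelta η (p.1 - E) * approxDelta η (p.2 - E) ∂μ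
      ≤ (∑ l, ‖n l‖ ^ 2) * C / Real.pi ^ 2 := by
  set z : ℂ := (E : ℂ) + η * Complex.I with hz
  have hzim : z.im ≠ 0 := by simpa [hz] using hη.ne'
  have hfin : greenSecondMoment k lam ℙ E η ≠ ∞ :=
    ne_top_of_le_ne_top ENNReal.coe_ne_top (h_bound E η hη)
  have h1 := lintegral_approxDelta_correlation hk hsymm lam h_stat
    (isCovariant_velocityAlong (d := d) hk n) hμ hη E
  rw [← hz, lintegral_resolvent_velocity hk hsymm lam h_stat hη E hfin n, ← hz,
    ← ENNReal.tsum_mul_left] at h1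
  have hm : Measurable fun p : ℝ × ℝ => approxDelta η (p.1 - E) * approxDelta η (p.2 - E) :=
    ((measurable_approxDelta η).comp (measurable_fst.sub_const E)).mul
      ((measurable_approxDelta η).comp (measurable_snd.sub_const E))
  have hnn : ∀ p : ℝ × ℝ, 0 ≤ approxDelta η (p.1 - E) * approxDelta η (p.2 - E) := fun p =>
    mul_nonneg (approxDelta_nonneg hη.le _) (approxDelta_nonneg hη.le _)
  have h2 : ∫ p, approxDelta η (p.1 - E) * approxDelta η (p.2 - E) ∂μ
      = (∑' x : Lattice d, ENNReal.ofReal (η / Real.pi) ^ 2 *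
          (ENNReal.ofReal (‖∑ l, n l * (x l : ℂ)‖ ^ 2) *
          ∫⁻ V, ‖green k lam V 0 x z‖ₑ ^ 2 ∂ℙ)).toReal := by
    rw [integral_eq_lintegral_of_nonneg_ae (Eventually.of_forall hnn) hm.aestronglyMeasurable, ← h1]
    congr 1
    exact lintegral_congr fun p => ENNReal.ofReal_mul (approxDelta_nonneg hη.le _)
  have hterm : ∀ x : Lattice d, ENNReal.ofReal (η / Real.pi) ^ 2 *
          (ENNReal.ofReal (‖∑ l, n l * (x l : ℂ)‖ ^ 2) *
          ∫⁻ V, ‖green k lam V 0 x z‖ₑ ^ 2 ∂ℙ)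
      = ENNReal.ofReal ((η / Real.pi) ^ 2 * (‖∑ l, n l * (x l : ℂ)‖ ^ 2 *
        ∫ V, ‖green k lam V 0 x z‖ ^ 2 ∂ℙ)) := by
    intro x
    rw [ENNReal.ofReal_mul (by positivity), ENNReal.ofReal_mul (by positivity),
      ofReal_integral_green hk hsymm lam hzim, ENNReal.ofReal_pow (norm_nonneg _),
      ENNReal.ofReal_pow (by positivity : 0 ≤ η / Real.pi)]
  -- Cauchy–Schwarz, |n·x|² ≤ |n|² x², reduces every direction to the assumed second moment bound;
  -- the factor 1/π² comes from the two Poisson kernels.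
  have hle : ∑' x : Lattice d, ENNReal.ofReal (η / Real.pi) ^ 2 *
          (ENNReal.ofReal (‖∑ l, n l * (x l : ℂ)‖ ^ 2) *
          ∫⁻ V, ‖green k lam V 0 x z‖ₑ ^ 2 ∂ℙ)
      ≤ ENNReal.ofReal ((∑ l, ‖n l‖ ^ 2) * C / Real.pi ^ 2) := by
    have hN : 0 ≤ ∑ l, ‖n l‖ ^ 2 := Finset.sum_nonneg fun l _ => sq_nonneg _
    have hle1 : ∀ x : Lattice d, ENNReal.ofReal (η / Real.pi) ^ 2 *
          (ENNReal.ofReal (‖∑ l, n l * (x l : ℂ)‖ ^ 2) *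
          ∫⁻ V, ‖green k lam V 0 x z‖ₑ ^ 2 ∂ℙ)
        ≤ ENNReal.ofReal ((∑ l, ‖n l‖ ^ 2) / Real.pi ^ 2) * (ENNReal.ofReal (η ^ 2) *
          (ENNReal.ofReal (∑ l, (x l : ℝ) ^ 2) * ∫⁻ V, ‖green k lam V 0 x z‖ₑ ^ 2 ∂ℙ)) := by
      intro x
      rw [← mul_assoc, ← mul_assoc, ← mul_assoc]
      refine mul_le_mul' ?_ le_rfl
      rw [← ENNReal.ofReal_pow (by positivity), ← ENNReal.ofReal_mul (by positivity),
        ← ENNReal.ofReal_mul (by positivity), ← ENNReal.ofReal_mul (by positivity)]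
      refine ENNReal.ofReal_le_ofReal ?_
      calc (η / Real.pi) ^ 2 * ‖∑ l, n l * (x l : ℂ)‖ ^ 2
          ≤ (η / Real.pi) ^ 2 * ((∑ l, ‖n l‖ ^ 2) * ∑ l, (x l : ℝ) ^ 2) := by
            gcongr
            exact norm_sum_mul_sq_le n x
        _ = _ := by ring
    refine (ENNReal.tsum_le_tsum hle1).trans ?_
    rw [ENNReal.tsum_mul_left, ENNReal.tsum_mul_left]
    have hb := h_bound E η hη
    rw [greenSecondMoment] at hb
    refine (mul_le_mul' le_rfl hb).trans_eq ?_
    rw [← ENNReal.ofReal_coe_nnreal, ← ENNReal.ofReal_mul (by positivity), div_mul_eq_mul_div]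
  have hne := ne_top_of_le_ne_top ENNReal.ofReal_ne_top hle
  constructor
  · rw [h2]
    simp_rw [hterm] at hne ⊢
    have hs := ENNReal.summable_toReal hne
    rw [ENNReal.tsum_toReal_eq fun x => ENNReal.ofReal_ne_top]
    refine hs.hasSum.congr_fun fun x => ?_
    rw [ENNReal.toReal_ofReal]
    have : 0 ≤ ∫ V, ‖green k lam V 0 x z‖ ^ 2 ∂ℙ := integral_nonneg fun V => sq_nonneg _
    positivity
  · rw [h2]
    exact ENNReal.toReal_le_of_le_ofReal (by positivity) hle

/-- The coefficients that polarize the conductivity measure also polarize the weights: ∑ (s/4) |x_i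
+ s x_j|² = x_i x_j over the fourth roots of unity s. -/
lemma greenConductivity_eq (h_stat : ∀ a : Lattice d, MeasurePreserving (translate a) ℙ ℙ)
    {C : ℝ≥0} (h_bound : ∀ E η : ℝ, 0 < η → greenSecondMoment k lam ℙ E η ≤ C) {i j : Fin d}
    {μ : Fin 4 → Measure (ℝ × ℝ)} [∀ l, IsFiniteMeasure (μ l)]
    (hμ : ∀ l, IsCorrelationMeasure k lam ℙ (velocityAlong k (direction i j (phase l))) (μ l))
    {η : ℝ} (hη : 0 < η) (E : ℝ) :
    (greenConductivity k lam ℙ i j E η : ℂ) = Real.pi * ∑ l, phase l / 4 *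
      ((∫ p, approxDelta η (p.1 - E) * approxDelta η (p.2 - E) ∂(μ l) : ℝ) : ℂ) := by
  set z : ℂ := (E : ℂ) + η * Complex.I with hz
  have h1 : ∀ l, HasSum (fun x : Lattice d => phase l / 4 * (((η / Real.pi) ^ 2 *
      (‖∑ m, direction i j (phase l) m * (x m : ℂ)‖ ^ 2 *
        ∫ V, ‖green k lam V 0 x z‖ ^ 2 ∂ℙ) : ℝ) : ℂ))
      (phase l / 4 *
        ((∫ p, approxDelta η (p.1 - E) * approxDelta η (p.2 - E) ∂(μ l) : ℝ) : ℂ)) := fun l =>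
    (Complex.hasSum_ofReal.2
      (hasSum_integral_correlation hk hsymm lam h_stat h_bound (hμ l) hη E).1).mul_left _
  have h2 := (hasSum_sum fun l (_ : l ∈ Finset.univ) => h1 l).mul_left (Real.pi : ℂ)
  have h3 : ∀ (x : Lattice d) (s : ℂ), ∑ m, direction i j s m * (x m : ℂ)
      = (x i : ℂ) + s * (x j : ℂ) := by
    intro x s
    simp [direction, add_mul, Finset.sum_add_distrib, Pi.single_apply]
  have h4 : ∀ x : Lattice d, ∑ l, phase l / 4 *
      ((‖∑ m, direction i j (phase l) m * (x m : ℂ)‖ ^ 2 : ℝ) : ℂ) = (x i : ℂ) * (x j : ℂ) := by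
    intro x
    simp only [h3, Complex.ofReal_pow, ← Complex.mul_conj', Fin.sum_univ_four, phase]
    simp
    ring
  have h5 : HasSum (fun x : Lattice d => ((η ^ 2 / Real.pi * ((x i : ℝ) * (x j : ℝ) *
      ∫ V, ‖green k lam V 0 x z‖ ^ 2 ∂ℙ) : ℝ) : ℂ)) (Real.pi * ∑ l, phase l / 4 *
      ((∫ p, approxDelta η (p.1 - E) * approxDelta η (p.2 - E) ∂(μ l) : ℝ) : ℂ)) := by
    refine h2.congr_fun fun x => ?_
    have hpi : (Real.pi : ℂ) ≠ 0 := Complex.ofReal_ne_zero.2 Real.pi_ne_zero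
    have h6 := h4 x
    have h7 : ∀ l, phase l / 4 * (((η / Real.pi) ^ 2 *
        (‖∑ m, direction i j (phase l) m * (x m : ℂ)‖ ^ 2 *
        ∫ V, ‖green k lam V 0 x z‖ ^ 2 ∂ℙ) : ℝ) : ℂ)
        = (phase l / 4 * ((‖∑ m, direction i j (phase l) m * (x m : ℂ)‖ ^ 2 : ℝ) : ℂ)) *
          (((η / Real.pi) ^ 2 * ∫ V, ‖green k lam V 0 x z‖ ^ 2 ∂ℙ : ℝ) : ℂ) := fun l => by
      push_cast; ring
    simp_rw [h7]
    rw [← Finset.sum_mul, h6]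
    push_cast
    field_simp
  rw [← h5.tsum_eq, ← Complex.ofReal_tsum, greenConductivity, tsum_mul_left]

end GreenSum

/-! ### The Poisson semigroup and the comparison of kernels -/

section Kernel

lemma tendsto_div_sq_add_one {l : Filter ℝ} (hl : l ≤ Bornology.cobounded ℝ) :
    Tendsto (fun x : ℝ => x / (x ^ 2 + 1)) l (𝓝 0) := by
  have h1 : Tendsto (fun x : ℝ => x⁻¹) l (𝓝 0) := (tendsto_inv₀_cobounded (α := ℝ)).mono_left hl
  refine squeeze_zero_norm (fun x => ?_) (by simpa using h1.norm)
  rw [norm_div, Real.norm_eq_abs, Real.norm_of_nonneg (by positivity)]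
  rcases eq_or_ne x 0 with rfl | hx
  · simp
  · rw [div_le_iff₀ (by positivity), ← sq_abs, mul_add, sq, ← mul_assoc,
      inv_mul_cancel₀ (abs_ne_zero.2 hx)]
    have : 0 ≤ |x|⁻¹ := by positivity
    linarith

lemma tendsto_log_ratio (a : ℝ) {l : Filter ℝ} (hl : l ≤ Bornology.cobounded ℝ) :
    Tendsto (fun x : ℝ => Real.log ((x + a) ^ 2 + 1) - Real.log (x ^ 2 + 1)) l (𝓝 0) := by
  have h1 : Tendsto (fun x : ℝ => x⁻¹) l (𝓝 0) := (tendsto_inv₀_cobounded (α := ℝ)).mono_left hl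
  have h2 := tendsto_div_sq_add_one hl
  have h3 : Tendsto (fun x : ℝ => (x ^ 2 + 1)⁻¹) l (𝓝 0) := by
    have := h1.mul h2
    rw [zero_mul] at this
    refine this.congr' ?_
    filter_upwards [hl (Bornology.eventually_ne_cobounded (0 : ℝ))] with x hx
    have hx' : x ≠ 0 := hx
    field_simp
  have h4 : Tendsto (fun x : ℝ => 1 + (2 * a * (x / (x ^ 2 + 1)) + a ^ 2 * (x ^ 2 + 1)⁻¹)) l
      (𝓝 1) := by
    simpa using ((h2.const_mul (2 * a)).add (h3.const_mul (a ^ 2))).const_add 1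
  have h5 := (Real.continuousAt_log one_ne_zero).tendsto.comp h4
  rw [Real.log_one] at h5
  refine h5.congr fun x => ?_
  have hx : (x ^ 2 + 1) ≠ 0 := by positivity
  rw [Function.comp_apply, ← Real.log_div (by positivity) hx]
  congr 1
  field_simp
  ring

/-- An explicit antiderivative by partial fractions. The logarithms cancel at infinity and the
arctangents give the value; at a = 0 the double poles require a separate antiderivative. -/
lemma integral_inv_mul_inv (a : ℝ) :
    ∫ x : ℝ, ((x + a) ^ 2 + 1)⁻¹ * (x ^ 2 + 1)⁻¹ = 2 * Real.pi / (a ^ 2 + 4) := by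
  have hpos : ∀ x : ℝ, x ^ 2 + 1 ≠ 0 := fun x => by positivity
  have hint : Integrable fun x : ℝ => ((x + a) ^ 2 + 1)⁻¹ * (x ^ 2 + 1)⁻¹ := by
    have h := integrable_inv_one_add_sq.bdd_mul (c := 1) (f := fun x : ℝ => ((x + a) ^ 2 + 1)⁻¹)
      (((continuous_id.add continuous_const).pow 2).add continuous_const |>.inv₀
        fun x => hpos _).aestronglyMeasurable (Eventually.of_forall fun x => by
          rw [norm_inv, Real.norm_of_nonneg (by positivity)]
          exact inv_le_one_of_one_le₀ (by nlinarith [sq_nonneg (x + a)]))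
    simpa only [add_comm (1 : ℝ)] using h
  have hcob : atTop ≤ Bornology.cobounded ℝ := by
    rw [IsOrderBornology.cobounded_eq]; exact le_sup_right
  have hcob' : atBot ≤ Bornology.cobounded ℝ := by
    rw [IsOrderBornology.cobounded_eq]; exact le_sup_left
  have hat : Tendsto Real.arctan atTop (𝓝 (Real.pi / 2)) :=
    Real.tendsto_arctan_atTop.mono_right nhdsWithin_le_nhds
  have hab : Tendsto Real.arctan atBot (𝓝 (-(Real.pi / 2))) :=
    Real.tendsto_arctan_atBot.mono_right nhdsWithin_le_nhds
  have hsq : ∀ x c : ℝ, HasDerivAt (fun x : ℝ => (x + c) ^ 2 + 1) (2 * (x + c)) x := by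
    intro x c
    simpa using (((hasDerivAt_id x).add_const c).pow 2).add_const 1
  rcases eq_or_ne a 0 with rfl | ha
  · have hd : ∀ x : ℝ, HasDerivAt (fun x : ℝ => (x / (x ^ 2 + 1) + Real.arctan x) / 2)
        (((x + 0) ^ 2 + 1)⁻¹ * (x ^ 2 + 1)⁻¹) x := by
      intro x
      have h1 : HasDerivAt (fun x : ℝ => x ^ 2 + 1) (2 * x) x := by simpa using hsq x 0
      have h2 := (((hasDerivAt_id x).div h1 (hpos x)).add (Real.hasDerivAt_arctan x)).div_const 2
      refine h2.congr_deriv ?_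
      have := hpos x
      have h3 : 1 + x ^ 2 ≠ 0 := by rwa [add_comm]
      simp only [id_eq, add_zero]
      field_simp
      ring
    rw [integral_of_hasDerivAt_of_tendsto hd hint
      (((tendsto_div_sq_add_one hcob').add hab).div_const 2)
      (((tendsto_div_sq_add_one hcob).add hat).div_const 2)]
    ring
  · have hd : ∀ x : ℝ, HasDerivAt (fun x : ℝ => (a ^ 2 + 4)⁻¹ * (a⁻¹ *
        (Real.log ((x + a) ^ 2 + 1) - Real.log (x ^ 2 + 1))
        + (Real.arctan (x + a) + Real.arctan x)))
        (((x + a) ^ 2 + 1)⁻¹ * (x ^ 2 + 1)⁻¹) x := by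
      intro x
      have h1 := (hsq x a).log (hpos _)
      have h2 : HasDerivAt (fun x : ℝ => Real.log (x ^ 2 + 1)) (2 * x / (x ^ 2 + 1)) x := by
        simpa using (hsq x 0).log (hpos _)
      have h3 : HasDerivAt (fun x : ℝ => Real.arctan (x + a)) (1 / (1 + (x + a) ^ 2)) x := by
        simpa using ((hasDerivAt_id x).add_const a).arctan
      refine ((((h1.sub h2).const_mul a⁻¹).add
        (h3.add (Real.hasDerivAt_arctan x))).const_mul (a ^ 2 + 4)⁻¹).congr_deriv ?_
      have e1 := hpos x
      have e2 := hpos (x + a)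
      have e3 : 1 + x ^ 2 ≠ 0 := by rwa [add_comm]
      have e4 : 1 + (x + a) ^ 2 ≠ 0 := by rwa [add_comm]
      have e5 : a ^ 2 + 4 ≠ 0 := by positivity
      field_simp
      ring
    have hat' := hat.comp (tendsto_atTop_add_const_right atTop a tendsto_id)
    have hab' := hab.comp (tendsto_atBot_add_const_right atBot a tendsto_id)
    rw [integral_of_hasDerivAt_of_tendsto hd hint
      ((((tendsto_log_ratio a hcob').const_mul _).add (hab'.add hab)).const_mul _)
      ((((tendsto_log_ratio a hcob).const_mul _).add (hat'.add hat)).const_mul _)]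
    field_simp
    ring

/-- The semigroup property of the Poisson kernel. -/
lemma integral_approxDelta_mul_approxDelta {η : ℝ} (hη : 0 < η) (s t : ℝ) :
    ∫ E, approxDelta η (s - E) * approxDelta η (t - E) = approxDelta (2 * η) (s - t) := by
  rw [integral_mul_approxDelta hη fun E => approxDelta η (s - E)]
  have h1 : ∀ u, approxDelta η (s - (t - η * u)) * approxDelta 1 u
      = η⁻¹ * Real.pi⁻¹ ^ 2 * (((u + (s - t) / η) ^ 2 + 1)⁻¹ * (u ^ 2 + 1)⁻¹) := by
    intro u
    have : s - (t - η * u) = η * (u + (s - t) / η) := by field_simp; ring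
    rw [this, approxDelta_mul hη, approxDelta_one, approxDelta_one, add_comm (1 : ℝ),
      add_comm (1 : ℝ)]
    ring
  simp_rw [h1]
  rw [integral_const_mul, integral_inv_mul_inv, approxDelta]
  have : (s - t) ^ 2 + (2 * η) ^ 2 ≠ 0 := by positivity
  have h2 : ((s - t) / η) ^ 2 + 4 ≠ 0 := by positivity
  field_simp
  ring

variable {μ : Measure (ℝ × ℝ)} [IsFiniteMeasure μ]

lemma integrable_mul_approxDelta_prod {η : ℝ} (hη : 0 < η) {v : ℝ → ℝ} (hv : Measurable v) {b : ℝ}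
    (hb : ∀ E, ‖v E‖ ≤ b) :
    Integrable (fun q : (ℝ × ℝ) × ℝ => v q.2 * (approxDelta η (q.1.1 - q.2) *
      approxDelta η (q.1.2 - q.2))) (μ.prod volume) := by
  have hm := measurable_approxDelta η
  have h1 : Integrable (fun q : (ℝ × ℝ) × ℝ => approxDelta η (q.1.2 - q.2)) (μ.prod volume) := by
    have hm' : Measurable fun q : (ℝ × ℝ) × ℝ => approxDelta η (q.1.2 - q.2) :=
      hm.comp (by fun_prop)
    rw [integrable_prod_iff hm'.aestronglyMeasurable]
    constructor
    · exact Eventually.of_forall fun p => (integrable_approxDelta hη).comp_sub_left p.2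
    · have : (fun p : ℝ × ℝ => ∫ E, ‖approxDelta η (p.2 - E)‖) = fun _ => (1 : ℝ) := by
        ext p
        simp_rw [Real.norm_of_nonneg (approxDelta_nonneg hη.le _)]
        rw [integral_sub_left_eq_self (approxDelta η), integral_approxDelta hη]
      rw [this]
      exact integrable_const _
  have hb0 : 0 ≤ b := (norm_nonneg _).trans (hb 0)
  have h2 := h1.bdd_mul (c := b * (Real.pi * η)⁻¹)
    (f := fun q : (ℝ × ℝ) × ℝ => v q.2 * approxDelta η (q.1.1 - q.2))
    ((hv.comp measurable_snd).mul (hm.comp (by fun_prop))).aestronglyMeasurable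
    (Eventually.of_forall fun q => by
      rw [norm_mul, Real.norm_of_nonneg (approxDelta_nonneg hη.le _)]
      exact mul_le_mul (hb _) (approxDelta_le hη _) (approxDelta_nonneg hη.le _) hb0)
  simpa only [mul_assoc] using h2

lemma integral_integral_approxDelta {η : ℝ} (hη : 0 < η) {v : ℝ → ℝ} (hv : Measurable v) {b : ℝ}
    (hb : ∀ E, ‖v E‖ ≤ b) :
    ∫ p, (∫ E, v E * (approxDelta η (p.1 - E) * approxDelta η (p.2 - E))) ∂μ
      = ∫ E, v E * ∫ p, approxDelta η (p.1 - E) * approxDelta η (p.2 - E) ∂μ := by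
  rw [integral_integral_swap (integrable_mul_approxDelta_prod hη hv hb)]
  simp_rw [integral_const_mul]

/-- The mean value theorem, with c = s on the diagonal. Since c lies between s and t, its distance
to any E is at most the larger of theirs. -/
lemma dslope_eq_deriv {f g : ℝ → ℝ} (hf : ∀ x, HasDerivAt f (g x) x) (s t : ℝ) :
    ∃ c, dslope f s t = g c ∧ ∀ E, (c - E) ^ 2 ≤ (s - E) ^ 2 + (t - E) ^ 2 := by
  have hcont : Continuous f := continuous_iff_continuousAt.2 fun x => (hf x).continuousAt
  rcases lt_trichotomy s t with h | rfl | h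
  · obtain ⟨c, hc, he⟩ := exists_hasDerivAt_eq_slope f g h hcont.continuousOn fun x _ => hf x
    refine ⟨c, ?_, fun E => ?_⟩
    · rw [dslope_of_ne _ h.ne', slope_def_field, he]
    · rcases le_total c E with hE | hE <;> nlinarith [hc.1, hc.2, sq_nonneg (s - E),
      sq_nonneg (t - E)]
  · exact ⟨s, by rw [dslope_same, (hf s).deriv], fun E => by nlinarith [sq_nonneg (s - E)]⟩
  · obtain ⟨c, hc, he⟩ := exists_hasDerivAt_eq_slope f g h hcont.continuousOn fun x _ => hf x
    refine ⟨c, ?_, fun E => ?_⟩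
    · rw [dslope_of_ne _ h.ne, slope_comm, slope_def_field, he]
    · rcases le_total c E with hE | hE <;> nlinarith [hc.1, hc.2, sq_nonneg (s - E),
      sq_nonneg (t - E)]

lemma measurable_dslope {f g : ℝ → ℝ} (hf : ∀ x, HasDerivAt f (g x) x) (hg : Measurable g) :
    Measurable fun p : ℝ × ℝ => dslope f p.2 p.1 := by
  have hcont : Continuous f := continuous_iff_continuousAt.2 fun x => (hf x).continuousAt
  have h : (fun p : ℝ × ℝ => dslope f p.2 p.1)
      = fun p : ℝ × ℝ => if p.1 = p.2 then g p.2 else (f p.1 - f p.2) / (p.1 - p.2) := by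
    ext p
    split_ifs with h
    · rw [h, dslope_same, (hf _).deriv]
    · rw [dslope_of_ne _ h, slope_def_field]
  rw [h]
  refine Measurable.ite (measurableSet_eq_fun measurable_fst measurable_snd)
    (hg.comp measurable_snd) ?_
  exact ((hcont.measurable.comp measurable_fst).sub (hcont.measurable.comp measurable_snd)).div
    (measurable_fst.sub measurable_snd)

/-- Comparison of the two kernels. -/
lemma norm_kernel_sub_le {f g : ℝ → ℝ} (hf : ∀ x, HasDerivAt f (g x) x) (hg : Measurable g)
    {A κ C : ℝ} (hA : ∀ x, |g x| ≤ A) (hC : 0 ≤ C)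
    (hclose : ∀ c E, |g c - g E| ≤ (κ + C * (c - E) ^ 2) * (1 + E ^ 2)⁻¹)
    {η : ℝ} (hη : 0 < η) (p : ℝ × ℝ) :
    ‖approxDelta (2 * η) (p.1 - p.2) * dslope f p.2 p.1
      - ∫ E, g E * (approxDelta η (p.1 - E) * approxDelta η (p.2 - E))‖
    ≤ κ * (∫ E, (1 + E ^ 2)⁻¹ * (approxDelta η (p.1 - E) * approxDelta η (p.2 - E)))
      + 2 * C * (η / Real.pi) := by
  obtain ⟨c, hc, hcE⟩ := dslope_eq_deriv hf p.2 p.1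
  have hm := measurable_approxDelta η
  have hδi : ∀ t, Integrable fun E => approxDelta η (t - E) := fun t =>
    (integrable_approxDelta hη).comp_sub_left t
  have hi : ∀ {v : ℝ → ℝ} {b : ℝ}, Measurable v → (∀ E, ‖v E‖ ≤ b) → Integrable fun E =>
      v E * (approxDelta η (p.1 - E) * approxDelta η (p.2 - E)) := by
    intro v b hv hb
    have hb0 : 0 ≤ b := (norm_nonneg _).trans (hb 0)
    have h2 := (hδi p.2).bdd_mul (c := b * (Real.pi * η)⁻¹)
      (f := fun E => v E * approxDelta η (p.1 - E))
      (hv.mul (hm.comp (measurable_id.const_sub _))).aestronglyMeasurable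
      (Eventually.of_forall fun q => by
        rw [norm_mul, Real.norm_of_nonneg (approxDelta_nonneg hη.le _)]
        exact mul_le_mul (hb _) (approxDelta_le hη _) (approxDelta_nonneg hη.le _) hb0)
    simpa only [mul_assoc] using h2
  have hw : ∀ E : ℝ, ‖(1 + E ^ 2)⁻¹‖ ≤ 1 := fun E => by
    rw [Real.norm_of_nonneg (by positivity)]
    exact inv_le_one_of_one_le₀ (by nlinarith [sq_nonneg E])
  have h1 := hi (v := fun _ => dslope f p.2 p.1) (b := ‖dslope f p.2 p.1‖) measurable_const
    fun _ => le_rfl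
  have h2 := hi hg hA
  have h3 := hi (v := fun E => (1 + E ^ 2)⁻¹) (by fun_prop) hw
  -- The semigroup law spreads the kernel of width 2η over E, so that both terms are integrals
  -- against the same product of kernels of width η.
  rw [mul_comm, ← integral_approxDelta_mul_approxDelta hη, ← integral_const_mul,
      ← integral_sub h1 h2]
  have h4 : Integrable fun E => κ * ((1 + E ^ 2)⁻¹ *
      (approxDelta η (p.1 - E) * approxDelta η (p.2 - E)))
      + C * (η / Real.pi) * (approxDelta η (p.1 - E) + approxDelta η (p.2 - E)) :=
    (h3.const_mul κ).add (((hδi p.1).add (hδi p.2)).const_mul _)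
  refine (norm_integral_le_of_norm_le h4 (Eventually.of_forall fun E => ?_)).trans_eq ?_
  · have d1 := approxDelta_nonneg hη.le (p.1 - E)
    have d2 := approxDelta_nonneg hη.le (p.2 - E)
    have e1 := sq_mul_approxDelta_le hη (p.1 - E)
    have e2 := sq_mul_approxDelta_le hη (p.2 - E)
    set a := approxDelta η (p.1 - E)
    set b := approxDelta η (p.2 - E)
    have hw0 : (0 : ℝ) ≤ (1 + E ^ 2)⁻¹ := by positivity
    have hw1 := hw E
    rw [Real.norm_of_nonneg hw0] at hw1
    rw [← sub_mul, norm_mul, Real.norm_of_nonneg (mul_nonneg d1 d2), hc, Real.norm_eq_abs]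
    -- In the quadratic part one Poisson kernel absorbs the square, as u² δ_η(u) ≤ η/π, and the
    -- other integrates to 1 over E. There are two such terms, hence the factor 2.
    calc |g c - g E| * (a * b) ≤ ((κ + C * (c - E) ^ 2) * (1 + E ^ 2)⁻¹) * (a * b) := by
          gcongr
          exact hclose c E
      _ = κ * ((1 + E ^ 2)⁻¹ * (a * b)) + C * (1 + E ^ 2)⁻¹ * ((c - E) ^ 2 * (a * b)) := by ring
      _ ≤ κ * ((1 + E ^ 2)⁻¹ * (a * b)) + C * 1 * (((p.2 - E) ^ 2 + (p.1 - E) ^ 2) * (a * b)) := by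
          gcongr
          exact hcE E
      _ = κ * ((1 + E ^ 2)⁻¹ * (a * b))
          + C * (((p.2 - E) ^ 2 * b) * a + ((p.1 - E) ^ 2 * a) * b) := by ring
      _ ≤ κ * ((1 + E ^ 2)⁻¹ * (a * b)) + C * ((η / Real.pi) * a + (η / Real.pi) * b) := by
          gcongr
      _ = _ := by ring
  · rw [integral_add (h3.const_mul κ) (by exact ((hδi p.1).add (hδi p.2)).const_mul _),
    integral_const_mul,
      integral_const_mul, integral_add (hδi _) (hδi _), integral_sub_left_eq_self (approxDelta η),
      integral_sub_left_eq_self (approxDelta η), integral_approxDelta hη]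
    ring

/-- The smallness κ is fixed first and η sent to 0 afterwards. The weight 1/(1+E²) makes the uniform
bound M integrable in E with total πM. -/
lemma tendsto_kernel_sub {f g : ℝ → ℝ} (hf : ∀ x, HasDerivAt f (g x) x) (hg : Measurable g)
    {A : ℝ} (hA : ∀ x, |g x| ≤ A)
    (hclose : ∀ κ, 0 < κ → ∃ C, 0 ≤ C ∧
      ∀ c E, |g c - g E| ≤ (κ + C * (c - E) ^ 2) * (1 + E ^ 2)⁻¹)
    {M : ℝ} (hM : ∀ η E : ℝ, 0 < η →
      ∫ p, approxDelta η (p.1 - E) * approxDelta η (p.2 - E) ∂μ ≤ M) :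
    Tendsto (fun η => (∫ p, approxDelta (2 * η) (p.1 - p.2) * dslope f p.2 p.1 ∂μ)
      - ∫ E, g E * ∫ p, approxDelta η (p.1 - E) * approxDelta η (p.2 - E) ∂μ) (𝓝[>] 0) (𝓝 0) := by
  have hw : ∀ E : ℝ, ‖(1 + E ^ 2)⁻¹‖ ≤ 1 := fun E => by
    rw [Real.norm_of_nonneg (by positivity)]
    exact inv_le_one_of_one_le₀ (by nlinarith [sq_nonneg E])
  have hwm : Measurable fun E : ℝ => (1 + E ^ 2)⁻¹ := by fun_prop
  have hA0 : 0 ≤ A := (abs_nonneg _).trans (hA 0)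
  have hM0 : 0 ≤ M := by
    refine le_trans (integral_nonneg fun p => ?_) (hM 1 0 one_pos)
    exact mul_nonneg (approxDelta_nonneg zero_le_one _) (approxDelta_nonneg zero_le_one _)
  have key : ∀ {κ C : ℝ}, 0 < κ → 0 ≤ C →
      (∀ c E, |g c - g E| ≤ (κ + C * (c - E) ^ 2) * (1 + E ^ 2)⁻¹) → ∀ {η : ℝ}, 0 < η →
      ‖(∫ p, approxDelta (2 * η) (p.1 - p.2) * dslope f p.2 p.1 ∂μ)
      - ∫ E, g E * ∫ p, approxDelta η (p.1 - E) * approxDelta η (p.2 - E) ∂μ‖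
      ≤ κ * (M * Real.pi) + 2 * C * (η / Real.pi) * μ.real Set.univ := by
    intro κ C hκ hC hcl η hη
    rw [← integral_integral_approxDelta hη hg hA]
    have i1 : Integrable (fun p : ℝ × ℝ => approxDelta (2 * η) (p.1 - p.2) * dslope f p.2 p.1) μ
        := by
      refine Integrable.of_bound (((measurable_approxDelta _).comp (by fun_prop)).mul
        (measurable_dslope hf hg)).aestronglyMeasurable ((Real.pi * (2 * η))⁻¹ * A)
        (Eventually.of_forall fun p => ?_)
      obtain ⟨c, hc, -⟩ := dslope_eq_deriv hf p.2 p.1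
      rw [norm_mul, Real.norm_of_nonneg (approxDelta_nonneg (by positivity) _), hc]
      exact mul_le_mul (approxDelta_le (by positivity) _) (hA c) (norm_nonneg _) (by positivity)
    have i2 := (integrable_mul_approxDelta_prod (μ := μ) hη hg hA).integral_prod_left
    have i3 := (integrable_mul_approxDelta_prod (μ := μ) hη hwm hw).integral_prod_left
    dsimp only at i2 i3
    rw [← integral_sub i1 i2]
    refine (norm_integral_le_of_norm_le ((i3.const_mul κ).add (integrable_const _))
      (Eventually.of_forall fun p => norm_kernel_sub_le hf hg hA hC hcl hη p)).trans ?_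
    rw [integral_add' (i3.const_mul κ) (integrable_const _), integral_const_mul, integral_const,
      smul_eq_mul, integral_integral_approxDelta hη hwm hw, mul_comm (μ.real _)]
    gcongr
    have i4 := (integrable_mul_approxDelta_prod (μ := μ) hη hwm hw).integral_prod_right
    dsimp only at i4
    simp_rw [integral_const_mul] at i4
    calc ∫ E : ℝ, (1 + E ^ 2)⁻¹ * ∫ p, approxDelta η (p.1 - E) * approxDelta η (p.2 - E) ∂μ
        ≤ ∫ E : ℝ, (1 + E ^ 2)⁻¹ * M := integral_mono i4 (integrable_inv_one_add_sq.mul_const M)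
          fun E => mul_le_mul_of_nonneg_left (hM η E hη) (by positivity)
      _ = M * Real.pi := by rw [integral_mul_const, integral_univ_inv_one_add_sq, mul_comm]
  rw [Metric.tendsto_nhds]
  intro ε hε
  -- This κ makes κMπ at most ε/2; the added 1 covers M = 0.
  obtain ⟨C, hC, hcl⟩ := hclose (ε / (2 * (M * Real.pi + 1))) (by positivity)
  have hlim : Tendsto (fun η : ℝ => 2 * C * (η / Real.pi) * μ.real Set.univ) (𝓝[>] 0) (𝓝 0) := by
    have : Continuous fun η : ℝ => 2 * C * (η / Real.pi) * μ.real Set.univ := by fun_prop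
    simpa using (this.tendsto 0).mono_left nhdsWithin_le_nhds
  filter_upwards [hlim.eventually_lt_const (half_pos hε), self_mem_nhdsWithin] with η h1 h2
  rw [dist_zero_right]
  refine (key (by positivity) hC hcl h2).trans_lt ?_
  have h3 : ε / (2 * (M * Real.pi + 1)) * (M * Real.pi) ≤ ε / 2 := by
    rw [div_mul_eq_mul_div, div_le_div_iff₀ (by positivity) two_pos]
    nlinarith [mul_nonneg hM0 Real.pi_pos.le]
  linarith

end Kernel

/-! ### Estimates for the Fermi distribution -/

section Fermi

variable {T : ℝ} (EF : ℝ)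

lemma fermi_pos (T E : ℝ) : 0 < fermi T EF E := by unfold fermi; positivity

lemma fermi_lt_one (T E : ℝ) : fermi T EF E < 1 := by
  unfold fermi
  exact inv_lt_one_of_one_lt₀ (by linarith [Real.exp_pos ((E - EF) / T)])

/-- The derivative of the Fermi distribution. -/
lemma hasDerivAt_fermi (T E : ℝ) :
    HasDerivAt (fermi T EF) (-(fermi T EF E * (1 - fermi T EF E)) / T) E := by
  have h1 : HasDerivAt (fun E => 1 + Real.exp ((E - EF) / T))
      (Real.exp ((E - EF) / T) * (1 / T)) E :=
    ((((hasDerivAt_id E).sub_const EF).div_const T).exp).const_add 1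
  have h2 : 1 + Real.exp ((E - EF) / T) ≠ 0 := by positivity
  refine (h1.inv h2).congr_deriv ?_
  unfold fermi
  field_simp
  ring

lemma deriv_fermi (T E : ℝ) :
    deriv (fermi T EF) E = -(fermi T EF E * (1 - fermi T EF E)) / T :=
  (hasDerivAt_fermi EF T E).deriv

lemma hasDerivAt_fermi' (T E : ℝ) : HasDerivAt (fermi T EF) (deriv (fermi T EF) E) E :=
  (hasDerivAt_fermi EF T E).congr_deriv (deriv_fermi EF T E).symm

lemma hasDerivAt_deriv_fermi (T E : ℝ) :
    HasDerivAt (deriv (fermi T EF))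
      (deriv (fermi T EF) E * (-(1 - 2 * fermi T EF E) / T)) E := by
  have h : deriv (fermi T EF) = fun E => -(fermi T EF E * (1 - fermi T EF E)) / T :=
    funext (deriv_fermi EF T)
  have h1 := hasDerivAt_fermi' EF T E
  rw [h]
  refine ((h1.mul (h1.const_sub 1)).neg.div_const T).congr_deriv ?_
  rw [deriv_fermi]
  ring

lemma continuous_deriv_fermi (T : ℝ) : Continuous (deriv (fermi T EF)) :=
  continuous_iff_continuousAt.2 fun E => (hasDerivAt_deriv_fermi EF T E).continuousAt

lemma abs_deriv_fermi (hT : 0 < T) (E : ℝ) :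
    |deriv (fermi T EF) E| = -deriv (fermi T EF) E := by
  rw [abs_of_nonpos]
  rw [deriv_fermi, neg_div]
  have h1 := fermi_pos EF T E
  have h2 := fermi_lt_one EF T E
  have : 0 ≤ fermi T EF E * (1 - fermi T EF E) / T :=
    div_nonneg (mul_nonneg h1.le (by linarith)) hT.le
  linarith

/-- With u = (E − EF)/T one has f(1 − f) = 1/(2 + e^u + e^{−u}), and e^v ≥ 1 + v²/2 for v ≥ 0.
Quadratic decay is all that is needed later. -/
lemma abs_deriv_fermi_le (hT : 0 < T) (E : ℝ) :
    |deriv (fermi T EF) E| ≤ T⁻¹ * (1 + ((E - EF) / T) ^ 2 / 2)⁻¹ := by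
  rw [abs_deriv_fermi EF hT, deriv_fermi, neg_div, neg_neg, div_eq_mul_inv, mul_comm]
  gcongr
  set u := (E - EF) / T with hu
  have h1 : fermi T EF E * (1 - fermi T EF E) = (2 + (Real.exp u + Real.exp (-u)))⁻¹ := by
    unfold fermi
    rw [← hu, Real.exp_neg]
    have := Real.exp_pos u
    field_simp
    ring
  rw [h1]
  refine inv_anti₀ (by positivity) ?_
  have h2 : ∀ v : ℝ, 0 ≤ v → 1 + v ^ 2 / 2 ≤ Real.exp v := fun v hv => by
    linarith [Real.quadratic_le_exp_of_nonneg hv]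
  rcases le_total 0 u with h | h
  · linarith [h2 u h, Real.exp_pos (-u)]
  · have := h2 (-u) (by linarith)
    rw [neg_sq] at this
    linarith [Real.exp_pos u]

lemma exists_abs_deriv_fermi_le (hT : 0 < T) :
    ∃ A, 0 ≤ A ∧ ∀ E, |deriv (fermi T EF) E| ≤ A * (1 + E ^ 2)⁻¹ := by
  refine ⟨T⁻¹ * (1 + 2 * EF ^ 2 + 4 * T ^ 2), by positivity, fun E => ?_⟩
  refine (abs_deriv_fermi_le EF hT E).trans ?_
  rw [mul_assoc]
  gcongr
  rw [← div_eq_mul_inv, inv_eq_one_div, div_le_div_iff₀ (by positivity) (by positivity)]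
  set u := (E - EF) / T with hu
  have hE : E = EF + T * u := by rw [hu]; field_simp; ring
  rw [hE]
  nlinarith [sq_nonneg (EF - T * u), sq_nonneg (EF * u), sq_nonneg (T * u), sq_nonneg T,
    sq_nonneg u, sq_nonneg EF]

/-- For |c − E| ≤ 1, f' is Lipschitz with constant B/(1+E²), and B r ≤ κ + B² r²/(4κ) with r = |c −
E|. For |c − E| ≥ 1 the two derivatives are bounded separately and the factor (c − E)² ≥ 1 absorbs
the rest. -/
lemma exists_deriv_fermi_sub_le (hT : 0 < T) {κ : ℝ} (hκ : 0 < κ) : ∃ C, 0 ≤ C ∧ ∀ c E,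
    |deriv (fermi T EF) c - deriv (fermi T EF) E| ≤ (κ + C * (c - E) ^ 2) * (1 + E ^ 2)⁻¹ := by
  obtain ⟨A, hA, hg⟩ := exists_abs_deriv_fermi_le EF hT
  -- From |f''| ≤ |f'|/T and `hcomp` on the unit ball around E, where 2(1 + (x − E)²) ≤ 4.
  set B := 4 * A / T with hB
  -- Peetre's inequality, which moves the weight from x to E.
  have hcomp : ∀ x E : ℝ, (1 + x ^ 2)⁻¹ ≤ 2 * (1 + (x - E) ^ 2) * (1 + E ^ 2)⁻¹ := by
    intro x E
    rw [← div_eq_mul_inv, inv_eq_one_div, div_le_div_iff₀ (by positivity) (by positivity)]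
    nlinarith [sq_nonneg (x - (E - x)), sq_nonneg (x * (x - E)), sq_nonneg x, sq_nonneg (x - E)]
  refine ⟨B ^ 2 / (4 * κ) + 5 * A, by positivity, fun c E => ?_⟩
  have hw : (0 : ℝ) ≤ (1 + E ^ 2)⁻¹ := by positivity
  rcases le_total |c - E| 1 with h | h
  · have h1 : ‖deriv (fermi T EF) c - deriv (fermi T EF) E‖ ≤ B * (1 + E ^ 2)⁻¹ * ‖c - E‖ := by
      refine Convex.norm_image_sub_le_of_norm_hasDerivWithin_le (s := Metric.closedBall E 1)
        (fun x hx => (hasDerivAt_deriv_fermi EF T x).hasDerivWithinAt) (fun x hx => ?_)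
        (convex_closedBall E 1) (Metric.mem_closedBall_self zero_le_one) (by
          rwa [Metric.mem_closedBall, Real.dist_eq])
      have hx' : (x - E) ^ 2 ≤ 1 := by
        rw [Metric.mem_closedBall, Real.dist_eq] at hx
        exact (sq_le_one_iff_abs_le_one _).2 hx
      have h2 : |(-(1 - 2 * fermi T EF x) / T)| ≤ T⁻¹ := by
        rw [abs_div, abs_of_pos hT, abs_neg, div_eq_mul_inv]
        refine mul_le_of_le_one_left (by positivity) ?_
        rw [abs_le]
        constructor <;> linarith [fermi_pos EF T x, fermi_lt_one EF T x]
      rw [norm_mul, Real.norm_eq_abs, Real.norm_eq_abs]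
      calc |deriv (fermi T EF) x| * |(-(1 - 2 * fermi T EF x) / T)|
          ≤ (A * (2 * (1 + (x - E) ^ 2) * (1 + E ^ 2)⁻¹)) * T⁻¹ := by
            refine mul_le_mul ((hg x).trans ?_) h2 (abs_nonneg _) (by positivity)
            exact mul_le_mul_of_nonneg_left (hcomp x E) hA
        _ ≤ (A * (2 * (1 + 1) * (1 + E ^ 2)⁻¹)) * T⁻¹ := by gcongr
        _ = B * (1 + E ^ 2)⁻¹ := by rw [hB]; ring
    have h3 : B * |c - E| ≤ κ + B ^ 2 / (4 * κ) * (c - E) ^ 2 := by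
      have h4 : 0 ≤ (2 * κ - B * |c - E|) ^ 2 / (4 * κ) := by positivity
      have h5 : (2 * κ - B * |c - E|) ^ 2 / (4 * κ)
          = κ - B * |c - E| + B ^ 2 / (4 * κ) * |c - E| ^ 2 := by
        field_simp; ring
      rw [h5, sq_abs] at h4
      linarith
    calc |deriv (fermi T EF) c - deriv (fermi T EF) E| ≤ B * |c - E| * (1 + E ^ 2)⁻¹ := by
          refine h1.trans_eq ?_
          rw [Real.norm_eq_abs]; ring
      _ ≤ _ := by
        gcongr
        nlinarith [sq_nonneg (c - E)]
  · have h2 : 1 ≤ (c - E) ^ 2 := (one_le_sq_iff_one_le_abs _).2 h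
    calc |deriv (fermi T EF) c - deriv (fermi T EF) E|
        ≤ |deriv (fermi T EF) c| + |deriv (fermi T EF) E| := abs_sub _ _
      _ ≤ A * (2 * (1 + (c - E) ^ 2) * (1 + E ^ 2)⁻¹) + A * (1 + E ^ 2)⁻¹ :=
        add_le_add ((hg c).trans (mul_le_mul_of_nonneg_left (hcomp c E) hA)) (hg E)
      _ = (A * (3 + 2 * (c - E) ^ 2)) * (1 + E ^ 2)⁻¹ := by ring
      _ ≤ _ := by
        gcongr
        have : 0 ≤ B ^ 2 / (4 * κ) * (c - E) ^ 2 := by positivity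
        nlinarith [mul_nonneg hA (sub_nonneg.2 h2)]

lemma integrable_deriv_fermi (hT : 0 < T) : Integrable (deriv (fermi T EF)) := by
  obtain ⟨A, hA, hg⟩ := exists_abs_deriv_fermi_le EF hT
  exact (integrable_inv_one_add_sq.const_mul A).mono'
    (continuous_deriv_fermi EF T).aestronglyMeasurable (Eventually.of_forall hg)

lemma integral_deriv_fermi (hT : 0 < T) : ∫ E, deriv (fermi T EF) E = -1 := by
  have h1 : Tendsto (fun E => (E - EF) / T) atTop atTop :=
    (tendsto_atTop_add_const_right atTop (-EF) tendsto_id).atTop_div_const hT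
  have h2 : Tendsto (fun E => (E - EF) / T) atBot atBot :=
    (tendsto_atBot_add_const_right atBot (-EF) tendsto_id).atBot_div_const hT
  have h3 : Tendsto (fermi T EF) atTop (𝓝 0) :=
    (tendsto_atTop_add_const_left _ 1 (Real.tendsto_exp_atTop.comp h1)).inv_tendsto_atTop
  have h4 : Tendsto (fermi T EF) atBot (𝓝 1) := by
    have := ((Real.tendsto_exp_atBot.comp h2).const_add 1).inv₀ (by norm_num)
    have h5 : Tendsto (fun E => (1 + Real.exp ((E - EF) / T))⁻¹) atBot (𝓝 1) := by simpa using this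
    exact h5
  rw [integral_of_hasDerivAt_of_tendsto (hasDerivAt_fermi' EF T) (integrable_deriv_fermi EF hT)
    h4 h3]
  norm_num

/-- Away from EF the bound of `abs_deriv_fermi_le` is at most a multiple of T/(1 + (E − EF)²), so
the tail is O(T). -/
lemma tendsto_setIntegral_deriv_fermi {r : ℝ} (hr : 0 < r) :
    Tendsto (fun T => ∫ E in (Metric.ball EF r)ᶜ, |deriv (fermi T EF) E|) (𝓝[>] 0) (𝓝 0) := by
  set c := 2 * (1 + (r ^ 2)⁻¹) with hc
  have hb : ∀ T : ℝ, 0 < T → ∀ E ∈ (Metric.ball EF r)ᶜ,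
      |deriv (fermi T EF) E| ≤ c * T * (1 + (E - EF) ^ 2)⁻¹ := by
    intro T hT E hE
    rw [Set.mem_compl_iff, Metric.mem_ball, Real.dist_eq, not_lt] at hE
    have hE2 : r ^ 2 ≤ (E - EF) ^ 2 := by
      rw [← sq_abs (E - EF)]
      exact pow_le_pow_left₀ hr.le hE 2
    refine (abs_deriv_fermi_le EF hT E).trans ?_
    set v := (E - EF) ^ 2 with hv
    have hvpos : 0 < v := lt_of_lt_of_le (by positivity) hE2
    rw [div_pow, ← hv]
    calc T⁻¹ * (1 + v / T ^ 2 / 2)⁻¹ ≤ T⁻¹ * (v / T ^ 2 / 2)⁻¹ := by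
          gcongr
          linarith
      _ = 2 * T * v⁻¹ := by field_simp
      _ ≤ 2 * T * ((1 + (r ^ 2)⁻¹) * (1 + v)⁻¹) := by
          gcongr
          rw [← div_eq_mul_inv, inv_eq_one_div, div_le_div_iff₀ hvpos (by positivity)]
          have : 1 ≤ (r ^ 2)⁻¹ * v := by
            rw [inv_mul_eq_div, one_le_div (by positivity)]; exact hE2
          nlinarith
      _ = _ := by rw [hc]; ring
  have hint : Integrable fun E => (1 + (E - EF) ^ 2)⁻¹ :=
    integrable_inv_one_add_sq.comp_sub_right EF
  have hle : ∀ T : ℝ, 0 < T → ∫ E in (Metric.ball EF r)ᶜ, |deriv (fermi T EF) E|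
      ≤ c * T * ∫ E in (Metric.ball EF r)ᶜ, (1 + (E - EF) ^ 2)⁻¹ := by
    intro T hT
    rw [← integral_const_mul]
    exact setIntegral_mono_on (integrable_deriv_fermi EF hT).abs.integrableOn
      (hint.const_mul _).integrableOn Metric.isOpen_ball.measurableSet.compl (hb T hT)
  have hlim : Tendsto (fun T => c * T * ∫ E in (Metric.ball EF r)ᶜ, (1 + (E - EF) ^ 2)⁻¹)
      (𝓝[>] 0) (𝓝 0) := by
    have : Continuous fun T => c * T * ∫ E in (Metric.ball EF r)ᶜ, (1 + (E - EF) ^ 2)⁻¹ := by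
      fun_prop
    simpa using (this.tendsto 0).mono_left nhdsWithin_le_nhds
  exact tendsto_of_tendsto_of_tendsto_of_le_of_le' tendsto_const_nhds hlim
    (Eventually.of_forall fun T => integral_nonneg fun E => abs_nonneg _)
    (eventually_nhdsWithin_of_forall fun T hT => hle T hT)

end Fermi

lemma tendsto_half_nhdsGT_zero : Tendsto (fun η : ℝ => η / 2) (𝓝[>] 0) (𝓝[>] 0) := by
  refine tendsto_nhdsWithin_iff.2 ⟨?_, eventually_nhdsWithin_of_forall fun η hη => half_pos
      (Set.mem_Ioi.1 hη)⟩
  have : Continuous fun η : ℝ => η / 2 := by fun_prop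
  simpa using (this.tendsto 0).mono_left nhdsWithin_le_nhds

/-! ### Comparison of the conductivities and the two limits -/

section Conductivity

variable {d : ℕ} {k : Lattice d → ℝ} {ℙ : Measure (Environment d)}

lemma kuboConductivity_eq {lam : ℝ} {i j : Fin d} {μ : Fin 4 → Measure (ℝ × ℝ)}
    [∀ l, IsFiniteMeasure (μ l)]
    (hμ : ∀ S, MeasurableSet S →
      conductivityMeasure k lam ℙ i j S = ∑ l, phase l / 4 * ((μ l).real S : ℂ))
    (EF : ℝ) {T η : ℝ} (hT : 0 < T) (hη : 0 < η) :
    kuboConductivity k lam ℙ i j EF T η = -(Real.pi : ℂ) * ∑ l, phase l / 4 *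
      ((∫ p, approxDelta η (p.1 - p.2) * dslope (fermi T EF) p.2 p.1 ∂(μ l) : ℝ) : ℂ) := by
  obtain ⟨A, hA, hg⟩ := exists_abs_deriv_fermi_le EF hT
  have hf := hasDerivAt_fermi' EF T
  rw [kuboConductivity, vectorIntegral_eq_sum hμ (b := (Real.pi * η)⁻¹ * A)]
  · exact ((measurable_approxDelta η).comp (measurable_fst.sub measurable_snd)).mul
      (measurable_dslope hf (continuous_deriv_fermi EF T).measurable)
  · intro p
    obtain ⟨c, hc, -⟩ := dslope_eq_deriv hf p.2 p.1
    rw [norm_mul, Real.norm_of_nonneg (approxDelta_nonneg hη.le _), hc]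
    refine mul_le_mul (approxDelta_le hη _) ((hg c).trans ?_) (norm_nonneg _) (by positivity)
    exact mul_le_of_le_one_right hA (inv_le_one_of_one_le₀ (by nlinarith [sq_nonneg c]))

lemma measurable_integral_approxDelta (μ : Measure (ℝ × ℝ)) [IsFiniteMeasure μ] (η : ℝ) :
    Measurable fun E => ∫ p, approxDelta η (p.1 - E) * approxDelta η (p.2 - E) ∂μ := by
  have hm := measurable_approxDelta η
  have h : Measurable fun q : ℝ × (ℝ × ℝ) =>
      approxDelta η (q.2.1 - q.1) * approxDelta η (q.2.2 - q.1) :=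
    (hm.comp (by fun_prop)).mul (hm.comp (by fun_prop))
  exact (h.stronglyMeasurable.integral_prod_right' (ν := μ)).measurable

variable [IsProbabilityMeasure ℙ]
  (hk : Summable fun a : Lattice d => (1 + ‖a‖) * |k a|) (hsymm : ∀ a, k (-a) = k a)
  (lam : ℝ) (h_stat : ∀ a : Lattice d, MeasurePreserving (translate a) ℙ ℙ)
  {C : ℝ≥0} (h_bound : ∀ E η : ℝ, 0 < η → greenSecondMoment k lam ℙ E η ≤ C) (i j : Fin d)
include hk hsymm h_stat h_bound

/-- Uniformity in both η and E provides the constant dominating function for both limits.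
Measurability in E is read off the expression by correlation measures. -/
lemma exists_greenConductivity_bound : ∃ M, ∀ η, 0 < η →
    Measurable (fun E => greenConductivity k lam ℙ i j E η) ∧
      ∀ E, |greenConductivity k lam ℙ i j E η| ≤ M := by
  obtain ⟨μ, hfin, hμ, -⟩ := exists_conductivityMeasure_eq hk hsymm lam h_stat i j
  have hG := fun {η : ℝ} (hη : 0 < η) (E : ℝ) =>
    greenConductivity_eq hk hsymm lam h_stat h_bound hμ hη E
  refine ⟨Real.pi * ∑ l, ‖phase l / 4‖ *
    ((∑ m, ‖direction i j (phase l) m‖ ^ 2) * C / Real.pi ^ 2), fun η hη => ⟨?_, fun E => ?_⟩⟩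
  · have h1 : Measurable fun E => (greenConductivity k lam ℙ i j E η : ℂ) := by
      simp_rw [hG hη]
      exact (Finset.measurable_fun_sum _ fun l _ => (Complex.measurable_ofReal.comp
        (measurable_integral_approxDelta (μ l) η)).const_mul _).const_mul _
    exact Complex.measurable_re.comp h1
  · rw [← Real.norm_eq_abs, ← Complex.norm_real, hG hη, norm_mul, Complex.norm_real,
      Real.norm_of_nonneg Real.pi_pos.le]
    refine mul_le_mul_of_nonneg_left ?_ Real.pi_pos.le
    refine (norm_sum_le _ _).trans (Finset.sum_le_sum fun l _ => ?_)
    rw [norm_mul, Complex.norm_real, Real.norm_of_nonneg (integral_nonneg fun p =>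
      mul_nonneg (approxDelta_nonneg hη.le _) (approxDelta_nonneg hη.le _))]
    exact mul_le_mul_of_nonneg_left
      (hasSum_integral_correlation hk hsymm lam h_stat h_bound (hμ l) hη E).2 (norm_nonneg _)

/-- The Kubo conductivity and the smeared Green function sum have the same asymptotics. -/
lemma tendsto_kuboConductivity_add (EF : ℝ) {T : ℝ} (hT : 0 < T) :
    Tendsto (fun η => kuboConductivity k lam ℙ i j EF T (2 * η)
      + ((∫ E, deriv (fermi T EF) E * greenConductivity k lam ℙ i j E η : ℝ) : ℂ))
      (𝓝[>] 0) (𝓝 0) := by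
  obtain ⟨μ, hfin, hμ, hm⟩ := exists_conductivityMeasure_eq hk hsymm lam h_stat i j
  obtain ⟨A, hA, hg⟩ := exists_abs_deriv_fermi_le EF hT
  have hgA : ∀ E, |deriv (fermi T EF) E| ≤ A := fun E => (hg E).trans
    (mul_le_of_le_one_right hA (inv_le_one_of_one_le₀ (by nlinarith [sq_nonneg E])))
  have hb : ∀ l, ∀ η E : ℝ, 0 < η →
      ∫ p, approxDelta η (p.1 - E) * approxDelta η (p.2 - E) ∂(μ l)
      ≤ (∑ m, ‖direction i j (phase l) m‖ ^ 2) * C / Real.pi ^ 2 := fun l η E hη =>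
    (hasSum_integral_correlation hk hsymm lam h_stat h_bound (hμ l) hη E).2
  -- The kernel comparison is made for each of the four positive measures and recombined with the
  -- polarization coefficients.
  have h1 : ∀ l, Tendsto (fun η => -(Real.pi : ℂ) * (phase l / 4 * (((∫ p, approxDelta (2 * η)
      (p.1 - p.2) * dslope (fermi T EF) p.2 p.1 ∂(μ l)) - ∫ E, deriv (fermi T EF) E *
      ∫ p, approxDelta η (p.1 - E) * approxDelta η (p.2 - E) ∂(μ l) : ℝ) : ℂ))) (𝓝[>] 0) (𝓝 0) := by
    intro l
    have h := tendsto_kernel_sub (hasDerivAt_fermi' EF T) (continuous_deriv_fermi EF T).measurable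
      hgA (fun κ hκ => exists_deriv_fermi_sub_le EF hT hκ) (hb l)
    have h2 := (((Complex.continuous_ofReal.tendsto 0).comp h).const_mul (phase l / 4)).const_mul
      (-(Real.pi : ℂ))
    simpa using h2
  have h2 := tendsto_finsetSum Finset.univ fun l _ => h1 l
  rw [Finset.sum_const_zero] at h2
  refine h2.congr' (eventually_nhdsWithin_of_forall fun η hη => ?_)
  have hη' : 0 < η := hη
  have hi : ∀ l, Integrable fun E => ((deriv (fermi T EF) E *
      ∫ p, approxDelta η (p.1 - E) * approxDelta η (p.2 - E) ∂(μ l) : ℝ) : ℂ) := by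
    intro l
    refine Integrable.ofReal (𝕜 := ℂ) ?_
    refine (integrable_deriv_fermi EF hT).mul_bdd
      (c := (∑ m, ‖direction i j (phase l) m‖ ^ 2) * C / Real.pi ^ 2)
      (measurable_integral_approxDelta (μ l) η).aestronglyMeasurable
      (Eventually.of_forall fun E => ?_)
    rw [Real.norm_of_nonneg (integral_nonneg fun p =>
      mul_nonneg (approxDelta_nonneg hη'.le _) (approxDelta_nonneg hη'.le _))]
    exact hb l η E hη'
  have h3 : ((∫ E, deriv (fermi T EF) E * greenConductivity k lam ℙ i j E η : ℝ) : ℂ)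
      = Real.pi * ∑ l, phase l / 4 * ((∫ E, deriv (fermi T EF) E *
        ∫ p, approxDelta η (p.1 - E) * approxDelta η (p.2 - E) ∂(μ l) : ℝ) : ℂ) := by
    have e : ∀ l, phase l / 4 * ((∫ E, deriv (fermi T EF) E *
        ∫ p, approxDelta η (p.1 - E) * approxDelta η (p.2 - E) ∂(μ l) : ℝ) : ℂ)
        = ∫ E, phase l / 4 * ((deriv (fermi T EF) E *
        ∫ p, approxDelta η (p.1 - E) * approxDelta η (p.2 - E) ∂(μ l) : ℝ) : ℂ) := fun l => by
      rw [integral_const_mul, integral_complex_ofReal]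
    rw [Finset.sum_congr rfl fun l _ => e l,
      ← integral_finsetSum _ fun l _ => (hi l).const_mul _, ← integral_const_mul,
      ← integral_complex_ofReal]
    refine integral_congr_ae (Eventually.of_forall fun E => ?_)
    dsimp only
    rw [Complex.ofReal_mul, greenConductivity_eq hk hsymm lam h_stat h_bound hμ hη' E,
      Finset.mul_sum, Finset.mul_sum, Finset.mul_sum]
    refine Finset.sum_congr rfl fun l _ => ?_
    push_cast
    ring
  dsimp only
  rw [kuboConductivity_eq hm EF hT (by positivity : 0 < 2 * η), h3, ← Finset.mul_sum, neg_mul,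
      neg_mul,
    ← sub_eq_neg_add, ← mul_sub, ← Finset.sum_sub_distrib, ← mul_neg, ← Finset.sum_neg_distrib]
  congr 1
  refine Finset.sum_congr rfl fun l _ => ?_
  push_cast
  ring

/-- The limit function inherits the uniform bound, and measurability along η = 1/(n+1); dominated
convergence handles the smeared sum. The comparison is at 2η, so the claim follows after replacing η
by η/2. -/
lemma integrable_and_tendsto_kuboConductivity (EF : ℝ) {σt : ℝ → ℝ}
    (hσ : ∀ E : ℝ, Tendsto (greenConductivity k lam ℙ i j E) (𝓝[>] 0) (𝓝 (σt E)))
    {T : ℝ} (hT : 0 < T) :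
    Integrable (fun E => deriv (fermi T EF) E * σt E) ∧
      Tendsto (kuboConductivity k lam ℙ i j EF T) (𝓝[>] 0)
        (𝓝 (((-∫ E, deriv (fermi T EF) E * σt E : ℝ)) : ℂ)) := by
  obtain ⟨M, hM⟩ := exists_greenConductivity_bound hk hsymm lam h_stat h_bound i j
  have hgm := (continuous_deriv_fermi EF T).aestronglyMeasurable (μ := volume)
  have hgi := integrable_deriv_fermi EF hT
  have hσM : ∀ E, |σt E| ≤ M := fun E => le_of_tendsto (hσ E).abs
    (eventually_nhdsWithin_of_forall fun η hη => (hM η hη).2 E)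
  have hσm : AEStronglyMeasurable σt volume := by
    have hpos : ∀ n : ℕ, (0 : ℝ) < 1 / ((n : ℝ) + 1) := fun n => by positivity
    refine aestronglyMeasurable_of_tendsto_ae (u := atTop)
      (f := fun (n : ℕ) E => greenConductivity k lam ℙ i j E (1 / ((n : ℝ) + 1)))
      (fun n => (hM _ (hpos n)).1.aestronglyMeasurable) (Eventually.of_forall fun E => ?_)
    exact (hσ E).comp (tendsto_nhdsWithin_iff.2
      ⟨tendsto_one_div_add_atTop_nhds_zero_nat, Eventually.of_forall hpos⟩)
  refine ⟨hgi.mul_bdd hσm (Eventually.of_forall hσM), ?_⟩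
  have h1 : Tendsto (fun η => ∫ E, deriv (fermi T EF) E * greenConductivity k lam ℙ i j E η)
      (𝓝[>] 0) (𝓝 (∫ E, deriv (fermi T EF) E * σt E)) := by
    refine tendsto_integral_filter_of_dominated_convergence
      (fun E => ‖deriv (fermi T EF) E‖ * M) ?_ ?_ (hgi.norm.mul_const M)
      (Eventually.of_forall fun E => (hσ E).const_mul _)
    · exact eventually_nhdsWithin_of_forall fun η hη =>
        hgm.mul (hM η hη).1.aestronglyMeasurable
    · refine eventually_nhdsWithin_of_forall fun η hη => Eventually.of_forall fun E => ?_
      rw [norm_mul]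
      exact mul_le_mul_of_nonneg_left ((hM η hη).2 E) (norm_nonneg _)
  have h2 := (tendsto_kuboConductivity_add hk hsymm lam h_stat h_bound i j EF hT).sub
    ((Complex.continuous_ofReal.tendsto _).comp h1)
  have h3 := h2.comp tendsto_half_nhdsGT_zero
  refine (h3.congr fun η => ?_).trans_eq ?_
  · simp [mul_div_cancel₀]
  · simp

/-- Four errors of size ε/4: the comparison with the smeared sum, the variation of σt on a small
ball around EF, the defect of convergence inside that ball, and the tail of −f' outside it. T is
chosen for the tail alone, then η. -/
lemma eventually_norm_kuboConductivity_sub_lt (EF : ℝ) {σt : ℝ → ℝ} {U : Set ℝ} (hU : U ∈ 𝓝 EF)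
    (hσ : ∀ E ∈ U, Tendsto (greenConductivity k lam ℙ i j E) (𝓝[>] 0) (𝓝 (σt E)))
    (hcont : ContinuousOn σt U) {ε : ℝ} (hε : 0 < ε) :
    ∀ᶠ T in 𝓝[>] (0 : ℝ), ∀ᶠ η in 𝓝[>] (0 : ℝ),
      ‖kuboConductivity k lam ℙ i j EF T η - (σt EF : ℂ)‖ < ε := by
  obtain ⟨M, hM⟩ := exists_greenConductivity_bound hk hsymm lam h_stat h_bound i j
  set s := σt EF with hs
  have hM0 : 0 ≤ M := (abs_nonneg _).trans ((hM 1 one_pos).2 0)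
  have hcat : ContinuousAt σt EF := hcont.continuousAt hU
  obtain ⟨r, hr, hball⟩ := Metric.mem_nhds_iff.1 (inter_mem hU
    (hcat (Metric.ball_mem_nhds s (ε := ε / 4) (by positivity))))
  have htail := (tendsto_setIntegral_deriv_fermi EF hr).const_mul (M + |s|)
  rw [mul_zero] at htail
  filter_upwards [htail.eventually_lt_const (by positivity : 0 < ε / 4), self_mem_nhdsWithin]
    with T hT1 hT
  have hT : 0 < T := hT
  set g := deriv (fermi T EF) with hg
  set G := fun η E => greenConductivity k lam ℙ i j E η with hG
  have hgi : Integrable g := integrable_deriv_fermi EF hT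
  have hgabs : ∫ E, |g E| = 1 := by
    simp_rw [hg, abs_deriv_fermi EF hT]
    rw [integral_neg, integral_deriv_fermi EF hT, neg_neg]
  have hGs : ∀ η, 0 < η → ∀ E, |G η E - s| ≤ M + |s| := fun η hη E =>
    (abs_sub _ _).trans (add_le_add ((hM η hη).2 E) le_rfl)
  have hGm : ∀ η, 0 < η → Measurable fun E => |G η E - s| := fun η hη =>
    continuous_abs.measurable.comp ((hM η hη).1.sub_const s)
  have hmS : MeasurableSet (Metric.ball EF r) := Metric.isOpen_ball.measurableSet
  -- Convergence to σt on the ball is only pointwise in E. The part of |G η E − s| in excess of ε/4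
  -- tends to 0 at each point, since |σt E − s| < ε/4 there, and dominated convergence replaces
  -- uniformity.
  have hJ : Tendsto (fun η => ∫ E in Metric.ball EF r, |g E| * max (|G η E - s| - ε / 4) 0)
      (𝓝[>] 0) (𝓝 0) := by
    suffices h : Tendsto (fun η => ∫ E in Metric.ball EF r, |g E| * max (|G η E - s| - ε / 4) 0)
        (𝓝[>] 0) (𝓝 (∫ E in Metric.ball EF r, |g E| * 0)) by
      simpa only [mul_zero, integral_zero] using h
    refine tendsto_integral_filter_of_dominated_convergence (fun E => |g E| * (M + |s|)) ?_ ?_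
      (hgi.abs.mul_const _).integrableOn ?_
    · exact eventually_nhdsWithin_of_forall fun η hη =>
        (hgi.abs.aestronglyMeasurable.mul
          (((hGm η hη).sub_const _).max measurable_const).aestronglyMeasurable).restrict
    · refine eventually_nhdsWithin_of_forall fun η hη => Eventually.of_forall fun E => ?_
      rw [norm_mul, Real.norm_eq_abs, abs_abs, Real.norm_of_nonneg (le_max_right _ _)]
      refine mul_le_mul_of_nonneg_left (max_le ?_ (by positivity)) (abs_nonneg _)
      linarith [hGs η hη E]
    · refine (ae_restrict_iff' hmS).2 (Eventually.of_forall fun E hE => ?_)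
      obtain ⟨hEU, hEs⟩ := hball hE
      have hEs' : |σt E - s| < ε / 4 := by
        simpa [Real.dist_eq] using hEs
      have h1 := (((hσ E hEU).sub_const s).abs.sub_const (ε / 4)).max
        (tendsto_const_nhds (x := (0 : ℝ)))
      rw [max_eq_right (by linarith)] at h1
      exact h1.const_mul _
  have hev : ∀ᶠ η in 𝓝[>] (0 : ℝ), ‖kuboConductivity k lam ℙ i j EF T (2 * η) - (s : ℂ)‖ < ε := by
    have hadd := (tendsto_kuboConductivity_add hk hsymm lam h_stat h_bound i j EF hT).norm
    rw [norm_zero] at hadd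
    filter_upwards [hadd.eventually_lt_const (by positivity : 0 < ε / 4),
      hJ.eventually_lt_const (by positivity : 0 < ε / 4), self_mem_nhdsWithin] with η h1 h2 hη
    have hη : 0 < η := hη
    have hgG : Integrable fun E => g E * G η E :=
      hgi.mul_bdd (hM η hη).1.aestronglyMeasurable (Eventually.of_forall (hM η hη).2)
    have hi : Integrable fun E => |g E| * |G η E - s| :=
      hgi.abs.mul_bdd (c := M + |s|) (hGm η hη).aestronglyMeasurable
        (Eventually.of_forall fun E => by rw [Real.norm_eq_abs, abs_abs]; exact hGs η hη E)
    have hi2 : Integrable fun E => |g E| * max (|G η E - s| - ε / 4) 0 :=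
      hgi.abs.mul_bdd (c := M + |s|)
        (((hGm η hη).sub_const _).max measurable_const).aestronglyMeasurable
        (Eventually.of_forall fun E => by
          rw [Real.norm_of_nonneg (le_max_right _ _)]
          exact max_le (by linarith [hGs η hη E]) (by positivity))
    have e1 : (∫ E, g E * G η E) + s = ∫ E, g E * (G η E - s) := by
      simp_rw [mul_sub]
      rw [integral_sub hgG (hgi.mul_const s), integral_mul_const, hg, integral_deriv_fermi EF hT]
      ring
    have e2 : |(∫ E, g E * G η E) + s| ≤ ∫ E, |g E| * |G η E - s| := by
      rw [e1]
      simp_rw [← abs_mul]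
      exact abs_integral_le_integral_abs
    have e3 : ∫ E in Metric.ball EF r, |g E| * |G η E - s| ≤ ε / 4
        + ∫ E in Metric.ball EF r, |g E| * max (|G η E - s| - ε / 4) 0 := by
      have e4 : ∫ E in Metric.ball EF r, |g E| * (ε / 4) ≤ ε / 4 := by
        refine (setIntegral_le_integral (hgi.abs.mul_const _)
          (Eventually.of_forall fun E => mul_nonneg (abs_nonneg _) (by positivity))).trans_eq ?_
        rw [integral_mul_const, hgabs, one_mul]
      refine le_trans ?_ (add_le_add_left e4 _)
      rw [← integral_add (hgi.abs.mul_const _).integrableOn hi2.integrableOn]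
      refine integral_mono hi.integrableOn
        ((hgi.abs.mul_const _).integrableOn.add hi2.integrableOn) fun E => ?_
      dsimp only [Pi.add_apply]
      rw [← mul_add]
      refine mul_le_mul_of_nonneg_left ?_ (abs_nonneg _)
      linarith [le_max_left (|G η E - s| - ε / 4) 0]
    have e5 : ∫ E in (Metric.ball EF r)ᶜ, |g E| * |G η E - s|
        ≤ (M + |s|) * ∫ E in (Metric.ball EF r)ᶜ, |g E| := by
      rw [← integral_const_mul]
      refine integral_mono hi.integrableOn (hgi.abs.const_mul _).integrableOn fun E => ?_
      dsimp only
      rw [mul_comm]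
      exact mul_le_mul_of_nonneg_right (hGs η hη E) (abs_nonneg _)
    rw [← integral_add_compl hmS hi] at e2
    have e6 : kuboConductivity k lam ℙ i j EF T (2 * η) - (s : ℂ)
        = (kuboConductivity k lam ℙ i j EF T (2 * η) + ((∫ E, g E * G η E : ℝ) : ℂ))
          - (((∫ E, g E * G η E) + s : ℝ) : ℂ) := by
      push_cast; ring
    rw [e6]
    refine (norm_sub_le _ _).trans_lt ?_
    rw [Complex.norm_real, Real.norm_eq_abs]
    linarith
  refine (tendsto_half_nhdsGT_zero.eventually hev).mono fun η hη => ?_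
  rwa [mul_div_cancel₀ _ (two_ne_zero' ℝ)] at hη

end Conductivity

end Kubo

end

/-- The iterated limit is stated with nested eventualities, which is equivalent to the lim–limsup
form and does not presuppose that the limit η ↓ 0 exists at fixed T. -/
theorem mainTheorem6 (d : ℕ)
    -- short-range hopping without magnetic field, real and symmetric (time-reversal invariance)
    (k : Kubo.Lattice d → ℝ) (hk_symm : ∀ a, k (-a) = k a)
    (hk_short : Summable fun a : Kubo.Lattice d => (1 + ‖a‖) * |k a|)
    (lam : ℝ)
    -- stationary random potential
    (ℙ : MeasureTheory.Measure (Kubo.Environment d)) [MeasureTheory.IsProbabilityMeasure ℙ]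
    (h_stat : ∀ a : Kubo.Lattice d, MeasureTheory.MeasurePreserving (Kubo.translate a) ℙ ℙ)
    -- the bound, uniform in `η > 0` and in the energy
    (C : ℝ≥0)
    (h_bound : ∀ E η : ℝ, 0 < η → Kubo.greenSecondMoment k lam ℙ E η ≤ C)
    (i j : Fin d) (EF : ℝ) :
    -- positive temperature
    (∀ σt : ℝ → ℝ,
      (∀ E : ℝ, Tendsto (Kubo.greenConductivity k lam ℙ i j E) (𝓝[>] 0) (𝓝 (σt E))) →
      ∀ T : ℝ, 0 < T →
        MeasureTheory.Integrable (fun E => deriv (Kubo.fermi T EF) E * σt E) ∧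
        Tendsto (Kubo.kuboConductivity k lam ℙ i j EF T) (𝓝[>] 0)
          (𝓝 (((-∫ E, deriv (Kubo.fermi T EF) E * σt E : ℝ)) : ℂ))) ∧
    -- zero-temperature limit
    (∀ (σt : ℝ → ℝ) (U : Set ℝ), U ∈ 𝓝 EF →
      (∀ E ∈ U, Tendsto (Kubo.greenConductivity k lam ℙ i j E) (𝓝[>] 0) (𝓝 (σt E))) →
      ContinuousOn σt U →
      ∀ ε : ℝ, 0 < ε → ∀ᶠ T in 𝓝[>] (0 : ℝ), ∀ᶠ η in 𝓝[>] (0 : ℝ),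
        ‖Kubo.kuboConductivity k lam ℙ i j EF T η - (σt EF : ℂ)‖ < ε) :=
  ⟨fun _ hσ _ hT => Kubo.integrable_and_tendsto_kuboConductivity hk_short hk_symm lam h_stat
      h_bound i j EF hσ hT,
    fun _ _ hU hσ hcont _ hε => Kubo.eventually_norm_kuboConductivity_sub_lt hk_short hk_symm lam
      h_stat h_bound i j EF hU hσ hcont hε⟩
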